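/- **Setting.** A *CPT parameter set* consists of a continuous increasing utility function $u:\mathbb R\to\mathbb R$ and two continuous increasing weighting functions $w^+,w^-:[0,1]\to[0,1]$ ("increasing" meaning non-decreasing). A (rational) *prospect* $(\vec o,\vec p)$ consists of rational outcomes $o_1<\dots<o_k$, one of which is $0$, and rational probabilities $p_i\ge 0$ with $\sum_i p_i=1$. The *CPT-function* is $$\mathsf{cpt}(\vec o,\vec p)=\sum_{i=1}^k u(o_i)\,\pi_i,\qquad \pi_i=\begin{cases} w^+\big(\sum_{m\ge i}p_m\big)-w^+\big(\sum_{m>i}p_m\big) & o_i>0,\\ 0 & o_i=0,\\ w^-\big(\sum_{m\le i}p_m\big)-w^-\big(\sum_{m<i}p_m\big) & o_i<0.\end{cases}$$ Let $\mathsf M$ be a finite Markov chain with rational transition probabilities and an initial state, and let $\mathbb P_{\mathsf M}$ be its probability measure on infinite paths from the initial state. A *weighted reachability objective* $\Phi=(F,r)$ consists of a set $F$ of target states and rewards $r:F\to\mathbb Q$; the value $\Phi(\rho)$ of a path $\rho$ is the reward of the first state of $F$ on $\rho$, and $0$ if $\rho$ never visits $F$. With $\mathsf{outc}(\Phi)=r(F)\cup\{0\}$,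 the *CPT-value* is $$\mathsf{CPT\text{-}val}(\mathsf M,\Phi)=\sum_{\substack{o\in\mathsf{outc}(\Phi)\\ o>0}}u(o)\Big(w^+\big(\mathbb P_{\mathsf M}(\Phi\ge o)\big)-w^+\big(\mathbb P_{\mathsf M}(\Phi>o)\big)\Big)+\sum_{\substack{o\in\mathsf{outc}(\Phi)\\ o<0}}u(o)\Big(w^-\big(\mathbb P_{\mathsf M}(\Phi\le o)\big)-w^-\big(\mathbb P_{\mathsf M}(\Phi<o)\big)\Big).$$ An instance of the *CPT-value approximation problem for Markov chains* consists of such $\mathsf M$ and $\Phi$, a rational precision $\varepsilon>0$ and a rational threshold $v$, with all numbers written in binary. The answer has to be *true* if $\mathsf{CPT\text{-}val}(\mathsf M,\Phi)>v+\varepsilon$, *false* if $\mathsf{CPT\text{-}val}(\mathsf M,\Phi)<v-\varepsilon$, and may be either otherwise. An *oracle for* $\mathsf{cpt}$ answers each query, consisting of a prospect $(\vec o,\vec p)$ and a rational $\eta>0$ (in binary), in one step by the binary expansion of an integer $m$ with $|m\eta-\mathsf{cpt}(\vec o,\vec p)|\le\eta$. Writing down the query, and reading the digits of the answer one by one, costs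 time. **Theorem (MC complexity).** Given an oracle for $\mathsf{cpt}$, the CPT-value approximation problem for finite Markov chains is in $\mathbf{PTIME}$: there are a single oracle machine (a random access machine with logarithmic cost) and a polynomial $P$ such that, for every CPT parameter set, every oracle for its function $\mathsf{cpt}$ and every instance $(\mathsf M,\Phi,\varepsilon,v)$ of binary length $\ell$, the machine halts within time $P(\ell)$ and returns a correct answer. -/

import Mathlib

open MeasureTheory ProbabilityTheory

/-! ## Cumulative prospect theory -/

/-- The parameters of cumulative prospect theory: a continuous increasing utility function and two
continuous increasing probability weighting functions `[0,1] → [0,1]`, for gains and for losses. -/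
structure CPTParams where
  u : ℝ → ℝ
  wPlus : ℝ → ℝ
  wMinus : ℝ → ℝ
  u_mono : Monotone u
  u_cont : Continuous u
  wPlus_mono : MonotoneOn wPlus (Set.Icc 0 1)
  wPlus_cont : ContinuousOn wPlus (Set.Icc 0 1)
  wPlus_mapsTo : Set.MapsTo wPlus (Set.Icc 0 1) (Set.Icc 0 1)
  wMinus_mono : MonotoneOn wMinus (Set.Icc 0 1)
  wMinus_cont : ContinuousOn wMinus (Set.Icc 0 1)
  wMinus_mapsTo : Set.MapsTo wMinus (Set.Icc 0 1) (Set.Icc 0 1)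

/-- The probability of an outcome ranked strictly higher than the `i`-th one. -/
noncomputable def gainRank {k : ℕ} (p : Fin k → ℝ) (i : Fin k) : ℝ := ∑ m ∈ Finset.Ioi i, p m

/-- The probability of an outcome ranked strictly lower than the `i`-th one. -/
noncomputable def lossRank {k : ℕ} (p : Fin k → ℝ) (i : Fin k) : ℝ := ∑ m ∈ Finset.Iio i, p m

open Classical in
/-- The decision weight of the `i`-th outcome of the prospect `(o, p)`. -/
noncomputable def decisionWeight (C : CPTParams) {k : ℕ} (o p : Fin k → ℝ) (i : Fin k) : ℝ :=
  if 0 < o i then C.wPlus (p i + gainRank p i) - C.wPlus (gainRank p i)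
  else if o i < 0 then C.wMinus (p i + lossRank p i) - C.wMinus (lossRank p i)
  else 0

/-- The CPT-function on the prospect `(o, p)`, where `o` is increasing. -/
noncomputable def cptFun (C : CPTParams) {k : ℕ} (o p : Fin k → ℝ) : ℝ :=
  ∑ i, C.u (o i) * decisionWeight C o p i

/-- A prospect with rational data: a probability distribution over finitely many outcomes, which
are listed in increasing order and include `0`. -/
structure Prospect where
  k : ℕ
  o : Fin k → ℚ
  p : Fin k → ℚ
  o_strictMono : StrictMono o
  zero_mem : ∃ i, o i = 0
  p_nonneg : ∀ i, 0 ≤ p i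
  p_sum : ∑ i, p i = 1

/-- The CPT-function on a rational prospect. -/
noncomputable def Prospect.cpt (C : CPTParams) (x : Prospect) : ℝ :=
  cptFun C (fun i => (x.o i : ℝ)) (fun i => (x.p i : ℝ))

/-! ## Finite Markov chains and weighted reachability -/

/-- A finite Markov chain with rational transition probabilities; its states are numbered. -/
structure MarkovChain where
  n : ℕ
  init : Fin n
  δ : Fin n → Fin n → ℚ
  δ_nonneg : ∀ s t, 0 ≤ δ s t
  δ_sum : ∀ s, ∑ t, δ s t = 1

namespace MarkovChain

/-- The distribution of the successor of the state `s`. -/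
noncomputable def next (M : MarkovChain) (s : Fin M.n) : PMF (Fin M.n) :=
  PMF.ofFintype (fun t => ENNReal.ofReal (M.δ s t)) (by
    rw [← ENNReal.ofReal_sum_of_nonneg (fun t _ => by exact_mod_cast M.δ_nonneg s t),
      ← Rat.cast_sum, M.δ_sum s]
    simp)

/-- The transition kernel from histories `ρ₀ … ρᵢ` to the next state `ρᵢ₊₁`: it depends on the
current state `ρᵢ` only. -/
noncomputable def step (M : MarkovChain) (i : ℕ) :
    Kernel ((j : Finset.Iic i) → (fun _ : ℕ => Fin M.n) j) (Fin M.n) :=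
  Kernel.ofFunOfCountable (fun h => (M.next (h ⟨i, Finset.mem_Iic.2 le_rfl⟩)).toMeasure)

instance (M : MarkovChain) (i : ℕ) : IsMarkovKernel (M.step i) :=
  ⟨fun h => by
    change IsProbabilityMeasure (M.next (h ⟨i, Finset.mem_Iic.2 le_rfl⟩)).toMeasure
    infer_instance⟩

/-- The probability measure on infinite paths `ρ : ℕ → Fin M.n` starting in the initial state. -/
noncomputable def pathMeasure (M : MarkovChain) : Measure (ℕ → Fin M.n) :=
  Kernel.traj (X := fun _ => Fin M.n) M.step 0 (fun _ => M.init)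

end MarkovChain

/-- A weighted reachability objective: a set of target states and a reward for each of them. -/
structure WRObjective (n : ℕ) where
  F : Finset (Fin n)
  r : {s // s ∈ F} → ℚ

namespace WRObjective

open Classical in
/-- The value of a path: the reward of the first target state on it, and `0` if there is none. -/
noncomputable def value {n : ℕ} (Φ : WRObjective n) (ρ : ℕ → Fin n) : ℚ :=
  if h : ∃ i, ρ i ∈ Φ.F then Φ.r ⟨ρ (Nat.find h), Nat.find_spec h⟩ else 0

/-- The set of outcomes: all rewards, and `0`. -/
def outcomes {n : ℕ} (Φ : WRObjective n) : Finset ℚ :=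
  insert 0 (Finset.univ.image Φ.r)

end WRObjective

/-- The CPT-value of a Markov chain (there are no choices, so there is no supremum over
strategies). -/
noncomputable def cptValue (C : CPTParams) (M : MarkovChain) (Φ : WRObjective M.n) : ℝ :=
  ∑ o ∈ Φ.outcomes with 0 < o, C.u o *
      (C.wPlus (M.pathMeasure.real {ρ | o ≤ Φ.value ρ}) -
        C.wPlus (M.pathMeasure.real {ρ | o < Φ.value ρ})) +
    ∑ o ∈ Φ.outcomes with o < 0, C.u o *
      (C.wMinus (M.pathMeasure.real {ρ | Φ.value ρ ≤ o}) -
        C.wMinus (M.pathMeasure.real {ρ | Φ.value ρ < o}))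

/-! ## Encodings -/

/-- A rational is presented by its reduced numerator and its positive denominator. -/
def encodeRat (q : ℚ) : List ℤ := [q.num, (q.den : ℤ)]

/-- An instance of the CPT-value approximation problem for Markov chains. -/
structure ApproxInstance where
  M : MarkovChain
  Φ : WRObjective M.n
  ε : ℚ
  ε_pos : 0 < ε
  v : ℚ

/-- An instance as a list of integers: the number of states, the initial state, the transition
matrix row by row, for each state a flag telling whether it is a target together with its reward
(`0` for the other states), the precision and the threshold. -/
def ApproxInstance.encode (I : ApproxInstance) : List ℤ :=
  [(I.M.n : ℤ), (I.M.init : ℕ)] ++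
    (List.ofFn fun s => (List.ofFn fun t => encodeRat (I.M.δ s t)).flatten).flatten ++
    (List.ofFn fun s =>
      if h : s ∈ I.Φ.F then 1 :: encodeRat (I.Φ.r ⟨s, h⟩) else 0 :: encodeRat 0).flatten ++
    encodeRat I.ε ++ encodeRat I.v

/-- The query asking for the CPT-function on the prospect `x` with precision `η`. -/
def Prospect.encodeQuery (x : Prospect) (η : ℚ) : List ℤ :=
  encodeRat η ++ (List.ofFn fun i => encodeRat (x.o i) ++ encodeRat (x.p i)).flatten

/-- An integer in binary: the sign, then the binary digits, least significant first, without
superfluous zeros. -/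
def encodeIntBits (m : ℤ) : List Bool := decide (m < 0) :: Nat.bits m.natAbs

/-! ## Random access machines with logarithmic cost and an oracle -/

/-- An oracle answers each query, a list of integers, by a bit string. -/
abbrev Oracle := List ℤ → List Bool

/-- `O` is an oracle for the CPT-function: given a prospect and a precision `η > 0`, it answers with
the binary expansion of an integer `m` such that `m * η` is an `η`-approximation of the value of
the CPT-function. Nothing is assumed about its answers to malformed queries. -/
def IsCPTOracle (C : CPTParams) (O : Oracle) : Prop :=
  ∀ (x : Prospect) (η : ℚ), 0 < η →
    ∃ m : ℤ, O (x.encodeQuery η) = encodeIntBits m ∧ |(m : ℝ) * (η : ℝ) - x.cpt C| ≤ (η : ℝ)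

/-- The length of an integer in binary, with one extra digit for the sign. -/
def intLen (z : ℤ) : ℕ := Nat.size z.natAbs + 1

/-- The size of a list of integers: the total length of its binary encoding. -/
def listSize (l : List ℤ) : ℕ := (l.map intLen).sum

namespace RAM

/-- The state of the machine: registers holding integers, and the answer to the latest oracle
query. -/
structure State where
  mem : ℕ → ℤ
  ans : List Bool

/-- Operands: a constant; the register `i`; the register whose address is held by the register `i`;
the entry of the read-only input, or the digit of the latest oracle answer, whose position is held
by the register `i`. -/
inductive Operand
  | const (z : ℤ)
  | reg (i : ℕ)
  | ind (i : ℕ)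
  | inp (i : ℕ)
  | ans (i : ℕ)

/-- Where a result is stored: in the register `i`, or in the register whose address is held by the
register `i`. -/
inductive Dest
  | reg (i : ℕ)
  | ind (i : ℕ)

inductive Op
  | add
  | sub
  | mul
  | div

def Op.eval : Op → ℤ → ℤ → ℤ
  | .add, x, y => x + y
  | .sub, x, y => x - y
  | .mul, x, y => x * y
  | .div, x, y => x / y

/-- Programs. `set d op a b` stores the result of an operation in `d`; `query a` asks the oracle about
the list that is stored in memory from address `a` on, preceded by its length; `ifPos a` and
`whilePos a` test whether the value of `a` is positive. -/
inductive Cmd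
  | skip
  | set (d : Dest) (op : Op) (a b : Operand)
  | query (a : Operand)
  | seq (c₁ c₂ : Cmd)
  | ifPos (a : Operand) (c₁ c₂ : Cmd)
  | whilePos (a : Operand) (c : Cmd)

/-- A digit of an answer: `1` for the bit `0`, `2` for the bit `1`, and `0` past the end. -/
def digit (l : List Bool) (j : ℕ) : ℤ :=
  match l[j]? with
  | none => 0
  | some false => 1
  | some true => 2

def Operand.eval (input : List ℤ) (σ : State) : Operand → ℤ
  | const z => z
  | reg i => σ.mem i
  | ind i => σ.mem (σ.mem i).toNat
  | inp i => input.getD (σ.mem i).toNat 0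
  | ans i => digit σ.ans (σ.mem i).toNat

/-- The logarithmic cost of reading an operand: the lengths of all addresses and values involved. -/
def Operand.cost (input : List ℤ) (σ : State) : Operand → ℕ
  | const z => intLen z
  | reg i => intLen i + intLen (σ.mem i)
  | ind i => intLen i + intLen (σ.mem i) + intLen (σ.mem (σ.mem i).toNat)
  | inp i => intLen i + intLen (σ.mem i) + intLen (input.getD (σ.mem i).toNat 0)
  | ans i => intLen i + intLen (σ.mem i) + intLen (digit σ.ans (σ.mem i).toNat)

def Dest.addr (σ : State) : Dest → ℕ
  | reg i => i
  | ind i => (σ.mem i).toNat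

def Dest.cost (σ : State) : Dest → ℕ
  | reg i => intLen i
  | ind i => intLen i + intLen (σ.mem i)

/-- The list stored from address `a` on: its length `L` at address `a`, its entries at the addresses
`a + 1, …, a + L`. -/
def State.block (σ : State) (a : ℕ) : List ℤ :=
  (List.range (σ.mem a).toNat).map fun j => σ.mem (a + 1 + j)

/-- `Exec O input c σ t σ'`: with oracle `O`, on the given input, the program `c` started in the state
`σ` halts after time `t` in the state `σ'`. Every command costs one unit plus the length of all
numbers that it handles; the oracle itself answers in one unit of time. -/
inductive Exec (O : Oracle) (input : List ℤ) : Cmd → State → ℕ → State → Prop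
  | skip (σ : State) : Exec O input .skip σ 1 σ
  | set (d : Dest) (op : Op) (a b : Operand) (σ : State) :
      Exec O input (.set d op a b) σ (1 + d.cost σ + a.cost input σ + b.cost input σ)
        { σ with
          mem := Function.update σ.mem (d.addr σ) (op.eval (a.eval input σ) (b.eval input σ)) }
  | query (a : Operand) (σ : State) :
      Exec O input (.query a) σ
        (1 + a.cost input σ + intLen (σ.mem (a.eval input σ).toNat) +
          listSize (σ.block (a.eval input σ).toNat))
        { σ with ans := O (σ.block (a.eval input σ).toNat) }
  | seq {c₁ c₂ : Cmd} {σ₁ σ₂ σ₃ : State} {t₁ t₂ : ℕ} :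
      Exec O input c₁ σ₁ t₁ σ₂ → Exec O input c₂ σ₂ t₂ σ₃ →
      Exec O input (.seq c₁ c₂) σ₁ (t₁ + t₂) σ₃
  | ifPos_pos {a : Operand} {c₁ c₂ : Cmd} {σ σ' : State} {t : ℕ} :
      0 < a.eval input σ → Exec O input c₁ σ t σ' →
      Exec O input (.ifPos a c₁ c₂) σ (1 + a.cost input σ + t) σ'
  | ifPos_neg {a : Operand} {c₁ c₂ : Cmd} {σ σ' : State} {t : ℕ} :
      ¬ 0 < a.eval input σ → Exec O input c₂ σ t σ' →
      Exec O input (.ifPos a c₁ c₂) σ (1 + a.cost input σ + t) σ'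
  | while_pos {a : Operand} {c : Cmd} {σ₁ σ₂ σ₃ : State} {t₁ t₂ : ℕ} :
      0 < a.eval input σ₁ → Exec O input c σ₁ t₁ σ₂ →
      Exec O input (.whilePos a c) σ₂ t₂ σ₃ →
      Exec O input (.whilePos a c) σ₁ (1 + a.cost input σ₁ + t₁ + t₂) σ₃
  | while_neg {a : Operand} {c : Cmd} {σ : State} :
      ¬ 0 < a.eval input σ → Exec O input (.whilePos a c) σ (1 + a.cost input σ) σ

/-- Initially all registers are `0` and no oracle answer is present. -/
def State.initial : State := ⟨fun _ => 0, []⟩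

/-- The program `c`, with oracle `O`, halts on the given input within time `T` and returns `b`; a
program returns `true` if the register `0` is positive when it halts, and `false` otherwise. -/
def ReturnsWithin (O : Oracle) (c : Cmd) (input : List ℤ) (T : ℕ) (b : Bool) : Prop :=
  ∃ t σ, Exec O input c State.initial t σ ∧ t ≤ T ∧ b = decide (0 < σ.mem 0)

end RAM

/-- `b` is an admissible answer to the instance `I` of the CPT-value approximation problem. -/
def ApproxInstance.Correct (C : CPTParams) (I : ApproxInstance) (b : Bool) : Prop :=
  ((I.v : ℝ) + (I.ε : ℝ) < cptValue C I.M I.Φ → b = true) ∧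
    (cptValue C I.M I.Φ < (I.v : ℝ) - (I.ε : ℝ) → b = false)

/-! ## Lengths of integers -/

/-! The value `Φ` of a path is a random variable with finitely many outcomes, and the probability
sums inside the decision weights are its tail probabilities. So the CPT-value is the CPT-function of
one rational prospect, the law of `Φ` (`MarkovChain.prospect_cpt`). One query for that prospect with
precision `ε` is enough: the answer `m` satisfies `|m ε - val| ≤ ε`, hence the test `v < m ε` is
right as soon as `val` is farther than `ε` from `v` (`ApproxInstance.correct_of_approx`). It remains
to compute the law exactly in polynomial time, and to perform the test although `m` may be too long
to be read.

The law. For a target `t`, the probabilities of entering the target set at `t` solve the usual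
linear equations, with the value `0` at the states that cannot reach a target. These conditions
determine the solution: the matrix is nonsingular by a maximum principle
(`IsReachMatrix.det_ne_zero`), and any solution gives the probability because the mass that has not
yet entered the target set dies out on all states that can reach it (`tendsto_avoiding`,
`firstHit_eq`). Multiplied by a common denominator `D`, the matrix `A` is integral. The
Faddeev–LeVerrier recursion then yields an integer matrix `B` and an integer `c ≠ 0` with `A * B =
-c`, using only matrix products and exact divisions (`leVerrier_eq`, `mul_leVerrier`). Its entries
are bounded by powers of `2 n² D` (`abs_leVerrier_le`), so they have polynomially many digits. Equal
rewards are merged, outcomes are sorted by counting the smaller ones, and Euclid's algorithm brings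
the probabilities to lowest terms, as the format of the query demands.

The answer. Nothing bounds `m` in terms of the instance, since `u` is an arbitrary function. But the
test compares `m` times a positive integer with a fixed integer of absolute value below `2 ^ s`, so
replacing `|m|` by `min |m| (2 ^ s)` does not change its result (`saturate_mul_sub_pos_iff`), and
reading `s` binary digits together with two further positions, the sign and the one that shows
whether `|m| ≥ 2 ^ s`, is enough.

The machine. The algorithm is written in a small language with arrays and loops whose numbers of
iterations are fixed on entry. Its correctness is a Hoare-style statement `Ensures`, which also
asserts that all stored numbers and all loops are bounded by one parameter `L`. Under this
assumption a compiler to the random access machine is correct and has running time polynomial in `L`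
(`Stmt.exec_compile`, `exists_polynomial_cost`), and `L` is taken polynomial in the length of the
instance (`exists_setting`). -/

theorem intLen_pos (z : ℤ) : 1 ≤ intLen z := Nat.le_add_left _ _

theorem intLen_le_iff {z : ℤ} {k : ℕ} : intLen z ≤ k + 1 ↔ z.natAbs < 2 ^ k := by
  rw [intLen, Nat.add_le_add_iff_right, Nat.size_le]

theorem intLen_mono {y z : ℤ} (h : y.natAbs ≤ z.natAbs) : intLen y ≤ intLen z :=
  Nat.add_le_add_right (Nat.size_le_size h) 1

theorem intLen_natCast_lt {i k : ℕ} (h : i < 2 ^ k) : intLen (i : ℤ) ≤ k + 1 :=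
  intLen_le_iff.2 (by simpa using h)

theorem two_pow_add_two_pow_le (a b : ℕ) : 2 ^ a + 2 ^ b ≤ 2 ^ (a + b + 1) := by
  rw [pow_succ, pow_add]
  have := Nat.one_le_two_pow (n := a)
  have := Nat.one_le_two_pow (n := b)
  nlinarith

/-- Because lengths are subadditive under all four operations, the value of a fixed expression is
longer than the stored numbers by at most a constant factor. -/
theorem intLen_eval_le (o : RAM.Op) (x y : ℤ) : intLen (o.eval x y) ≤ intLen x + intLen y := by
  obtain ⟨a, ha⟩ := Nat.exists_eq_add_of_le' (intLen_pos x)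
  obtain ⟨b, hb⟩ := Nat.exists_eq_add_of_le' (intLen_pos y)
  have hx := intLen_le_iff.1 ha.le
  have hy := intLen_le_iff.1 hb.le
  have hab := two_pow_add_two_pow_le a b
  rw [ha, hb, show a + 1 + (b + 1) = a + b + 1 + 1 by ring, intLen_le_iff]
  cases o with
  | add => exact lt_of_le_of_lt (Int.natAbs_add_le x y) (by omega)
  | sub => exact lt_of_le_of_lt (Int.natAbs_sub_le x y) (by omega)
  | mul =>
    rw [RAM.Op.eval, Int.natAbs_mul, pow_succ, pow_add]
    exact lt_of_lt_of_le (Nat.mul_lt_mul'' hx hy) (Nat.le_mul_of_pos_right _ two_pos)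
  | div =>
    have : (x / y).natAbs ≤ x.natAbs := Int.natAbs_ediv_le_natAbs x y
    rw [RAM.Op.eval]
    omega

/-! ## A language with bounded loops -/

/-- Positions of the scalar variables and of the arrays in the memory of the machine. -/
class Layout (V A : Type) where
  var : V → ℕ
  var_injective : Function.Injective var
  var_lt : ∀ x, var x < 64
  arr : A → ℕ
  arr_injective : Function.Injective arr
  arr_lt : ∀ a, arr a < 16

namespace Loop

/-- The state of a program: scalar variables, two-dimensional arrays, and the latest answer. -/
structure State (V A : Type) where
  scal : V → ℤ
  arr : A → ℕ → ℕ → ℤ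
  ans : List Bool

inductive Expr (V A : Type)
  | const (z : ℤ)
  | var (x : V)
  | arr (a : A) (r c : Expr V A)
  | inp (e : Expr V A)
  | ans (e : Expr V A)
  | op (o : RAM.Op) (e₁ e₂ : Expr V A)

/-- The number of iterations of a loop is evaluated once, on entry, so `run` is a total function and
time bounds follow by structural recursion. `size` supplies iteration counts that are logarithmic in
a number, as needed for Euclid's algorithm and for reading digits. -/
inductive Stmt (V A : Type)
  | assign (x : V) (e : Expr V A)
  | store (a : A) (r c e : Expr V A)
  | seq (s₁ s₂ : Stmt V A)
  | ite (e : Expr V A) (s₁ s₂ : Stmt V A)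
  | skip
  | loop (x : V) (e : Expr V A) (s : Stmt V A)
  | size (x : V) (e : Expr V A)
  | query (a : A)

variable {V A : Type}

instance : Add (Expr V A) := ⟨.op .add⟩
instance : Sub (Expr V A) := ⟨.op .sub⟩
instance : Mul (Expr V A) := ⟨.op .mul⟩
instance : Div (Expr V A) := ⟨.op .div⟩
instance (n : ℕ) : OfNat (Expr V A) n := ⟨.const n⟩

/-- What the execution of a program depends on: the oracle, the input, the number `S` of rows and of
columns of the arrays, and the bound `L` for the lengths of the stored numbers and for the numbers of
iterations of the loops. -/
structure Context where
  O : Oracle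
  input : List ℤ
  S : ℕ
  L : ℕ

namespace Expr

def eval (X : Context) (σ : State V A) : Expr V A → ℤ
  | const z => z
  | var x => σ.scal x
  | arr a r c => σ.arr a (r.eval X σ).toNat (c.eval X σ).toNat
  | inp e => X.input.getD (e.eval X σ).toNat 0
  | ans e => RAM.digit σ.ans (e.eval X σ).toNat
  | op o e₁ e₂ => o.eval (e₁.eval X σ) (e₂.eval X σ)

/-- All array accesses are within the bounds. -/
def Ok (X : Context) (σ : State V A) : Expr V A → Prop
  | const _ => True
  | var _ => True
  | arr _ r c => r.Ok X σ ∧ c.Ok X σ ∧ (0 ≤ r.eval X σ ∧ r.eval X σ < X.S) ∧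
      0 ≤ c.eval X σ ∧ c.eval X σ < X.S
  | inp e => e.Ok X σ
  | ans e => e.Ok X σ
  | op _ e₁ e₂ => e₁.Ok X σ ∧ e₂.Ok X σ

variable (X : Context) (σ : State V A)

@[simp] theorem eval_const (z : ℤ) : (const z : Expr V A).eval X σ = z := rfl
@[simp] theorem eval_ofNat (n : ℕ) : (no_index (OfNat.ofNat n) : Expr V A).eval X σ = n := rfl
@[simp] theorem eval_var (x : V) : (var x : Expr V A).eval X σ = σ.scal x := rfl
@[simp] theorem eval_arr (a : A) (r c : Expr V A) :
    (arr a r c).eval X σ = σ.arr a (r.eval X σ).toNat (c.eval X σ).toNat := rfl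
@[simp] theorem eval_inp (e : Expr V A) :
    (inp e).eval X σ = X.input.getD (e.eval X σ).toNat 0 := rfl
@[simp] theorem eval_ans (e : Expr V A) :
    (ans e).eval X σ = RAM.digit σ.ans (e.eval X σ).toNat := rfl
@[simp] theorem eval_add (e₁ e₂ : Expr V A) :
    (e₁ + e₂).eval X σ = e₁.eval X σ + e₂.eval X σ := rfl
@[simp] theorem eval_sub (e₁ e₂ : Expr V A) :
    (e₁ - e₂).eval X σ = e₁.eval X σ - e₂.eval X σ := rfl
@[simp] theorem eval_mul (e₁ e₂ : Expr V A) :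
    (e₁ * e₂).eval X σ = e₁.eval X σ * e₂.eval X σ := rfl
@[simp] theorem eval_div (e₁ e₂ : Expr V A) :
    (e₁ / e₂).eval X σ = e₁.eval X σ / e₂.eval X σ := rfl
@[simp] theorem ok_const (z : ℤ) : (const z : Expr V A).Ok X σ ↔ True := Iff.rfl
@[simp] theorem ok_ofNat (n : ℕ) : (no_index (OfNat.ofNat n) : Expr V A).Ok X σ ↔ True := Iff.rfl
@[simp] theorem ok_var (x : V) : (var x : Expr V A).Ok X σ ↔ True := Iff.rfl
@[simp] theorem ok_arr (a : A) (r c : Expr V A) :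
    (arr a r c).Ok X σ ↔ r.Ok X σ ∧ c.Ok X σ ∧ (0 ≤ r.eval X σ ∧ r.eval X σ < X.S) ∧
      0 ≤ c.eval X σ ∧ c.eval X σ < X.S := Iff.rfl
@[simp] theorem ok_inp (e : Expr V A) : (inp e).Ok X σ ↔ e.Ok X σ := Iff.rfl
@[simp] theorem ok_ans (e : Expr V A) : (ans e).Ok X σ ↔ e.Ok X σ := Iff.rfl
@[simp] theorem ok_add (e₁ e₂ : Expr V A) : (e₁ + e₂).Ok X σ ↔ e₁.Ok X σ ∧ e₂.Ok X σ := Iff.rfl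
@[simp] theorem ok_sub (e₁ e₂ : Expr V A) : (e₁ - e₂).Ok X σ ↔ e₁.Ok X σ ∧ e₂.Ok X σ := Iff.rfl
@[simp] theorem ok_mul (e₁ e₂ : Expr V A) : (e₁ * e₂).Ok X σ ↔ e₁.Ok X σ ∧ e₂.Ok X σ := Iff.rfl
@[simp] theorem ok_div (e₁ e₂ : Expr V A) : (e₁ / e₂).Ok X σ ↔ e₁.Ok X σ ∧ e₂.Ok X σ := Iff.rfl

end Expr

/-- Apply `f 0`, …, `f (k - 1)` in turn. -/
def iter {α : Type*} (f : ℕ → α → α) : ℕ → α → α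
  | 0, a => a
  | k + 1, a => f k (iter f k a)

section

variable [DecidableEq V]

def State.set (σ : State V A) (x : V) (z : ℤ) : State V A :=
  { σ with scal := Function.update σ.scal x z }

variable (σ : State V A)

@[simp] theorem State.set_scal (x y : V) (z : ℤ) :
    (σ.set x z).scal y = if y = x then z else σ.scal y := by
  simp [State.set, Function.update_apply]
@[simp] theorem State.set_arr (x : V) (z : ℤ) : (σ.set x z).arr = σ.arr := rfl
@[simp] theorem State.set_ans (x : V) (z : ℤ) : (σ.set x z).ans = σ.ans := rfl

end

section

variable [DecidableEq A]

def State.put (σ : State V A) (a : A) (r c : ℕ) (z : ℤ) : State V A :=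
  { σ with arr := Function.update σ.arr a (Function.update (σ.arr a) r
      (Function.update (σ.arr a r) c z)) }

variable (σ : State V A)

@[simp] theorem State.put_scal (a : A) (r c : ℕ) (z : ℤ) : (σ.put a r c z).scal = σ.scal := rfl
@[simp] theorem State.put_ans (a : A) (r c : ℕ) (z : ℤ) : (σ.put a r c z).ans = σ.ans := rfl
theorem State.put_arr (a b : A) (r c i j : ℕ) (z : ℤ) :
    (σ.put a r c z).arr b i j = if b = a ∧ i = r ∧ j = c then z else σ.arr b i j := by
  by_cases hb : b = a
  · subst hb
    by_cases hi : i = r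
    · subst hi; simp [State.put, Function.update_apply]
    · simp [State.put, hi]
  · simp [State.put, hb]

end

/-- The row `0` of an array occupies consecutive registers, so it can hold a query in the format of
the machine: the length, then the entries. -/
def State.block (σ : State V A) (a : A) : List ℤ :=
  (List.range (σ.arr a 0 0).toNat).map fun j => σ.arr a 0 (1 + j)

namespace Stmt

/-- Together with `arrs` and `queries`, a syntactic bound for what a statement may change. For
concrete programs `decide` settles the side conditions, so invariants need to mention only what
really changes. -/
def vars : Stmt V A → List V
  | assign x _ => [x]
  | store _ _ _ _ => []
  | seq s₁ s₂ => s₁.vars ++ s₂.vars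
  | ite _ s₁ s₂ => s₁.vars ++ s₂.vars
  | skip => []
  | loop x _ s => x :: s.vars
  | size x _ => [x]
  | query _ => []

def arrs : Stmt V A → List A
  | assign _ _ => []
  | store a _ _ _ => [a]
  | seq s₁ s₂ => s₁.arrs ++ s₂.arrs
  | ite _ s₁ s₂ => s₁.arrs ++ s₂.arrs
  | skip => []
  | loop _ _ s => s.arrs
  | size _ _ => []
  | query _ => []

def queries : Stmt V A → Bool
  | seq s₁ s₂ => s₁.queries || s₂.queries
  | ite _ s₁ s₂ => s₁.queries || s₂.queries
  | loop _ _ s => s.queries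
  | query _ => true
  | _ => false

/-- The state `τ` differs from `σ` only where `s` may write. -/
structure Frame (s : Stmt V A) (σ τ : State V A) : Prop where
  scal : ∀ x, x ∉ s.vars → τ.scal x = σ.scal x
  arr : ∀ a, a ∉ s.arrs → τ.arr a = σ.arr a
  ans : s.queries = false → τ.ans = σ.ans

theorem Frame.trans {s : Stmt V A} {σ τ υ : State V A} (h₁ : s.Frame σ τ) (h₂ : s.Frame τ υ) :
    s.Frame σ υ :=
  ⟨fun x hx => (h₂.scal x hx).trans (h₁.scal x hx), fun a ha => (h₂.arr a ha).trans (h₁.arr a ha),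
    fun h => (h₂.ans h).trans (h₁.ans h)⟩

theorem Frame.refl (s : Stmt V A) (σ : State V A) : s.Frame σ σ :=
  ⟨fun _ _ => rfl, fun _ _ => rfl, fun _ => rfl⟩

variable [DecidableEq V] [DecidableEq A]

def run (X : Context) : Stmt V A → State V A → State V A
  | assign x e, σ => σ.set x (e.eval X σ)
  | store a r c e, σ => σ.put a (r.eval X σ).toNat (c.eval X σ).toNat (e.eval X σ)
  | seq s₁ s₂, σ => s₂.run X (s₁.run X σ)
  | ite e s₁ s₂, σ => if 0 < e.eval X σ then s₁.run X σ else s₂.run X σ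
  | skip, σ => σ
  | loop x e s, σ => iter (fun i τ => s.run X (τ.set x i)) (e.eval X σ).toNat σ
  | size x e, σ => σ.set x ((e.eval X σ).toNat.size)
  | query a, σ => { σ with ans := X.O (σ.block a) }

/-- All array accesses are within the bounds, all stored numbers have length at most `L`, and no
loop has more than `L` iterations. -/
def Safe (X : Context) : Stmt V A → State V A → Prop
  | assign _ e, σ => e.Ok X σ ∧ intLen (e.eval X σ) ≤ X.L
  | store a r c e, σ => (Expr.arr a r c).Ok X σ ∧ e.Ok X σ ∧ intLen (e.eval X σ) ≤ X.L
  | seq s₁ s₂, σ => s₁.Safe X σ ∧ s₂.Safe X (s₁.run X σ)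
  | ite e s₁ s₂, σ => e.Ok X σ ∧ if 0 < e.eval X σ then s₁.Safe X σ else s₂.Safe X σ
  | skip, _ => True
  | loop x e s, σ => e.Ok X σ ∧ (0 ≤ e.eval X σ ∧ e.eval X σ ≤ X.L) ∧ ∀ i < (e.eval X σ).toNat,
      s.Safe X ((iter (fun i τ => s.run X (τ.set x i)) i σ).set x i)
  | size _ e, σ => e.Ok X σ ∧ intLen ((e.eval X σ).toNat.size : ℤ) ≤ X.L
  | query a, σ => (σ.arr a 0 0).toNat + 1 ≤ X.S

theorem frame_run (X : Context) (s : Stmt V A) (σ : State V A) : s.Frame σ (s.run X σ) := by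
  induction s generalizing σ with
  | assign x e =>
    refine ⟨fun y hy => ?_, fun _ _ => rfl, fun _ => rfl⟩
    simp only [vars, List.mem_singleton] at hy
    simp [run, hy]
  | store a r c e =>
    refine ⟨fun _ _ => rfl, fun b hb => ?_, fun _ => rfl⟩
    simp only [arrs, List.mem_singleton] at hb
    funext i j
    simp [run, State.put_arr, hb]
  | seq s₁ s₂ h₁ h₂ =>
    have h₁ := h₁ σ
    have h₂ := h₂ (s₁.run X σ)
    refine ⟨fun x hx => ?_, fun a ha => ?_, fun h => ?_⟩
    · simp only [vars, List.mem_append, not_or] at hx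
      exact (h₂.scal x hx.2).trans (h₁.scal x hx.1)
    · simp only [arrs, List.mem_append, not_or] at ha
      exact (h₂.arr a ha.2).trans (h₁.arr a ha.1)
    · simp only [queries, Bool.or_eq_false_iff] at h
      exact (h₂.ans h.2).trans (h₁.ans h.1)
  | ite e s₁ s₂ h₁ h₂ =>
    have h₁ := h₁ σ
    have h₂ := h₂ σ
    refine ⟨fun x hx => ?_, fun a ha => ?_, fun h => ?_⟩
    · simp only [vars, List.mem_append, not_or] at hx
      rw [run]; split_ifs
      exacts [h₁.scal x hx.1, h₂.scal x hx.2]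
    · simp only [arrs, List.mem_append, not_or] at ha
      rw [run]; split_ifs
      exacts [h₁.arr a ha.1, h₂.arr a ha.2]
    · simp only [queries, Bool.or_eq_false_iff] at h
      rw [run]; split_ifs
      exacts [h₁.ans h.1, h₂.ans h.2]
  | skip => exact Frame.refl _ _
  | loop x e s h =>
    rw [run]
    generalize (e.eval X σ).toNat = k
    induction k with
    | zero => exact Frame.refl _ _
    | succ k ih =>
      refine ih.trans ?_
      have h := h ((iter (fun i τ => s.run X (τ.set x i)) k σ).set x k)
      refine ⟨fun y hy => ?_, h.arr, h.ans⟩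
      simp only [vars, List.mem_cons, not_or] at hy
      refine (h.scal y hy.2).trans ?_
      simp [hy.1]
  | size x e =>
    refine ⟨fun y hy => ?_, fun _ _ => rfl, fun _ => rfl⟩
    simp only [vars, List.mem_singleton] at hy
    simp [run, hy]
  | query a => exact ⟨fun _ _ => rfl, fun _ _ => rfl, fun h => by simp [queries] at h⟩

/-- Started in the state `σ`, the program is safe and ends in a state that satisfies `Q`. -/
def Ensures (X : Context) (s : Stmt V A) (σ : State V A) (Q : State V A → Prop) : Prop :=
  s.Safe X σ ∧ Q (s.run X σ)

section

variable {X : Context} {s s₁ s₂ : Stmt V A} {σ : State V A} {Q Q' : State V A → Prop}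
  {x : V} {a : A} {e r c : Expr V A}

theorem Ensures.mono (h : s.Ensures X σ Q) (hQ : ∀ τ, s.Frame σ τ → Q τ → Q' τ) :
    s.Ensures X σ Q' :=
  ⟨h.1, hQ _ (s.frame_run X σ) h.2⟩

theorem Ensures.seq (h : s₁.Ensures X σ Q)
    (h' : ∀ τ, s₁.Frame σ τ → Q τ → s₂.Ensures X τ Q') : (Stmt.seq s₁ s₂).Ensures X σ Q' :=
  have h2 := h' _ (s₁.frame_run X σ) h.2
  ⟨⟨h.1, h2.1⟩, h2.2⟩

theorem ensures_seq_iff :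
    (Stmt.seq s₁ s₂).Ensures X σ Q ↔ s₁.Ensures X σ fun τ => s₂.Ensures X τ Q :=
  and_assoc

theorem ensures_assign_iff :
    (assign x e).Ensures X σ Q ↔
      e.Ok X σ ∧ intLen (e.eval X σ) ≤ X.L ∧ Q (σ.set x (e.eval X σ)) :=
  and_assoc

theorem ensures_store_iff :
    (store a r c e).Ensures X σ Q ↔ (Expr.arr a r c).Ok X σ ∧ e.Ok X σ ∧
      intLen (e.eval X σ) ≤ X.L ∧
        Q (σ.put a (r.eval X σ).toNat (c.eval X σ).toNat (e.eval X σ)) :=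
  ⟨fun h => ⟨h.1.1, h.1.2.1, h.1.2.2, h.2⟩, fun h => ⟨⟨h.1, h.2.1, h.2.2.1⟩, h.2.2.2⟩⟩

theorem ensures_ite_iff :
    (ite e s₁ s₂).Ensures X σ Q ↔
      e.Ok X σ ∧ (0 < e.eval X σ → s₁.Ensures X σ Q) ∧ (¬ 0 < e.eval X σ → s₂.Ensures X σ Q) := by
  by_cases h : 0 < e.eval X σ <;> simp [Ensures, Safe, run, h, and_assoc]

theorem ensures_skip_iff : (skip : Stmt V A).Ensures X σ Q ↔ Q σ :=
  and_iff_right trivial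

theorem ensures_size_iff :
    (size x e).Ensures X σ Q ↔ e.Ok X σ ∧ intLen ((e.eval X σ).toNat.size : ℤ) ≤ X.L ∧
      Q (σ.set x ((e.eval X σ).toNat.size)) :=
  and_assoc

theorem ensures_query_iff :
    (query a).Ensures X σ Q ↔ (σ.arr a 0 0).toNat + 1 ≤ X.S ∧
      Q { σ with ans := X.O (σ.block a) } :=
  Iff.rfl

/-- The rule for loops, with an invariant. -/
theorem ensures_loop (k : ℕ) (I : ℕ → State V A → Prop) (hok : e.Ok X σ)
    (hk : e.eval X σ = k) (hL : k ≤ X.L) (h0 : I 0 σ)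
    (hstep : ∀ i < k, ∀ τ, (loop x e s).Frame σ τ → I i τ → s.Ensures X (τ.set x i) (I (i + 1)))
    (hQ : ∀ τ, (loop x e s).Frame σ τ → I k τ → Q τ) : (loop x e s).Ensures X σ Q := by
  -- The frame relative to the state on entry is carried along with the invariant, so that every
  -- iteration may use that variables not written by the loop have kept their initial values.
  have key : ∀ i ≤ k, (loop x e s).Frame σ (iter (fun i τ => s.run X (τ.set x i)) i σ) ∧
      I i (iter (fun i τ => s.run X (τ.set x i)) i σ) := by
    intro i hi
    induction i with
    | zero => exact ⟨Frame.refl _ _, h0⟩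
    | succ i ih =>
      obtain ⟨h1, h2⟩ := ih (by omega)
      refine ⟨h1.trans ?_, (hstep i hi _ h1 h2).2⟩
      have h := frame_run X s ((iter (fun i τ => s.run X (τ.set x i)) i σ).set x i)
      refine ⟨fun y hy => ?_, h.arr, h.ans⟩
      simp only [vars, List.mem_cons, not_or] at hy
      refine (h.scal y hy.2).trans ?_
      simp [hy.1]
  have hk' : (e.eval X σ).toNat = k := by rw [hk, Int.toNat_natCast]
  have h := key k le_rfl
  refine ⟨⟨hok, by omega, fun i hi => ?_⟩, ?_⟩
  · rw [hk'] at hi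
    obtain ⟨h1, h2⟩ := key i hi.le
    exact (hstep i hi _ h1 h2).1
  · rw [run, hk']
    exact hQ _ h.1 h.2

end

end Stmt

end Loop

/-! ## The Faddeev–LeVerrier algorithm -/

namespace Matrix

open Polynomial

variable {ι R : Type*} [Fintype ι] [DecidableEq ι] [CommRing R]

/-- Jacobi's formula for `det (X - A)`, read off from the Leibniz expansion. Differentiating the
factor in column `i` of the term of `σ` gives `1` if `σ i = i` and `0` otherwise. These are also the
terms of the determinant whose column `i` is replaced by a unit vector, which is a diagonal entry of
the adjugate. -/
theorem trace_adjugate_charmatrix (A : Matrix ι ι R) :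
    (adjugate (charmatrix A)).trace = derivative A.charpoly := by
  have h1 : (adjugate (charmatrix A)).trace = (adjugate (charmatrix A)ᵀ).trace := by
    rw [← adjugate_transpose, trace_transpose]
  rw [h1, charpoly, det_apply', trace, derivative_sum]
  have h2 : ∀ i, (adjugate (charmatrix A)ᵀ).diag i =
      ∑ σ : Equiv.Perm ι, ((Equiv.Perm.sign σ : ℤ) : R[X]) *
        ((∏ j ∈ Finset.univ.erase i, charmatrix A (σ j) j) * if σ i = i then 1 else 0) := by
    intro i
    rw [diag_apply, adjugate_def, transpose_transpose, of_apply, cramer_apply, det_apply']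
    refine Finset.sum_congr rfl fun σ _ => ?_
    congr 1
    rw [← Finset.prod_erase_mul _ _ (Finset.mem_univ i)]
    congr 1
    · refine Finset.prod_congr rfl fun j hj => ?_
      rw [updateCol_ne (Finset.ne_of_mem_erase hj)]
    · rw [updateCol_self, Pi.single_apply]
  simp_rw [h2]
  rw [Finset.sum_comm]
  refine Finset.sum_congr rfl fun σ _ => ?_
  rw [← Finset.mul_sum, ← Polynomial.C_eq_intCast, derivative_C_mul, derivative_prod_finset]
  congr 1
  refine Finset.sum_congr rfl fun i _ => ?_
  congr 1
  by_cases h : σ i = i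
  · simp [h, charmatrix_apply_eq]
  · simp [h]

/-- The coefficient of `X ^ k` in the adjugate of the characteristic matrix. -/
noncomputable def adjCoeff (A : Matrix ι ι R) (k : ℕ) : Matrix ι ι R :=
  (adjugate (charmatrix A)).map fun p => p.coeff k

theorem charmatrix_mul_adjugate_apply (A : Matrix ι ι R) (i j : ι) :
    X * adjugate (charmatrix A) i j - ∑ l, C (A i l) * adjugate (charmatrix A) l j =
      if i = j then A.charpoly else 0 := by
  have h := congrFun (congrFun (mul_adjugate (charmatrix A)) i) j
  rw [smul_apply, one_apply, smul_eq_mul, mul_ite, mul_one, mul_zero] at h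
  rw [charpoly, ← h, mul_apply]
  simp only [charmatrix_apply, sub_mul, Finset.sum_sub_distrib]
  rw [sub_left_inj, Finset.sum_eq_single i]
  · simp
  · intro b _ hb; simp [diagonal_apply_ne _ hb.symm]
  · simp

/-- Compare the coefficients of `X ^ (k + 1)` in `(X - A) * adj (X - A) = charpoly A`. This is the
recursion behind the algorithm. -/
theorem adjCoeff_eq (A : Matrix ι ι R) (k : ℕ) :
    adjCoeff A k = A * adjCoeff A (k + 1) + A.charpoly.coeff (k + 1) • (1 : Matrix ι ι R) := by
  ext i j
  have h := congrArg (fun p => p.coeff (k + 1)) (charmatrix_mul_adjugate_apply A i j)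
  simp only [coeff_sub, coeff_X_mul, finsetSum_coeff, coeff_C_mul] at h
  simp only [adjCoeff, map_apply, add_apply, mul_apply, smul_apply, one_apply, smul_eq_mul]
  rw [sub_eq_iff_eq_add] at h
  rw [h, add_comm]
  congr 1
  split_ifs <;> simp

theorem mul_adjCoeff_zero (A : Matrix ι ι R) :
    A * adjCoeff A 0 = -(A.charpoly.coeff 0 • (1 : Matrix ι ι R)) := by
  ext i j
  have h := congrArg (fun p => p.coeff 0) (charmatrix_mul_adjugate_apply A i j)
  simp only [coeff_sub, coeff_X_mul_zero, finsetSum_coeff, coeff_C_mul] at h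
  simp only [adjCoeff, map_apply, mul_apply, neg_apply, smul_apply, one_apply, smul_eq_mul]
  rw [zero_sub, neg_eq_iff_eq_neg] at h
  rw [h]
  split_ifs <;> simp

/-- Polynomials have finite degree, so the coefficient matrices vanish from some `K` on; above the
degree of the characteristic polynomial the recursion is homogeneous and carries the vanishing down
from `K` to the dimension. -/
theorem adjCoeff_eq_zero [Nontrivial R] (A : Matrix ι ι R) {k : ℕ} (hk : Fintype.card ι ≤ k) :
    adjCoeff A k = 0 := by
  have h1 : ∃ K, ∀ m, K ≤ m → adjCoeff A m = 0 := by
    obtain ⟨K, hK⟩ := (Set.finite_range fun x : ι × ι =>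
      (adjugate (charmatrix A) x.1 x.2).natDegree).bddAbove
    refine ⟨K + 1, fun m hm => ?_⟩
    ext i j
    exact coeff_eq_zero_of_natDegree_lt
      (lt_of_le_of_lt (hK (Set.mem_range_self (i, j))) (Nat.lt_of_succ_le hm))
  obtain ⟨K, hK⟩ := h1
  have h2 : ∀ d, Fintype.card ι ≤ K - d → adjCoeff A (K - d) = 0 := by
    intro d
    induction d with
    | zero => intro _; exact hK _ le_rfl
    | succ d ih =>
      intro hd
      by_cases hKd : K ≤ d
      · rw [Nat.sub_eq_zero_of_le (by omega)] at hd ⊢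
        rw [Nat.sub_eq_zero_of_le hKd] at ih
        exact ih hd
      · rw [adjCoeff_eq, show K - (d + 1) + 1 = K - d by omega, ih (by omega), mul_zero, zero_add,
          coeff_eq_zero_of_natDegree_lt, zero_smul]
        rw [charpoly_natDegree_eq_dim]; omega
  by_cases hkK : K ≤ k
  · exact hK k hkK
  · have := h2 (K - k)
    rw [show K - (K - k) = k by omega] at this
    exact this hk

theorem trace_adjCoeff (A : Matrix ι ι R) (k : ℕ) :
    (adjCoeff A k).trace = A.charpoly.coeff (k + 1) * (k + 1) := by
  rw [← coeff_derivative, ← trace_adjugate_charmatrix, trace, trace, finsetSum_coeff]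
  rfl

/-- Take traces in the recursion and insert `trace_adjCoeff`. This expresses the next coefficient of
the characteristic polynomial through the trace of a matrix that is already known. -/
theorem trace_mul_adjCoeff (A : Matrix ι ι R) {k : ℕ} (hk : k ≤ Fintype.card ι) :
    (A * adjCoeff A k).trace = -((Fintype.card ι - k : ℕ) * A.charpoly.coeff k) := by
  cases k with
  | zero => rw [mul_adjCoeff_zero]; simp [mul_comm]
  | succ k =>
    have h := congrArg trace (adjCoeff_eq A k)
    rw [trace_adjCoeff, trace_add, trace_smul, trace_one, smul_eq_mul] at h
    rw [Nat.cast_sub hk]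
    push_cast
    linear_combination -h

/-- The iterates of the Faddeev–LeVerrier algorithm: after `k` rounds, the product of `A` with the
current auxiliary matrix, and the coefficient of degree `n - k` of the characteristic
polynomial. -/
def leVerrier (A : Matrix ι ι ℤ) : ℕ → Matrix ι ι ℤ × ℤ
  | 0 => (0, 1)
  | k + 1 =>
    let N := A * ((leVerrier A k).1 + (leVerrier A k).2 • (1 : Matrix ι ι ℤ))
    (N, -(N.trace / (k + 1)))

theorem leVerrier_eq (A : Matrix ι ι ℤ) {k : ℕ} (hk : k ≤ Fintype.card ι) :
    leVerrier A k = (A * adjCoeff A (Fintype.card ι - k),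
      A.charpoly.coeff (Fintype.card ι - k)) := by
  induction k with
  | zero =>
    rw [leVerrier, Nat.sub_zero, adjCoeff_eq_zero A le_rfl, mul_zero,
      ← charpoly_natDegree_eq_dim A, coeff_natDegree, (charpoly_monic A).leadingCoeff]
  | succ k ih =>
    have h1 : (leVerrier A k).1 + (leVerrier A k).2 • (1 : Matrix ι ι ℤ) =
        adjCoeff A (Fintype.card ι - (k + 1)) := by
      rw [ih (by omega), adjCoeff_eq A (Fintype.card ι - (k + 1)),
        show Fintype.card ι - (k + 1) + 1 = Fintype.card ι - k by omega]
    rw [leVerrier, h1, trace_mul_adjCoeff A (by omega)]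
    refine Prod.ext rfl ?_
    simp only [show Fintype.card ι - (Fintype.card ι - (k + 1)) = k + 1 by omega]
    -- The trace is `-(k + 1)` times a coefficient of the characteristic polynomial, hence the
    -- integer division is exact.
    rw [← mul_neg]
    push_cast
    rw [Int.mul_ediv_cancel_left _ (by positivity), neg_neg]

/-- The last auxiliary matrix is the inverse up to a scalar, which is the determinant up to sign. -/
theorem mul_leVerrier (A : Matrix ι ι ℤ) {k : ℕ} (hk : k + 1 = Fintype.card ι) :
    A * ((leVerrier A k).1 + (leVerrier A k).2 • (1 : Matrix ι ι ℤ)) =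
      -((leVerrier A (k + 1)).2 • (1 : Matrix ι ι ℤ)) := by
  have h : A * ((leVerrier A k).1 + (leVerrier A k).2 • (1 : Matrix ι ι ℤ)) =
    (leVerrier A (k + 1)).1 := rfl
  rw [h, leVerrier_eq A hk.le, hk, Nat.sub_self, mul_adjCoeff_zero]

theorem leVerrier_ne_zero (A : Matrix ι ι ℤ) (hA : A.det ≠ 0) :
    (leVerrier A (Fintype.card ι)).2 ≠ 0 := by
  rw [leVerrier_eq A le_rfl, Nat.sub_self]
  intro h
  apply hA
  rw [det_eq_sign_charpoly_coeff, show A.charpoly.coeff 0 = 0 from h, mul_zero]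

end Matrix

/-! ## Reachability in Markov chains -/

namespace MarkovChain

open Filter Topology

/-- The state `s` can reach the set `F`. -/
inductive CanReach (M : MarkovChain) (F : Finset (Fin M.n)) : Fin M.n → Prop
  | mem {s : Fin M.n} : s ∈ F → CanReach M F s
  | step {s t : Fin M.n} : 0 < M.δ s t → CanReach M F t → CanReach M F s

/-- The paths that are in the state `s` at time `k` and do not visit `F` before. -/
def avoiding (M : MarkovChain) (F : Finset (Fin M.n)) (k : ℕ) (s : Fin M.n) :
    Set (ℕ → Fin M.n) :=
  {ρ | ρ k = s ∧ ∀ j < k, ρ j ∉ F}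

instance (M : MarkovChain) : IsProbabilityMeasure M.pathMeasure := by
  unfold pathMeasure; infer_instance

variable (M : MarkovChain) (F : Finset (Fin M.n))

theorem measurableSet_avoiding (k : ℕ) (s : Fin M.n) : MeasurableSet (M.avoiding F k s) := by
  unfold avoiding
  measurability

theorem next_toMeasure_singleton (s t : Fin M.n) :
    (M.next s).toMeasure {t} = ENNReal.ofReal (M.δ s t) := by
  rw [PMF.toMeasure_apply_singleton _ _ (measurableSet_singleton t), next, PMF.ofFintype_apply]

/-- The Markov property: the event `avoiding` is determined by the history up to time `k`, and on it
the law of the next state is that of the successors of `s`. -/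
theorem pathMeasure_avoiding_inter (k : ℕ) (s t : Fin M.n) :
    M.pathMeasure (M.avoiding F k s ∩ {ρ | ρ (k + 1) = t}) =
      M.pathMeasure (M.avoiding F k s) * ENNReal.ofReal (M.δ s t) := by
  let B : Set ((j : Finset.Iic k) → (fun _ : ℕ => Fin M.n) j) :=
    {h | h ⟨k, Finset.mem_Iic.2 le_rfl⟩ = s ∧
      ∀ j (hj : j < k), h ⟨j, Finset.mem_Iic.2 hj.le⟩ ∉ F}
  have hB : MeasurableSet B := (Set.toFinite B).measurableSet
  have h1 : M.avoiding F k s = Preorder.frestrictLe k ⁻¹' B := rfl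
  have h2 : M.avoiding F k s ∩ {ρ | ρ (k + 1) = t} =
      (fun x : (i : ℕ) → (fun _ : ℕ => Fin M.n) i => (Preorder.frestrictLe k x, x (k + 1))) ⁻¹'
        (B ×ˢ {t}) := rfl
  have hm : MeasurableSet (B ×ˢ ({t} : Set (Fin M.n))) := hB.prod (measurableSet_singleton t)
  rw [h2, pathMeasure, ← Measure.map_apply (by fun_prop) hm,
    ← Kernel.partialTraj_compProd_eq_map_traj (Nat.zero_le k),
    Measure.compProd_apply_prod hB (measurableSet_singleton t), h1,
    ← Measure.map_apply (Preorder.measurable_frestrictLe k) hB, Kernel.traj_map_frestrictLe_apply]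
  -- On `B` the kernel sees only the current state `s`, so the integrand is constant.
  rw [setLIntegral_congr_fun (g := fun _ => ENNReal.ofReal (M.δ s t)) hB, setLIntegral_const,
    mul_comm]
  intro h hh
  change (M.next (h ⟨k, Finset.mem_Iic.2 le_rfl⟩)).toMeasure {t} = _
  rw [hh.1, next_toMeasure_singleton]

theorem avoiding_zero (s : Fin M.n) :
    M.pathMeasure.real (M.avoiding F 0 s) = if s = M.init then 1 else 0 := by
  let B : Set ((j : Finset.Iic 0) → (fun _ : ℕ => Fin M.n) j) :=
    {h | h ⟨0, Finset.mem_Iic.2 le_rfl⟩ = s}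
  have hB : MeasurableSet B := (Set.toFinite B).measurableSet
  have h1 : M.avoiding F 0 s = Preorder.frestrictLe 0 ⁻¹' B := by
    ext ρ; simp [avoiding, B]
  rw [measureReal_def, h1, pathMeasure,
    ← Measure.map_apply (Preorder.measurable_frestrictLe 0) hB, Kernel.traj_map_frestrictLe_apply,
    Kernel.partialTraj_self, Kernel.id_apply, Measure.dirac_apply' _ hB]
  by_cases h : s = M.init
  · simp [B, h]
  · simp [B, h, Ne.symm h]

/-- Split according to the state at time `k`, which must lie outside of `F`. -/
theorem avoiding_succ (k : ℕ) (t : Fin M.n) :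
    M.pathMeasure.real (M.avoiding F (k + 1) t) =
      ∑ s ∈ Fᶜ, M.pathMeasure.real (M.avoiding F k s) * (M.δ s t : ℝ) := by
  have h1 : M.avoiding F (k + 1) t = ⋃ s ∈ Fᶜ, (M.avoiding F k s ∩ {ρ | ρ (k + 1) = t}) := by
    ext ρ
    simp only [avoiding, Set.mem_ofPred_eq, Set.mem_iUnion, Set.mem_inter_iff, Finset.mem_compl,
      exists_prop]
    constructor
    · rintro ⟨h1, h2⟩
      exact ⟨ρ k, h2 k (Nat.lt_succ_self k), ⟨rfl, fun j hj => h2 j (by omega)⟩, h1⟩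
    · rintro ⟨s, hs, ⟨h1, h2⟩, h3⟩
      refine ⟨h3, fun j hj => ?_⟩
      rcases Nat.lt_succ_iff_lt_or_eq.1 hj with h | rfl
      · exact h2 j h
      · rwa [h1]
  rw [h1, measureReal_biUnion_finset]
  · refine Finset.sum_congr rfl fun s _ => ?_
    rw [measureReal_def, pathMeasure_avoiding_inter, ENNReal.toReal_mul, ENNReal.toReal_ofReal,
      measureReal_def]
    exact_mod_cast M.δ_nonneg s t
  · intro s _ s' _ hss
    refine Set.disjoint_left.2 fun ρ h h' => hss ?_
    exact h.1.1.symm.trans h'.1.1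
  · intro s _
    exact (M.measurableSet_avoiding F k s).inter
      (measurableSet_eq_fun (measurable_pi_apply _) measurable_const)

/-- The paths whose first state in `F` is `t`. -/
def firstHit (t : Fin M.n) : Set (ℕ → Fin M.n) :=
  ⋃ k, M.avoiding F k t

theorem measurableSet_firstHit (t : Fin M.n) : MeasurableSet (M.firstHit F t) :=
  MeasurableSet.iUnion fun k => M.measurableSet_avoiding F k t

variable {F}

theorem hasSum_firstHit {t : Fin M.n} (ht : t ∈ F) :
    HasSum (fun k => M.pathMeasure.real (M.avoiding F k t))
      (M.pathMeasure.real (M.firstHit F t)) := by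
  have hd : Pairwise (Function.onFun Disjoint fun k => M.avoiding F k t) := by
    intro k l hkl
    refine Set.disjoint_left.2 fun ρ h h' => ?_
    rcases lt_or_gt_of_ne hkl with hlt | hlt
    · exact h'.2 k hlt (h.1 ▸ ht)
    · exact h.2 l hlt (h'.1 ▸ ht)
  have h := measure_iUnion (μ := M.pathMeasure) hd fun k => M.measurableSet_avoiding F k t
  have h2 : ∑' k, M.pathMeasure (M.avoiding F k t) ≠ ⊤ := by
    rw [← h]; exact measure_ne_top _ _
  rw [measureReal_def, firstHit, h, ENNReal.tsum_toReal_eq (ENNReal.ne_top_of_tsum_ne_top h2)]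
  exact ENNReal.hasSum_toReal h2

/-- For a state in `F` the events for different times are disjoint, so their probabilities are
summable. The limit `0` propagates backwards along a transition from `s ∉ F` to `t`: the mass at `s`
at time `k`, multiplied by `δ s t`, is part of the mass at `t` at time `k + 1`. -/
theorem tendsto_avoiding {s : Fin M.n} (hs : M.CanReach F s) :
    Tendsto (fun k => M.pathMeasure.real (M.avoiding F k s)) atTop (𝓝 0) := by
  induction hs with
  | mem hs => exact (M.hasSum_firstHit hs).summable.tendsto_atTop_zero
  | @step s t hst _ ih =>
    by_cases hs : s ∈ F
    · exact (M.hasSum_firstHit hs).summable.tendsto_atTop_zero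
    have hpos : (0 : ℝ) < M.δ s t := by exact_mod_cast hst
    have h1 := (ih.comp (tendsto_add_atTop_nat 1)).div_const (M.δ s t : ℝ)
    rw [zero_div] at h1
    refine squeeze_zero (fun _ => measureReal_nonneg) (fun k => ?_) h1
    rw [le_div_iff₀ hpos, Function.comp_apply, avoiding_succ]
    refine Finset.single_le_sum
      (f := fun s => M.pathMeasure.real (M.avoiding F k s) * (M.δ s t : ℝ))
      (fun u _ => mul_nonneg measureReal_nonneg (by exact_mod_cast M.δ_nonneg u t))
      (Finset.mem_compl.2 hs)

/-- The probability that `t` is the first state in `F` is given by a solution of the usual linear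
equations that vanishes on the states that cannot reach `F`. -/
theorem firstHit_eq {t : Fin M.n} (ht : t ∈ F) (x : Fin M.n → ℝ)
    (hF : ∀ s ∈ F, x s = if s = t then 1 else 0) (hdead : ∀ s, ¬ M.CanReach F s → x s = 0)
    (hx : ∀ s ∉ F, x s = ∑ u, (M.δ s u : ℝ) * x u) :
    M.pathMeasure.real (M.firstHit F t) = x M.init := by
  -- A conserved quantity: the probability of having entered `F` at `t` before time `k`, plus the
  -- integral of `x` over the mass that has not entered `F` before time `k`. In the limit the second
  -- summand disappears, since either the mass tends to `0` or `x` vanishes.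
  have h1 : ∀ k, ∑ j ∈ Finset.range k, M.pathMeasure.real (M.avoiding F j t) +
      ∑ s, M.pathMeasure.real (M.avoiding F k s) * x s = x M.init := by
    intro k
    induction k with
    | zero => simp [avoiding_zero]
    | succ k ih =>
      rw [← ih, Finset.sum_range_succ, add_assoc]
      congr 1
      rw [← Finset.sum_add_sum_compl F fun s => M.pathMeasure.real (M.avoiding F k s) * x s]
      congr 1
      · rw [Finset.sum_eq_single_of_mem t ht, hF t ht, if_pos rfl, mul_one]
        intro s hs hst
        rw [hF s hs, if_neg hst, mul_zero]
      · simp_rw [avoiding_succ, Finset.sum_mul]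
        rw [Finset.sum_comm]
        refine Finset.sum_congr rfl fun s hs => ?_
        rw [hx s (Finset.mem_compl.1 hs), Finset.mul_sum]
        exact Finset.sum_congr rfl fun u _ => mul_assoc _ _ _
  have h2 : Tendsto (fun k => ∑ s, M.pathMeasure.real (M.avoiding F k s) * x s) atTop (𝓝 0) := by
    rw [← Finset.sum_const_zero (s := (Finset.univ : Finset (Fin M.n)))]
    refine tendsto_finsetSum _ fun s _ => ?_
    by_cases hs : M.CanReach F s
    · simpa using (M.tendsto_avoiding hs).mul_const (x s)
    · simp [hdead s hs]
  have h3 := ((M.hasSum_firstHit ht).tendsto_sum_nat.add h2)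
  simp_rw [h1, add_zero] at h3
  exact tendsto_nhds_unique h3 tendsto_const_nhds

end MarkovChain

/-! ### The integral matrix of the reachability equations -/

namespace MarkovChain

open Classical in
/-- `A` is the matrix, scaled by `D`, of the linear equations for reachability of `F`. -/
def IsReachMatrix (M : MarkovChain) (F : Finset (Fin M.n)) (D : ℤ)
    (A : Matrix (Fin M.n) (Fin M.n) ℤ) : Prop :=
  ∀ s t, (A s t : ℚ) =
    D * ((if s = t then 1 else 0) - if s ∉ F ∧ M.CanReach F s then M.δ s t else 0)

variable {M : MarkovChain} {F : Finset (Fin M.n)} {D : ℤ} {A : Matrix (Fin M.n) (Fin M.n) ℤ}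

-- The field is left open because regularity of the matrix is shown over `ℚ`, while the solutions of
-- interest are real probabilities.
open Classical in
theorem IsReachMatrix.sum_eq (hA : M.IsReachMatrix F D A) {K : Type*} [Field K] [CharZero K]
    (s : Fin M.n) (x : Fin M.n → K) :
    ∑ t, (A s t : K) * x t =
      D * (x s - if s ∉ F ∧ M.CanReach F s then ∑ t, (M.δ s t : K) * x t else 0) := by
  have h : ∀ t, (A s t : K) =
      D * ((if s = t then 1 else 0) - if s ∉ F ∧ M.CanReach F s then (M.δ s t : K) else 0) := by
    intro t
    have := congrArg (fun q : ℚ => (q : K)) (hA s t)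
    push_cast at this
    rw [this]
    split_ifs <;> simp
  simp_rw [h, mul_assoc, ← Finset.mul_sum, sub_mul, Finset.sum_sub_distrib]
  congr 2
  · simp
  · split_ifs <;> simp

/-- Maximum principle. A vector in the kernel vanishes on `F` and on the states that cannot reach
`F`; elsewhere each entry is the mean of the entries at the successors. Following a path to `F`
backwards, the absolute value at every state that can reach `F` stays strictly below the maximum, so
the maximum is attained nowhere unless it is `0`. -/
theorem IsReachMatrix.det_ne_zero (hA : M.IsReachMatrix F D A) (hD : D ≠ 0) : A.det ≠ 0 := by
  classical
  intro h
  obtain ⟨v, hv0, hv⟩ := Matrix.exists_mulVec_eq_zero_iff.2 h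
  have hD' : (D : ℚ) ≠ 0 := by exact_mod_cast hD
  have h1 : ∀ s, (v s : ℚ) =
      if s ∉ F ∧ M.CanReach F s then ∑ t, M.δ s t * (v t : ℚ) else 0 := by
    intro s
    have h2 := hA.sum_eq s fun t => (v t : ℚ)
    have h3 := congrArg (fun z : ℤ => (z : ℚ)) (congrFun hv s)
    simp only [Matrix.mulVec, dotProduct, Int.cast_sum, Int.cast_mul, Pi.zero_apply,
      Int.cast_zero] at h3
    rw [h3] at h2
    simpa [hD', sub_eq_zero] using h2.symm
  obtain ⟨m, -, hm⟩ := Finset.exists_max_image Finset.univ (fun s => |(v s : ℚ)|)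
    ⟨M.init, Finset.mem_univ _⟩
  have hpos : 0 < |(v m : ℚ)| := by
    obtain ⟨s, hs⟩ := Function.ne_iff.1 hv0
    refine lt_of_lt_of_le ?_ (hm s (Finset.mem_univ s))
    exact abs_pos.2 (by exact_mod_cast hs)
  have key : ∀ s, M.CanReach F s → |(v s : ℚ)| < |(v m : ℚ)| := by
    intro s hs
    induction hs with
    | mem hs => rw [h1, if_neg (fun h => h.1 hs), abs_zero]; exact hpos
    | @step s t hst ht ih =>
      by_cases hs : s ∈ F
      · rw [h1, if_neg (fun h => h.1 hs), abs_zero]; exact hpos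
      rw [h1 s, if_pos ⟨hs, .step hst ht⟩]
      calc |∑ t, M.δ s t * (v t : ℚ)| ≤ ∑ t, |M.δ s t * (v t : ℚ)| := Finset.abs_sum_le_sum_abs _ _
        _ = ∑ t, M.δ s t * |(v t : ℚ)| :=
          Finset.sum_congr rfl fun t _ => by rw [abs_mul, abs_of_nonneg (M.δ_nonneg s t)]
        _ < ∑ t, M.δ s t * |(v m : ℚ)| :=
          Finset.sum_lt_sum
            (fun u hu => mul_le_mul_of_nonneg_left (hm u hu) (M.δ_nonneg s u))
            ⟨t, Finset.mem_univ t, mul_lt_mul_of_pos_left ih hst⟩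
        _ = |(v m : ℚ)| := by rw [← Finset.sum_mul, M.δ_sum, one_mul]
  by_cases hr : M.CanReach F m
  · exact lt_irrefl _ (key m hr)
  · rw [h1 m, if_neg (fun h => hr h.2), abs_zero] at hpos
    exact lt_irrefl _ hpos

/-- The probability that `t` is the first state in `F`, in terms of an inverse of the matrix of the
linear equations up to a scalar. -/
theorem IsReachMatrix.firstHit_eq (hA : M.IsReachMatrix F D A) (hD : D ≠ 0)
    {B : Matrix (Fin M.n) (Fin M.n) ℤ} {c : ℤ} (hc : c ≠ 0)
    (hB : A * B = -(c • (1 : Matrix (Fin M.n) (Fin M.n) ℤ))) {t : Fin M.n} (ht : t ∈ F) :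
    M.pathMeasure.real (M.firstHit F t) = ((-(D * c * B M.init t) : ℤ) : ℝ) / ((c * c : ℤ) : ℝ) := by
  classical
  have hD' : (D : ℝ) ≠ 0 := by exact_mod_cast hD
  have hc' : (c : ℝ) ≠ 0 := by exact_mod_cast hc
  -- By `hB` this column solves `A x = D e_t`, which are the equations for the probabilities. The
  -- conclusion extends the fraction by `c` so that the denominator is positive whatever the sign of
  -- `c`, and the same for all `t`.
  let x : Fin M.n → ℝ := fun s => -(D * B s t) / c
  have h1 : ∀ s, x s =
      (if s = t then 1 else 0) + if s ∉ F ∧ M.CanReach F s then ∑ u, (M.δ s u : ℝ) * x u else 0 := by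
    intro s
    have h2 := hA.sum_eq s x
    have h3 := congrArg (fun z : ℤ => (z : ℝ)) (congrFun (congrFun hB s) t)
    simp only [Matrix.mul_apply, Int.cast_sum, Int.cast_mul, Matrix.neg_apply, Matrix.smul_apply,
      Matrix.one_apply, smul_eq_mul, Int.cast_neg] at h3
    have h4 : ∑ u, (A s u : ℝ) * x u = D * if s = t then 1 else 0 := by
      have h5 : ∀ u, (A s u : ℝ) * x u = -(D / c) * ((A s u : ℝ) * (B u t : ℝ)) := by
        intro u; simp only [x]; ring
      simp_rw [h5, ← Finset.mul_sum, h3]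
      split_ifs
      · push_cast; field_simp
      · simp
    rw [h4] at h2
    have := mul_left_cancel₀ hD' h2
    rw [this]; ring
  rw [M.firstHit_eq ht x]
  · simp only [x]; push_cast; field_simp
  · intro s hs
    rw [h1 s, if_neg (fun h => h.1 hs : ¬ (s ∉ F ∧ M.CanReach F s)), add_zero]
  · intro s hs
    rw [h1 s, if_neg (fun h => hs h.2 : ¬ (s ∉ F ∧ M.CanReach F s)), add_zero, if_neg]
    rintro rfl
    exact hs (.mem ht)
  · intro s hs
    have hst : s ≠ t := fun h => hs (h ▸ ht)
    by_cases hr : M.CanReach F s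
    · conv_lhs => rw [h1 s]
      rw [if_neg hst, zero_add, if_pos ⟨hs, hr⟩]
    -- From a state that cannot reach `F`, all transitions of positive probability lead to such
    -- states again, so both sides are `0`.
    · have h0 : ∀ u, ¬ M.CanReach F u → x u = 0 := by
        intro u hu
        rw [h1 u, if_neg (fun h => hu h.2 : ¬ (u ∉ F ∧ M.CanReach F u)), add_zero, if_neg]
        rintro rfl
        exact hu (.mem ht)
      rw [h0 s hr]
      symm
      refine Finset.sum_eq_zero fun u _ => ?_
      by_cases hu : M.CanReach F u
      · have : M.δ s u = 0 :=
          le_antisymm (not_lt.1 fun h => hr (.step h hu)) (M.δ_nonneg s u)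
        rw [this, Rat.cast_zero, zero_mul]
      · rw [h0 u hu, mul_zero]

end MarkovChain

/-! ## The prospect of a Markov chain with a weighted reachability objective -/

namespace WRObjective

variable {n : ℕ} (Φ : WRObjective n)

theorem zero_mem_outcomes : (0 : ℚ) ∈ Φ.outcomes := Finset.mem_insert_self _ _

theorem value_eq_reward {ρ : ℕ → Fin n} {k : ℕ} (hk : ρ k ∈ Φ.F) (h : ∀ j < k, ρ j ∉ Φ.F) :
    Φ.value ρ = Φ.r ⟨ρ k, hk⟩ := by
  classical
  have hex : ∃ i, ρ i ∈ Φ.F := ⟨k, hk⟩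
  have hf : Nat.find hex = k := by
    rw [Nat.find_eq_iff]; exact ⟨hk, h⟩
  have h2 : ∀ i (hi : ρ i ∈ Φ.F), i = k → Φ.r ⟨ρ i, hi⟩ = Φ.r ⟨ρ k, hk⟩ := by
    rintro i hi rfl; rfl
  rw [value, dif_pos hex]
  exact h2 _ _ (by convert hf)

theorem value_eq_zero {ρ : ℕ → Fin n} (h : ∀ j, ρ j ∉ Φ.F) : Φ.value ρ = 0 := by
  rw [value, dif_neg (by simpa using h)]

theorem value_mem_outcomes (ρ : ℕ → Fin n) : Φ.value ρ ∈ Φ.outcomes := by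
  unfold value
  split_ifs
  · exact Finset.mem_insert_of_mem (Finset.mem_image_of_mem _ (Finset.mem_univ _))
  · exact Φ.zero_mem_outcomes

end WRObjective

/-! ### The law of the value of a path -/

namespace MarkovChain

variable (M : MarkovChain) (Φ : WRObjective M.n)

theorem mem_firstHit_iff {F : Finset (Fin M.n)} {t : Fin M.n} {ρ : ℕ → Fin M.n} :
    ρ ∈ M.firstHit F t ↔ ∃ k, ρ k = t ∧ ∀ j < k, ρ j ∉ F := by
  simp [firstHit, avoiding]

theorem disjoint_firstHit {F : Finset (Fin M.n)} {s t : Fin M.n} (hs : s ∈ F) (ht : t ∈ F)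
    (hst : s ≠ t) : Disjoint (M.firstHit F s) (M.firstHit F t) := by
  refine Set.disjoint_left.2 fun ρ h h' => hst ?_
  obtain ⟨k, hk, hk'⟩ := M.mem_firstHit_iff.1 h
  obtain ⟨l, hl, hl'⟩ := M.mem_firstHit_iff.1 h'
  rcases lt_trichotomy k l with hlt | rfl | hlt
  · exact absurd (hk ▸ hs) (hl' k hlt)
  · exact hk.symm.trans hl
  · exact absurd (hl ▸ ht) (hk' l hlt)

/-- The paths that never enter the target set have value `0`, so this outcome receives an additional
term, even if some target also has reward `0`. -/
theorem setOf_value_eq (o : ℚ) :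
    {ρ | Φ.value ρ = o} =
      (⋃ t ∈ (Finset.univ.filter fun t => Φ.r t = o), M.firstHit Φ.F t.1) ∪
        if o = 0 then (⋃ t ∈ (Finset.univ : Finset {s // s ∈ Φ.F}), M.firstHit Φ.F t.1)ᶜ else ∅ := by
  classical
  ext ρ
  by_cases hex : ∃ i, ρ i ∈ Φ.F
  · have hk := Nat.find_spec hex
    have hk' : ∀ j < Nat.find hex, ρ j ∉ Φ.F := fun j => Nat.find_min hex
    have h1 : ∀ t : {s // s ∈ Φ.F}, ρ ∈ M.firstHit Φ.F t.1 ↔ t = ⟨ρ (Nat.find hex), hk⟩ := by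
      intro t
      constructor
      · intro h
        by_contra hne
        refine Set.disjoint_left.1 (M.disjoint_firstHit t.2 hk fun h => hne (Subtype.ext h)) h ?_
        exact M.mem_firstHit_iff.2 ⟨_, rfl, hk'⟩
      · rintro rfl
        exact M.mem_firstHit_iff.2 ⟨_, rfl, hk'⟩
    have h2 := Φ.value_eq_reward hk hk'
    by_cases ho : o = 0 <;> simp [ho, h1, h2]
  · have h0 : ∀ i, ρ i ∉ Φ.F := by simpa using hex
    have h1 : ∀ t : {s // s ∈ Φ.F}, ρ ∉ M.firstHit Φ.F t.1 := by
      intro t h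
      obtain ⟨k, hk, -⟩ := M.mem_firstHit_iff.1 h
      exact h0 k (hk ▸ t.2)
    have h2 := Φ.value_eq_zero h0
    by_cases ho : o = 0 <;> simp [ho, h1, h2, eq_comm]

theorem measurableSet_biUnion_firstHit (T : Finset {s // s ∈ Φ.F}) :
    MeasurableSet (⋃ t ∈ T, M.firstHit Φ.F t.1) :=
  Finset.measurableSet_biUnion _ fun t _ => M.measurableSet_firstHit Φ.F t.1

theorem measurableSet_value_eq (o : ℚ) : MeasurableSet {ρ | Φ.value ρ = o} := by
  rw [setOf_value_eq]
  refine (M.measurableSet_biUnion_firstHit Φ _).union ?_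
  split_ifs
  · exact (M.measurableSet_biUnion_firstHit Φ _).compl
  · exact MeasurableSet.empty

theorem measureReal_biUnion_firstHit (T : Finset {s // s ∈ Φ.F}) :
    M.pathMeasure.real (⋃ t ∈ T, M.firstHit Φ.F t.1) =
      ∑ t ∈ T, M.pathMeasure.real (M.firstHit Φ.F t.1) :=
  measureReal_biUnion_finset
    (fun s _ t _ hst => M.disjoint_firstHit s.2 t.2 fun h => hst (Subtype.ext h))
    fun t _ => M.measurableSet_firstHit Φ.F t.1

theorem measureReal_value_eq (o : ℚ) :
    M.pathMeasure.real {ρ | Φ.value ρ = o} =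
      ∑ t with Φ.r t = o, M.pathMeasure.real (M.firstHit Φ.F t.1) +
        if o = 0 then 1 - ∑ t : {s // s ∈ Φ.F}, M.pathMeasure.real (M.firstHit Φ.F t.1)
        else 0 := by
  rw [setOf_value_eq, measureReal_union (h₁ := measure_ne_top _ _) (h₂ := measure_ne_top _ _),
    measureReal_biUnion_firstHit]
  · congr 1
    split_ifs
    · rw [probReal_compl_eq_one_sub (M.measurableSet_biUnion_firstHit Φ _),
        measureReal_biUnion_firstHit]
    · simp
  · split_ifs
    · refine Set.disjoint_compl_right_iff_subset.2 ?_
      exact Set.biUnion_subset_biUnion_left fun t _ => Finset.mem_univ t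
    · exact Set.disjoint_empty _
  · split_ifs
    · exact (M.measurableSet_biUnion_firstHit Φ _).compl
    · exact MeasurableSet.empty

theorem measureReal_value (P : ℚ → Prop) [DecidablePred P] :
    M.pathMeasure.real {ρ | P (Φ.value ρ)} =
      ∑ o ∈ Φ.outcomes with P o, M.pathMeasure.real {ρ | Φ.value ρ = o} := by
  rw [← measureReal_biUnion_finset]
  · congr 1
    ext ρ
    simp [Φ.value_mem_outcomes]
  · intro o _ o' _ hoo
    exact Set.disjoint_left.2 fun ρ h h' => hoo (Eq.trans (Eq.symm h) h')
  · exact fun o _ => M.measurableSet_value_eq Φ o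

/-- The distribution of the value of a path, as a prospect. -/
noncomputable def prospect (p : ℚ → ℚ)
    (hp : ∀ o, (p o : ℝ) = M.pathMeasure.real {ρ | Φ.value ρ = o}) : Prospect where
  k := Φ.outcomes.card
  o := Φ.outcomes.orderEmbOfFin rfl
  p := fun i => p (Φ.outcomes.orderEmbOfFin rfl i)
  o_strictMono := (Φ.outcomes.orderEmbOfFin rfl).strictMono
  zero_mem := by
    have h : (0 : ℚ) ∈ Set.range (Φ.outcomes.orderEmbOfFin rfl) := by
      rw [Finset.range_orderEmbOfFin]; exact Φ.zero_mem_outcomes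
    exact h
  p_nonneg := fun i => by
    have := (hp (Φ.outcomes.orderEmbOfFin rfl i)).ge.trans' measureReal_nonneg
    exact_mod_cast this
  p_sum := by
    have h1 := M.measureReal_value Φ fun _ => True
    have h2 : M.pathMeasure.real {ρ | True} = 1 := by simp
    rw [h2, Finset.filter_true] at h1
    have h3 : ∑ i, p (Φ.outcomes.orderEmbOfFin rfl i) = ∑ o ∈ Φ.outcomes, p o := by
      rw [← Finset.sum_coe_sort Φ.outcomes p]
      exact Fintype.sum_equiv (Φ.outcomes.orderIsoOfFin rfl).toEquiv _ _ fun i => rfl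
    rw [h3]
    simp_rw [← hp] at h1
    exact_mod_cast h1.symm

/-- As the outcomes are listed in increasing order, the sums over higher or lower positions are the
probabilities of larger or smaller values of `Φ`. The outcome `0` has decision weight `0` and is
absent from both sums of the CPT-value. -/
theorem prospect_cpt (C : CPTParams) (p : ℚ → ℚ)
    (hp : ∀ o, (p o : ℝ) = M.pathMeasure.real {ρ | Φ.value ρ = o}) :
    (M.prospect Φ p hp).cpt C = cptValue C M Φ := by
  classical
  have hsum : ∀ f : ℚ → ℝ, ∑ i, f (Φ.outcomes.orderEmbOfFin rfl i) = ∑ o ∈ Φ.outcomes, f o := by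
    intro f
    rw [← Finset.sum_coe_sort Φ.outcomes f]
    exact Fintype.sum_equiv (Φ.outcomes.orderIsoOfFin rfl).toEquiv _ _ fun i => rfl
  have hP : ∀ (P : ℚ → Prop) [DecidablePred P],
      ∑ i with P (Φ.outcomes.orderEmbOfFin rfl i), (p (Φ.outcomes.orderEmbOfFin rfl i) : ℝ) =
        M.pathMeasure.real {ρ | P (Φ.value ρ)} := by
    intro P _
    rw [measureReal_value, Finset.sum_filter, hsum fun o => if P o then (p o : ℝ) else 0,
      ← Finset.sum_filter]
    exact Finset.sum_congr rfl fun o _ => hp o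
  have hg : ∀ i, gainRank (fun i => (p (Φ.outcomes.orderEmbOfFin rfl i) : ℝ)) i =
      M.pathMeasure.real {ρ | Φ.outcomes.orderEmbOfFin rfl i < Φ.value ρ} := by
    intro i
    rw [← hP, gainRank]
    congr 1; ext m; simp
  have hg' : ∀ i, (p (Φ.outcomes.orderEmbOfFin rfl i) : ℝ) +
      gainRank (fun i => (p (Φ.outcomes.orderEmbOfFin rfl i) : ℝ)) i =
      M.pathMeasure.real {ρ | Φ.outcomes.orderEmbOfFin rfl i ≤ Φ.value ρ} := by
    intro i
    rw [← hP, gainRank,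
      ← Finset.sum_insert (f := fun m => (p (Φ.outcomes.orderEmbOfFin rfl m) : ℝ)) (by simp)]
    congr 1; ext m; simp [le_iff_eq_or_lt]
  have hl : ∀ i, lossRank (fun i => (p (Φ.outcomes.orderEmbOfFin rfl i) : ℝ)) i =
      M.pathMeasure.real {ρ | Φ.value ρ < Φ.outcomes.orderEmbOfFin rfl i} := by
    intro i
    rw [← hP (fun o => o < Φ.outcomes.orderEmbOfFin rfl i), lossRank]
    congr 1; ext m; simp
  have hl' : ∀ i, (p (Φ.outcomes.orderEmbOfFin rfl i) : ℝ) +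
      lossRank (fun i => (p (Φ.outcomes.orderEmbOfFin rfl i) : ℝ)) i =
      M.pathMeasure.real {ρ | Φ.value ρ ≤ Φ.outcomes.orderEmbOfFin rfl i} := by
    intro i
    rw [← hP (fun o => o ≤ Φ.outcomes.orderEmbOfFin rfl i), lossRank,
      ← Finset.sum_insert (f := fun m => (p (Φ.outcomes.orderEmbOfFin rfl m) : ℝ)) (by simp)]
    congr 1; ext m; simp [le_iff_eq_or_lt, eq_comm]
  rw [Prospect.cpt, cptFun, cptValue, Finset.sum_filter, Finset.sum_filter,
    ← Finset.sum_add_distrib]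
  simp only [prospect]
  rw [← hsum]
  refine Finset.sum_congr rfl fun i _ => ?_
  rw [decisionWeight, hg', hg, hl', hl]
  simp only [Rat.cast_pos, Rat.cast_lt_zero]
  split_ifs with h1 h2 h2
  · exact absurd h1 h2.le.not_gt
  · simp
  · simp
  · simp

/-- This replaces sorting: the place of an outcome in the query is found by counting the smaller
outcomes. -/
theorem card_outcomes_lt (i : Fin Φ.outcomes.card) :
    (Φ.outcomes.filter fun o => o < Φ.outcomes.orderEmbOfFin rfl i).card = i := by
  have h : (Φ.outcomes.filter fun o => o < Φ.outcomes.orderEmbOfFin rfl i) =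
      (Finset.Iio i).map (Φ.outcomes.orderEmbOfFin rfl).toEmbedding := by
    ext o
    simp only [Finset.mem_filter, Finset.mem_map, Finset.mem_Iio]
    constructor
    · rintro ⟨h1, h2⟩
      have h3 : o ∈ Set.range (Φ.outcomes.orderEmbOfFin rfl) := by
        rw [Finset.range_orderEmbOfFin]; exact h1
      obtain ⟨j, rfl⟩ := h3
      exact ⟨j, (Φ.outcomes.orderEmbOfFin rfl).lt_iff_lt.1 h2, rfl⟩
    · rintro ⟨j, hj, rfl⟩
      exact ⟨Finset.orderEmbOfFin_mem _ _ _, (Φ.outcomes.orderEmbOfFin rfl).lt_iff_lt.2 hj⟩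
  rw [h, Finset.card_map, Fin.card_Iio]

/-- The query for the prospect, entry by entry. -/
theorem map_range_eq_encodeQuery (p : ℚ → ℚ)
    (hp : ∀ o, (p o : ℝ) = M.pathMeasure.real {ρ | Φ.value ρ = o}) (η : ℚ) (f : ℕ → ℤ)
    (h0 : f 0 = η.num) (h1 : f 1 = η.den)
    (hf : ∀ o ∈ Φ.outcomes, ∀ r, (Φ.outcomes.filter fun o' => o' < o).card = r →
      f (2 + 4 * r) = o.num ∧ f (3 + 4 * r) = o.den ∧
        f (4 + 4 * r) = (p o).num ∧ f (5 + 4 * r) = (p o).den) :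
    (List.range (2 + 4 * Φ.outcomes.card)).map f = (M.prospect Φ p hp).encodeQuery η := by
  have e1 : (List.range (2 + 4 * Φ.outcomes.card)).map f =
      List.ofFn fun i : Fin (2 + Φ.outcomes.card * 4) => f i := by
    rw [mul_comm 4]
    exact List.ext_getElem (by simp) fun i _ _ => by simp
  rw [e1, List.ofFn_add, List.ofFn_mul, Prospect.encodeQuery]
  congr 1
  · simp [encodeRat, h0, h1]
  · congr 2
    funext i
    obtain ⟨a, b, c, d⟩ := hf _ (Finset.orderEmbOfFin_mem Φ.outcomes rfl i) i
      (M.card_outcomes_lt Φ i)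
    simp only [encodeRat, prospect, List.ofFn_succ, List.ofFn_zero, List.cons_append,
      List.nil_append, ← a, ← b, ← c, ← d]
    simp
    refine ⟨?_, ?_, ?_, ?_⟩ <;> congr 1 <;> ring

end MarkovChain

/-! ## Compilation to the random access machine -/

namespace Loop

open RAM (Cmd Exec)

/-- Expressions over the memory of the machine. -/
inductive MemExpr
  | const (z : ℤ)
  | reg (i : ℕ)
  | inp (e : MemExpr)
  | ans (e : MemExpr)
  | mem (e : MemExpr)
  | op (o : RAM.Op) (e₁ e₂ : MemExpr)

namespace MemExpr

def eval (input : List ℤ) (m : RAM.State) : MemExpr → ℤ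
  | const z => z
  | reg i => m.mem i
  | inp e => input.getD (e.eval input m).toNat 0
  | ans e => RAM.digit m.ans (e.eval input m).toNat
  | mem e => m.mem (e.eval input m).toNat
  | op o e₁ e₂ => o.eval (e₁.eval input m) (e₂.eval input m)

/-- Up to the factor `L`, a bound for the length of the value. -/
def len : MemExpr → ℕ
  | const z => intLen z
  | op _ e₁ e₂ => e₁.len + e₂.len
  | _ => 1

/-- Up to the factor `L`, a bound for the time needed for the evaluation. -/
def cost : MemExpr → ℕ
  | const z => 12 + intLen z
  | reg _ => 21
  | inp e => e.cost + e.len + 21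
  | ans e => e.cost + e.len + 21
  | mem e => e.cost + e.len + 21
  | op _ e₁ e₂ => e₁.cost + e₂.cost + e₁.len + e₂.len + 28

/-- The number of auxiliary registers that are needed for the evaluation. -/
def depth : MemExpr → ℕ
  | const _ => 1
  | reg _ => 1
  | inp e => e.depth
  | ans e => e.depth
  | mem e => e.depth
  | op _ e₁ e₂ => max e₁.depth (e₂.depth + 1)

/-- The evaluation does not read the auxiliary registers `128`, …, `255`. -/
def Ok (input : List ℤ) (m : RAM.State) : MemExpr → Prop
  | const _ => True
  | reg i => i < 128
  | inp e => e.Ok input m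
  | ans e => e.Ok input m
  | mem e => e.Ok input m ∧ 256 ≤ (e.eval input m).toNat
  | op _ e₁ e₂ => e₁.Ok input m ∧ e₂.Ok input m

/-- Evaluate an expression into the register `128 + d`. -/
def compile : MemExpr → ℕ → Cmd
  | const z, d => .set (.reg (128 + d)) .add (.const z) (.const 0)
  | reg i, d => .set (.reg (128 + d)) .add (.reg i) (.const 0)
  | inp e, d => .seq (e.compile d) (.set (.reg (128 + d)) .add (.inp (128 + d)) (.const 0))
  | ans e, d => .seq (e.compile d) (.set (.reg (128 + d)) .add (.ans (128 + d)) (.const 0))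
  | mem e, d => .seq (e.compile d) (.set (.reg (128 + d)) .add (.ind (128 + d)) (.const 0))
  | op o e₁ e₂, d => .seq (e₁.compile d) (.seq (e₂.compile (d + 1))
      (.set (.reg (128 + d)) o (.reg (128 + d)) (.reg (128 + (d + 1)))))

variable {O : Oracle} {input : List ℤ} {m m' : RAM.State} {L : ℕ}

/-- Expressions read only registers outside of the auxiliary range, so intermediate results cannot
disturb them. -/
theorem eval_congr {e : MemExpr} (ha : m'.ans = m.ans)
    (hm : ∀ i, i < 128 ∨ 256 ≤ i → m'.mem i = m.mem i) (he : e.Ok input m) :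
    e.eval input m' = e.eval input m ∧ e.Ok input m' := by
  induction e with
  | const z => exact ⟨rfl, trivial⟩
  | reg i => exact ⟨hm i (Or.inl he), he⟩
  | inp e ih => have := ih he; exact ⟨by simp only [eval, this.1], this.2⟩
  | ans e ih => have := ih he; exact ⟨by simp only [eval, this.1, ha], this.2⟩
  | mem e ih =>
    have := ih he.1
    refine ⟨?_, this.2, this.1 ▸ he.2⟩
    simp only [eval, this.1]
    exact hm _ (Or.inr he.2)
  | op o e₁ e₂ h₁ h₂ =>
    have h₁ := h₁ he.1
    have h₂ := h₂ he.2
    exact ⟨by simp only [eval, h₁.1, h₂.1], h₁.2, h₂.2⟩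

theorem intLen_getD_le (hin : ∀ z ∈ input, intLen z ≤ L) (hL : 1 ≤ L) (j : ℕ) :
    intLen (input.getD j 0) ≤ L := by
  rw [List.getD_eq_getElem?_getD]
  cases h : input[j]? with
  | none => exact hL
  | some z => exact hin z (List.mem_of_getElem? h)

theorem intLen_digit_le (l : List Bool) (j : ℕ) : intLen (RAM.digit l j) ≤ 3 := by
  unfold RAM.digit
  split <;> decide

theorem intLen_eval_le {e : MemExpr} (hL : 9 ≤ L) (hin : ∀ z ∈ input, intLen z ≤ L)
    (hm : ∀ i, i < 128 ∨ 256 ≤ i → intLen (m.mem i) ≤ L) (he : e.Ok input m) :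
    intLen (e.eval input m) ≤ e.len * L := by
  induction e with
  | const z => exact Nat.le_mul_of_pos_right _ (by omega)
  | reg i => simp only [len, one_mul]; exact hm i (Or.inl he)
  | inp e ih => simp only [len, one_mul]; exact intLen_getD_le hin (by omega) _
  | ans e ih => simp only [len, one_mul]; exact (intLen_digit_le _ _).trans (by omega)
  | mem e ih => simp only [len, one_mul]; exact hm _ (Or.inr he.2)
  | op o e₁ e₂ h₁ h₂ =>
    rw [len, add_mul]
    exact (_root_.intLen_eval_le o _ _).trans (add_le_add (h₁ he.1) (h₂ he.2))

theorem intLen_small {i : ℕ} (h : i < 256) : intLen (i : ℤ) ≤ 9 :=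
  intLen_natCast_lt (k := 8) h

theorem intLen_zero : intLen 0 = 1 := by decide

/-- The program puts the value `z` into the register `128 + d` within time `T` and otherwise changes
only registers between `128 + d` and `255`. -/
def Evaluates (O : Oracle) (input : List ℤ) (m : RAM.State) (d : ℕ) (c : Cmd) (z : ℤ) (T : ℕ) :
    Prop :=
  ∃ t m', Exec O input c m t m' ∧ m'.mem (128 + d) = z ∧ m'.ans = m.ans ∧
    (∀ i, i < 128 + d ∨ 256 ≤ i → m'.mem i = m.mem i) ∧ t ≤ T

/-- The common part of the three kinds of lookup. The summand `20` consists of `1` for the command,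
`9` for each of the two mentions of the register `128 + d`, and `1` for the constant `0`. -/
theorem Evaluates.unary {d : ℕ} (hd : d < 128) {c : Cmd} {y z : ℤ} {T k : ℕ} {a : RAM.Operand}
    (h : Evaluates O input m d c y T)
    (ha : ∀ m' : RAM.State, m'.mem (128 + d) = y → m'.ans = m.ans →
      (∀ i, i < 128 + d ∨ 256 ≤ i → m'.mem i = m.mem i) → a.eval input m' = z ∧
        a.cost input m' = intLen ((128 + d : ℕ) : ℤ) + intLen y + intLen z)
    (hk : T + intLen y + intLen z + 20 ≤ k) :
    Evaluates O input m d (.seq c (.set (.reg (128 + d)) .add a (.const 0))) z k := by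
  obtain ⟨t, m₁, h1, h2, h3, h4, h5⟩ := h
  obtain ⟨ha1, ha2⟩ := ha m₁ h2 h3 h4
  refine ⟨_, _, h1.seq (.set _ _ _ _ _), ?_, h3, ?_, ?_⟩
  · simp [RAM.Dest.addr, RAM.Op.eval, ha1]
    rfl
  · intro i hi
    rw [← h4 i hi]
    exact Function.update_of_ne (by simp only [RAM.Dest.addr]; omega) _ _
  · have h6 := intLen_small (i := 128 + d) (by omega)
    simp only [RAM.Dest.cost, ha2]
    simp only [RAM.Operand.cost, intLen_zero]
    omega

/-- The auxiliary registers form a stack. The second operand is evaluated one register higher, which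
preserves the first one, and `depth` bounds the height, which keeps the stack below `256`. -/
theorem evaluates_compile (hL : 9 ≤ L) (hin : ∀ z ∈ input, intLen z ≤ L) {e : MemExpr} {d : ℕ}
    (hd : e.depth + d ≤ 128) (hm : ∀ i, i < 128 ∨ 256 ≤ i → intLen (m.mem i) ≤ L)
    (he : e.Ok input m) :
    Evaluates O input m d (e.compile d) (e.eval input m) (e.cost * L) := by
  have pos : ∀ e : MemExpr, 1 ≤ e.depth := fun e => by
    induction e <;> simp only [depth] <;> omega
  have hd' : d < 128 := by have := pos e; omega
  induction e generalizing m d with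
  | const z =>
    refine ⟨_, _, .set _ _ _ _ _, ?_, rfl, ?_, ?_⟩
    · simp [RAM.Dest.addr, RAM.Op.eval, RAM.Operand.eval, eval]
    · intro i hi
      exact Function.update_of_ne (by simp only [RAM.Dest.addr]; omega) _ _
    · have h1 := intLen_small (i := 128 + d) (by omega)
      have h2 : intLen z ≤ intLen z * L := Nat.le_mul_of_pos_right _ (by omega)
      simp only [RAM.Dest.cost, RAM.Operand.cost, cost, add_mul, intLen_zero]
      omega
  | reg i =>
    have he' : i < 128 := he
    refine ⟨_, _, .set _ _ _ _ _, ?_, rfl, ?_, ?_⟩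
    · simp [RAM.Dest.addr, RAM.Op.eval, RAM.Operand.eval, eval]
    · intro i hi
      exact Function.update_of_ne (by simp only [RAM.Dest.addr]; omega) _ _
    · have h1 := intLen_small (i := 128 + d) (by omega)
      have h2 := intLen_small (i := i) (by omega)
      have h3 := hm i (Or.inl he')
      simp only [RAM.Dest.cost, RAM.Operand.cost, cost, intLen_zero]
      omega
  | inp e ih =>
    refine (ih hd hm he hd').unary hd' (fun m' h1 _ _ => ?_) ?_
    · rw [RAM.Operand.eval, RAM.Operand.cost, h1]; exact ⟨rfl, rfl⟩
    · have h1 := intLen_eval_le (e := e) hL hin hm he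
      have h2 : _ ≤ 1 * L := intLen_eval_le hL hin hm (e := inp e) he
      simp only [cost, add_mul]
      omega
  | ans e ih =>
    refine (ih hd hm he hd').unary hd' (fun m' h1 h2 _ => ?_) ?_
    · rw [RAM.Operand.eval, RAM.Operand.cost, h1, h2]; exact ⟨rfl, rfl⟩
    · have h1 := intLen_eval_le (e := e) hL hin hm he
      have h2 : _ ≤ 1 * L := intLen_eval_le hL hin hm (e := ans e) he
      simp only [cost, add_mul]
      omega
  | mem e ih =>
    refine (ih hd hm he.1 hd').unary hd' (fun m' h1 _ h3 => ?_) ?_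
    · rw [RAM.Operand.eval, RAM.Operand.cost, h1, h3 _ (Or.inr he.2)]; exact ⟨rfl, rfl⟩
    · have h1 := intLen_eval_le hL hin hm he.1
      have h2 : _ ≤ 1 * L := intLen_eval_le hL hin hm (e := mem e) he
      simp only [cost, add_mul]
      omega
  | op o e₁ e₂ ih₁ ih₂ =>
    rw [depth] at hd
    have hp := pos e₂
    obtain ⟨t₁, m₁, a1, a2, a3, a4, a5⟩ := ih₁ (by omega) hm he.1 hd'
    have hc : ∀ i, i < 128 ∨ 256 ≤ i → m₁.mem i = m.mem i := fun i hi => a4 i (by omega)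
    obtain ⟨e1, e2⟩ := eval_congr a3 hc he.2
    obtain ⟨t₂, m₂, b1, b2, b3, b4, b5⟩ := ih₂ (d := d + 1) (m := m₁) (by omega)
      (fun i hi => by rw [hc i hi]; exact hm i hi) e2 (by omega)
    have hv : m₂.mem (128 + d) = e₁.eval input m := by rw [b4 _ (by omega), a2]
    rw [e1] at b2
    refine ⟨_, _, a1.seq (b1.seq (.set _ _ _ _ _)), ?_, ?_, ?_, ?_⟩
    · simp only [RAM.Dest.addr, RAM.Operand.eval, Function.update_self, hv, b2, eval]
    · exact b3.trans a3
    · intro i hi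
      rw [← a4 i hi, ← b4 i (by omega)]
      exact Function.update_of_ne (by simp only [RAM.Dest.addr]; omega) _ _
    · have h1 := intLen_small (i := 128 + d) (by omega)
      have h2 := intLen_small (i := 128 + (d + 1)) (by omega)
      have h3 := intLen_eval_le hL hin hm he.1
      have h4 := intLen_eval_le hL hin hm he.2
      simp only [RAM.Dest.cost, RAM.Operand.cost, hv, b2, cost, add_mul]
      omega

end MemExpr

end Loop

/-! ### Memory layout and compilation of statements -/

namespace Loop

open RAM (Cmd Exec)

variable {V A : Type} [Layout V A]

/-- The place of an array entry in the memory. -/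
def addr (S k r c : ℕ) : ℕ := 256 + ((k * S + r) * S + c)

/-- Rows and columns are below `S`, so they are the last two digits of the shifted address in base
`S`. -/
theorem addr_injective {S k r c k' r' c' : ℕ} (hr : r < S) (hc : c < S) (hr' : r' < S)
    (hc' : c' < S) (h : addr S k r c = addr S k' r' c') : k = k' ∧ r = r' ∧ c = c' := by
  have aux : ∀ {a b c d : ℕ}, b < S → d < S → a * S + b = c * S + d → a = c ∧ b = d := by
    intro a b c d hb hd h
    have h1 : b = d := by
      have := congrArg (· % S) h
      simpa [Nat.mul_add_mod', Nat.mod_eq_of_lt hb, Nat.mod_eq_of_lt hd] using this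
    subst h1
    exact ⟨Nat.eq_of_mul_eq_mul_right (by omega) (Nat.add_right_cancel h), rfl⟩
  obtain ⟨h1, h2⟩ := aux hc hc' (Nat.add_left_cancel h)
  obtain ⟨h3, h4⟩ := aux hr hr' h1
  exact ⟨h3, h4, h2⟩

/-- The register `64` holds the number `S` of rows and columns. In all, registers below `64` hold
the scalars, those from `65` to `126` the counters of the loops, those from `128` to `255`
intermediate results, and the arrays start at `256`. -/
def addrExpr (k : ℕ) (r c : MemExpr) : MemExpr :=
  .op .add (.const 256) (.op .add (.op .mul (.op .add (.op .mul (.const k) (.reg 64)) r) (.reg 64)) c)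

/-- The expression over the memory that computes the same value. -/
def Expr.lower : Expr V A → MemExpr
  | const z => .const z
  | var x => .reg (Layout.var A x)
  | arr a r c => .mem (addrExpr (Layout.arr V a) r.lower c.lower)
  | inp e => .inp e.lower
  | ans e => .ans e.lower
  | op o e₁ e₂ => .op o e₁.lower e₂.lower

/-- The memory of the machine represents the state of a program. -/
structure Rep (X : Context) (m : RAM.State) (σ : State V A) : Prop where
  var : ∀ x, m.mem (Layout.var A x) = σ.scal x
  arr : ∀ a r c, r < X.S → c < X.S → m.mem (addr X.S (Layout.arr V a) r c) = σ.arr a r c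
  ans : m.ans = σ.ans
  size : m.mem 64 = X.S
  bound : ∀ i, i < 128 ∨ 256 ≤ i → intLen (m.mem i) ≤ X.L

/-- The bound `9` covers the length of the number of any register below `256`. -/
structure Context.Valid (X : Context) : Prop where
  nine_le : 9 ≤ X.L
  size_le : X.S ≤ X.L
  input_le : ∀ z ∈ X.input, intLen z ≤ X.L

variable {X : Context} {m m' : RAM.State} {σ : State V A}

theorem Rep.congr (h : Rep X m σ) (ha : m'.ans = m.ans)
    (hm : ∀ i, i < 128 ∨ 256 ≤ i → m'.mem i = m.mem i) : Rep X m' σ where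
  var x := by
    have := Layout.var_lt (V := V) (A := A) x
    rw [hm _ (by omega), h.var]
  arr a r c hr hc := by rw [hm _ (by unfold addr; omega), h.arr a r c hr hc]
  ans := ha.trans h.ans
  size := by rw [hm _ (by omega), h.size]
  bound i hi := by rw [hm i hi]; exact h.bound i hi

theorem Rep.eval_addrExpr (h : Rep X m σ) {k r c : ℕ} {e₁ e₂ : MemExpr}
    (h₁ : e₁.eval X.input m = r) (h₂ : e₂.eval X.input m = c) :
    (addrExpr k e₁ e₂).eval X.input m = addr X.S k r c := by
  simp only [addrExpr, MemExpr.eval, RAM.Op.eval, h₁, h₂, h.size, addr]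
  push_cast
  ring

theorem addrExpr_ok {input : List ℤ} {k : ℕ} {e₁ e₂ : MemExpr} (h₁ : e₁.Ok input m)
    (h₂ : e₂.Ok input m) : (addrExpr k e₁ e₂).Ok input m :=
  have h : (64 : ℕ) < 128 := by norm_num
  ⟨trivial, ⟨⟨⟨trivial, h⟩, h₁⟩, h⟩, h₂⟩

theorem Rep.eval_lower (h : Rep X m σ) {e : Expr V A} (he : e.Ok X σ) :
    e.lower.eval X.input m = e.eval X σ ∧ e.lower.Ok X.input m := by
  induction e with
  | const z => exact ⟨rfl, trivial⟩
  | var x => exact ⟨h.var x, (Layout.var_lt x).trans (by norm_num)⟩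
  | arr a r c ihr ihc =>
    obtain ⟨h1, h2, ⟨h3, h4⟩, h5, h6⟩ := he
    obtain ⟨r1, r2⟩ := ihr h1
    obtain ⟨c1, c2⟩ := ihc h2
    have e1 := h.eval_addrExpr (k := Layout.arr V a) (r1.trans (Int.toNat_of_nonneg h3).symm)
      (c1.trans (Int.toNat_of_nonneg h5).symm)
    refine ⟨?_, addrExpr_ok r2 c2, ?_⟩
    · rw [Expr.lower, MemExpr.eval, e1, Int.toNat_natCast, h.arr _ _ _ (by omega) (by omega)]
      rfl
    · rw [e1, Int.toNat_natCast, addr]; omega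
  | inp e ih => exact ⟨by rw [Expr.lower, MemExpr.eval, (ih he).1, Expr.eval], (ih he).2⟩
  | ans e ih => exact ⟨by rw [Expr.lower, MemExpr.eval, (ih he).1, h.ans, Expr.eval], (ih he).2⟩
  | op o e₁ e₂ ih₁ ih₂ =>
    exact ⟨by rw [Expr.lower, MemExpr.eval, (ih₁ he.1).1, (ih₂ he.2).1, Expr.eval],
      (ih₁ he.1).2, (ih₂ he.2).2⟩

/-- The place of an array entry, as an expression. -/
def Expr.place (a : A) (r c : Expr V A) : MemExpr := addrExpr (Layout.arr V a) r.lower c.lower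

/-- The place of the first entry of an array, as an expression. -/
def Expr.origin (V : Type) [Layout V A] (a : A) : MemExpr :=
  addrExpr (Layout.arr V a) (.const 0) (.const 0)

namespace Stmt

/-- At loop depth `d`, the register `65 + 2 * d` counts the remaining iterations and the register
`66 + 2 * d` holds the index of the current one. The loop variable is only a copy, so a body that
overwrites it does not affect the number of iterations. -/
def compile : Stmt V A → ℕ → Cmd
  | assign x e, _ => .seq (e.lower.compile 0) (.set (.reg (Layout.var A x)) .add (.reg 128) (.const 0))
  | store a r c e, _ => .seq (e.lower.compile 0) (.seq ((Expr.place a r c).compile 1)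
      (.set (.ind 129) .add (.reg 128) (.const 0)))
  | seq s₁ s₂, d => .seq (s₁.compile d) (s₂.compile d)
  | ite e s₁ s₂, d => .seq (e.lower.compile 0) (.ifPos (.reg 128) (s₁.compile d) (s₂.compile d))
  | skip, _ => .skip
  | loop x e s, d => .seq (e.lower.compile 0) (.seq
      (.set (.reg (65 + 2 * d)) .add (.reg 128) (.const 0)) (.seq
      (.set (.reg (66 + 2 * d)) .add (.const 0) (.const 0))
      (.whilePos (.reg (65 + 2 * d)) (.seq
        (.set (.reg (Layout.var A x)) .add (.reg (66 + 2 * d)) (.const 0)) (.seq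
        (s.compile (d + 1)) (.seq
        (.set (.reg (66 + 2 * d)) .add (.reg (66 + 2 * d)) (.const 1))
        (.set (.reg (65 + 2 * d)) .sub (.reg (65 + 2 * d)) (.const 1))))))))
  | size x e, _ => .seq (e.lower.compile 0) (.seq
      (.set (.reg (Layout.var A x)) .add (.const 0) (.const 0))
      (.whilePos (.reg 128) (.seq
        (.set (.reg 128) .div (.reg 128) (.const 2))
        (.set (.reg (Layout.var A x)) .add (.reg (Layout.var A x)) (.const 1)))))
  | query a, _ => .seq ((Expr.origin V a).compile 0) (.query (.reg 128))

/-- A bound for the time needed, if all numbers have length at most `L` and all loops have at most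
`L` iterations. -/
def cost : Stmt V A → ℕ → ℕ
  | assign _ e, L => (e.lower.cost + e.lower.len + 30) * L
  | store a r c e, L => (e.lower.cost + e.lower.len + (Expr.place a r c).cost +
      (Expr.place a r c).len + 40) * L
  | seq s₁ s₂, L => s₁.cost L + s₂.cost L
  | ite e s₁ s₂, L => (e.lower.cost + e.lower.len + 30) * L + s₁.cost L + s₂.cost L
  | skip, _ => 1
  | loop _ e s, L => (e.lower.cost + e.lower.len + 60) * L + (L + 1) * (s.cost L + 20 * L)
  | size _ e, L => (e.lower.cost + 20) * L +
      (e.lower.len * L + 1) * ((2 * e.lower.len + 10) * L)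
  | query a, L => ((Expr.origin V a).cost +
      (Expr.origin V a).len + 20) * L + (L + 1) * L

-- The structure of the statement is fixed: a loop contributes a factor `L + 1`, and only finitely
-- many loops are nested.
open Polynomial in
theorem exists_polynomial_cost (s : Stmt V A) (p : Polynomial ℕ) :
    ∃ P : Polynomial ℕ, ∀ l, s.cost (p.eval l) = P.eval l := by
  induction s with
  | assign x e => exact ⟨C (e.lower.cost + e.lower.len + 30) * p, fun l => by simp [cost]⟩
  | store a r c e =>
    exact ⟨C (e.lower.cost + e.lower.len + (Expr.place a r c).cost +
      (Expr.place a r c).len + 40) * p, fun l => by simp [cost]⟩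
  | seq s₁ s₂ h₁ h₂ =>
    obtain ⟨P₁, h₁⟩ := h₁
    obtain ⟨P₂, h₂⟩ := h₂
    exact ⟨P₁ + P₂, fun l => by simp [cost, h₁, h₂]⟩
  | ite e s₁ s₂ h₁ h₂ =>
    obtain ⟨P₁, h₁⟩ := h₁
    obtain ⟨P₂, h₂⟩ := h₂
    exact ⟨C (e.lower.cost + e.lower.len + 30) * p + P₁ + P₂, fun l => by simp [cost, h₁, h₂]⟩
  | skip => exact ⟨1, fun l => by simp [cost]⟩
  | loop x e s h =>
    obtain ⟨P, h⟩ := h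
    exact ⟨C (e.lower.cost + e.lower.len + 60) * p + (p + 1) * (P + C 20 * p),
      fun l => by simp only [cost, h, eval_add, eval_mul, eval_C, eval_one]⟩
  | size x e =>
    exact ⟨C (e.lower.cost + 20) * p +
      (C e.lower.len * p + 1) * (C (2 * e.lower.len + 10) * p),
      fun l => by simp only [cost, eval_add, eval_mul, eval_C, eval_one]⟩
  | query a =>
    exact ⟨C ((Expr.origin V a).cost +
      (Expr.origin V a).len + 20) * p + (p + 1) * p,
      fun l => by simp only [cost, eval_add, eval_mul, eval_C, eval_one]⟩

/-- The program fits into the auxiliary registers if compiled at loop depth `d`. -/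
def fits : Stmt V A → ℕ → Bool
  | assign _ e, _ => e.lower.depth ≤ 128
  | store a r c e, _ => e.lower.depth ≤ 128 && (Expr.place a r c).depth + 1 ≤ 128
  | seq s₁ s₂, d => s₁.fits d && s₂.fits d
  | ite e s₁ s₂, d => e.lower.depth ≤ 128 && s₁.fits d && s₂.fits d
  | skip, _ => true
  | loop _ e s, d => e.lower.depth ≤ 128 && d < 31 && s.fits (d + 1)
  | size _ e, _ => e.lower.depth ≤ 128
  | query _, _ => true

end Stmt

end Loop

theorem Nat.size_of_pos {y : ℕ} (hy : 0 < y) : y.size = (y / 2).size + 1 := by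
  have h := Nat.bit_bodd_div2 y
  have h2 : Nat.bit y.bodd y.div2 ≠ 0 := by rw [h]; omega
  rw [← Nat.div2_val]
  conv_lhs => rw [← h]
  exact Nat.size_bit h2

/-- Thus counters and sizes that are at most `L` also satisfy the bound for lengths. -/
theorem intLen_natCast_le {i L : ℕ} (hi : i ≤ L) (hL : 9 ≤ L) : intLen (i : ℤ) ≤ L := by
  have key : ∀ L, 9 ≤ L → L < 2 ^ (L - 1) := by
    intro L hL
    induction L, hL using Nat.le_induction with
    | base => norm_num
    | succ L hL ih =>
      rw [Nat.add_sub_cancel]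
      obtain ⟨k, rfl⟩ := Nat.exists_eq_add_of_le' (show 1 ≤ L by omega)
      rw [Nat.add_sub_cancel] at ih
      rw [pow_succ]; omega
  have := intLen_natCast_lt (lt_of_le_of_lt hi (key L hL))
  omega

/-! ### Simulation of assignments, `size` and loops -/

namespace Loop

open RAM (Cmd Exec)

variable {V A : Type} [Layout V A] [DecidableEq V] [DecidableEq A] {X : Context}
  {m m' : RAM.State} {σ : State V A}

omit [DecidableEq A] in
theorem Rep.set (h : Rep X m σ) {x : V} {z : ℤ} (ha : m'.ans = m.ans)
    (hm : ∀ i, i < 128 ∨ 256 ≤ i → m'.mem i = if i = Layout.var A x then z else m.mem i)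
    (hz : intLen z ≤ X.L) : Rep X m' (σ.set x z) where
  var y := by
    have := Layout.var_lt (V := V) (A := A) y
    rw [hm _ (by omega), State.set_scal, h.var]
    simp only [(Layout.var_injective (A := A)).eq_iff]
  arr a r c hr hc := by
    have := Layout.var_lt (V := V) (A := A) x
    rw [hm _ (by unfold addr; omega), if_neg (by unfold addr; omega), h.arr a r c hr hc]
    rfl
  ans := ha.trans h.ans
  size := by
    have := Layout.var_lt (V := V) (A := A) x
    rw [hm _ (by omega), if_neg (by omega), h.size]
  bound i hi := by
    rw [hm i hi]
    split_ifs
    · exact hz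
    · exact h.bound i hi

omit [DecidableEq V] in
theorem Rep.put (h : Rep X m σ) {a : A} {r c : ℕ} {z : ℤ} (ha : m'.ans = m.ans)
    (hr : r < X.S) (hc : c < X.S)
    (hm : ∀ i, i < 128 ∨ 256 ≤ i →
      m'.mem i = if i = addr X.S (Layout.arr V a) r c then z else m.mem i)
    (hz : intLen z ≤ X.L) : Rep X m' (σ.put a r c z) where
  var y := by
    have := Layout.var_lt (V := V) (A := A) y
    rw [hm _ (by omega), if_neg (by unfold addr; omega), h.var]
    rfl
  arr b r' c' hr' hc' := by
    rw [hm _ (by unfold addr; omega), State.put_arr, h.arr b r' c' hr' hc']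
    congr 1
    refine propext ⟨fun he => ?_, ?_⟩
    · obtain ⟨h1, h2, h3⟩ := addr_injective hr' hc' hr hc he
      exact ⟨Layout.arr_injective (V := V) h1, h2, h3⟩
    · rintro ⟨rfl, rfl, rfl⟩; rfl
  ans := ha.trans h.ans
  size := by rw [hm _ (by omega), if_neg (by unfold addr; omega), h.size]
  bound i hi := by
    rw [hm i hi]
    split_ifs
    · exact hz
    · exact h.bound i hi

omit [DecidableEq V] [DecidableEq A] in
theorem Rep.exec_eval (hX : X.Valid) (h : Rep X m σ) {e : MemExpr} {d : ℕ}
    (hd : e.depth + d ≤ 128) (he : e.Ok X.input m) :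
    ∃ t m', Exec X.O X.input (e.compile d) m t m' ∧ m'.mem (128 + d) = e.eval X.input m ∧
      m'.ans = m.ans ∧ (∀ i, i < 128 + d ∨ 256 ≤ i → m'.mem i = m.mem i) ∧ t ≤ e.cost * X.L ∧
      Rep X m' σ ∧ intLen (e.eval X.input m) ≤ e.len * X.L := by
  obtain ⟨t, m₁, h1, h2, h3, h4, h5⟩ :=
    MemExpr.evaluates_compile (O := X.O) hX.nine_le hX.input_le hd h.bound he
  exact ⟨t, m₁, h1, h2, h3, h4, h5, h.congr h3 fun i hi => h4 i (by omega),
    MemExpr.intLen_eval_le hX.nine_le hX.input_le h.bound he⟩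

omit [Layout V A] [DecidableEq V] [DecidableEq A] in
theorem exec_set (O : Oracle) (input : List ℤ) (m : RAM.State) (d : RAM.Dest) (o : RAM.Op)
    (a b : RAM.Operand) {i : ℕ} {z : ℤ} (hi : d.addr m = i)
    (hz : o.eval (a.eval input m) (b.eval input m) = z) :
    ∃ m', Exec O input (.set d o a b) m (1 + d.cost m + a.cost input m + b.cost input m) m' ∧
      m'.ans = m.ans ∧ ∀ j, m'.mem j = if j = i then z else m.mem j :=
  ⟨_, .set d o a b m, rfl, fun _ => by rw [hi, hz]; exact Function.update_apply _ _ _ _⟩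

/-- Computing the number of binary digits of the number in the register `128`. -/
theorem exec_size {O : Oracle} {input : List ℤ} {x L Z : ℕ} (hx : x < 64) :
    ∀ (y k : ℕ) (m : RAM.State), (m.mem 128).toNat = y → intLen (m.mem 128) ≤ Z →
      m.mem x = k → (∀ j ≤ y.size, intLen ((k + j : ℕ) : ℤ) ≤ L) →
      ∃ t m', Exec O input (.whilePos (.reg 128) (.seq
        (.set (.reg 128) .div (.reg 128) (.const 2))
        (.set (.reg x) .add (.reg x) (.const 1)))) m t m' ∧ m'.ans = m.ans ∧
        (∀ i, i < 128 ∨ 256 ≤ i →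
          m'.mem i = if i = x then ((k + y.size : ℕ) : ℤ) else m.mem i) ∧
        t ≤ (y.size + 1) * (2 * Z + L + 62) := by
  have h128 : intLen ((128 : ℕ) : ℤ) ≤ 9 := MemExpr.intLen_small (by norm_num)
  have hx9 : intLen (x : ℤ) ≤ 9 := MemExpr.intLen_small (by omega)
  intro y
  induction y using Nat.strong_induction_on with
  | _ y ih =>
    intro k m hy hZ hk hL
    by_cases hpos : 0 < m.mem 128
    · have hy0 : 0 < y := by omega
      have hsz := Nat.size_of_pos hy0
      obtain ⟨m₁, e1, s1, b⟩ := exec_set O input m (.reg 128) .div (.reg 128) (.const 2)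
        (i := 128) (z := m.mem 128 / 2) rfl rfl
      obtain ⟨m₂, e2, s2, a⟩ := exec_set O input m₁ (.reg x) .add (.reg x) (.const 1)
        (i := x) (z := m₁.mem x + 1) rfl rfl
      have b1 : m₁.mem x = m.mem x := by rw [b, if_neg (by omega)]
      have a1 : m₂.mem 128 = m.mem 128 / 2 := by rw [a, if_neg (by omega), b, if_pos rfl]
      have a2 : m₂.mem x = (k + 1 : ℕ) := by rw [a, if_pos rfl, b1, hk]; rfl
      have a3 : ∀ i, i < 128 ∨ 256 ≤ i → i ≠ x → m₂.mem i = m.mem i := by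
        intro i hi hix
        rw [a, if_neg hix, b, if_neg (by omega)]
      have hy2 : (m₂.mem 128).toNat = y / 2 := by rw [a1]; omega
      obtain ⟨t, m₃, c1, c2, c3, c4⟩ := ih (y / 2) (by omega) (k + 1) m₂ hy2
        (by
          rw [a1]
          exact (intLen_mono (Int.natAbs_ediv_le_natAbs _ _)).trans hZ) a2
        (fun j hj => by
          have := hL (j + 1) (by omega)
          rwa [show k + 1 + j = k + (j + 1) by ring])
      refine ⟨_, m₃, .while_pos hpos (e1.seq e2) c1, c2.trans (s2.trans s1), fun i hi => ?_, ?_⟩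
      · rw [c3 i hi, hsz]
        by_cases hix : i = x
        · rw [if_pos hix, if_pos hix]; push_cast; ring
        · rw [if_neg hix, if_neg hix, a3 i hi hix]
      · have hk' := hL 0 (Nat.zero_le _)
        rw [add_zero, ← hk] at hk'
        have : intLen 2 = 3 := by decide
        have : intLen 1 = 2 := by decide
        rw [hsz, add_mul]
        simp only [RAM.Dest.cost, RAM.Operand.cost, b1]
        omega
    · have hy0 : y = 0 := by omega
      subst hy0
      refine ⟨_, m, .while_neg hpos, rfl, fun i hi => ?_, ?_⟩
      · split_ifs with hix
        · rw [hix, hk]; simp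
        · rfl
      · simp only [RAM.Operand.cost, Nat.size_zero]
        omega

namespace Stmt

/-- Induction on the number `r` of iterations still to come. The counters survive the body because
the body is compiled at depth `d + 1` and leaves all counters of smaller depth alone. -/
theorem exec_loop (hX : X.Valid) {x : V} {s : Stmt V A} {d T : ℕ} (hd : d < 31)
    (hbody : ∀ (i : ℕ) (m : RAM.State) (σ : State V A), Rep X m (σ.set x i) →
      s.Safe X (σ.set x i) → ∃ t m', Exec X.O X.input (s.compile (d + 1)) m t m' ∧
        Rep X m' (s.run X (σ.set x i)) ∧
        (∀ i, 65 ≤ i → i < 65 + 2 * (d + 1) → m'.mem i = m.mem i) ∧ t ≤ T)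
    {k : ℕ} (hk : k ≤ X.L) {σ : State V A}
    (hsafe : ∀ i < k, s.Safe X ((iter (fun i τ => s.run X (τ.set x i)) i σ).set x i)) :
    ∀ (r i : ℕ) (m : RAM.State), i + r = k →
      Rep X m (iter (fun i τ => s.run X (τ.set x i)) i σ) → m.mem (65 + 2 * d) = r →
      m.mem (66 + 2 * d) = i →
      ∃ t m', Exec X.O X.input (.whilePos (.reg (65 + 2 * d)) (.seq
        (.set (.reg (Layout.var A x)) .add (.reg (66 + 2 * d)) (.const 0)) (.seq
        (s.compile (d + 1)) (.seq
        (.set (.reg (66 + 2 * d)) .add (.reg (66 + 2 * d)) (.const 1))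
        (.set (.reg (65 + 2 * d)) .sub (.reg (65 + 2 * d)) (.const 1)))))) m t m' ∧
        Rep X m' (iter (fun i τ => s.run X (τ.set x i)) k σ) ∧
        (∀ i, 65 ≤ i → i < 65 + 2 * d → m'.mem i = m.mem i) ∧
        t ≤ (r + 1) * (T + 20 * X.L) := by
  have h9 := hX.nine_le
  have hx := Layout.var_lt (V := V) (A := A) x
  have l1 : intLen ((65 + 2 * d : ℕ) : ℤ) ≤ 9 := MemExpr.intLen_small (by omega)
  have l2 : intLen ((66 + 2 * d : ℕ) : ℤ) ≤ 9 := MemExpr.intLen_small (by omega)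
  have l3 : intLen (Layout.var A x : ℤ) ≤ 9 := MemExpr.intLen_small (by omega)
  have l4 : intLen 1 = 2 := by decide
  have l5 := MemExpr.intLen_zero
  intro r
  induction r with
  | zero =>
    intro i m hi hrep hr hi'
    have : i = k := by omega
    subst this
    refine ⟨_, m, .while_neg (by simp [RAM.Operand.eval, hr]), hrep, fun _ _ _ => rfl, ?_⟩
    simp only [RAM.Operand.cost, hr, Nat.cast_zero, l5]
    omega
  | succ r ih =>
    intro i m hi hrep hr hi'
    have li : intLen (i : ℤ) ≤ X.L := intLen_natCast_le (by omega) h9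
    have lr : intLen ((r + 1 : ℕ) : ℤ) ≤ X.L := intLen_natCast_le (by omega) h9
    obtain ⟨m₁, e1, s1, a1⟩ := exec_set X.O X.input m (.reg (Layout.var A x)) .add
      (.reg (66 + 2 * d)) (.const 0) (i := Layout.var A x) (z := i) rfl (by simp [RAM.Op.eval, RAM.Operand.eval, hi'])
    have rep₁ := hrep.set (m' := m₁) (x := x) (z := i) s1 (fun j _ => a1 j) li
    obtain ⟨t₂, m₂, e2, rep₂, fr₂, ht₂⟩ := hbody i m₁ _ rep₁ (hsafe i (by omega))
    have b1 : m₂.mem (65 + 2 * d) = (r + 1 : ℕ) := by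
      rw [fr₂ _ (by omega) (by omega), a1, if_neg (by omega), hr]
    have b2 : m₂.mem (66 + 2 * d) = i := by
      rw [fr₂ _ (by omega) (by omega), a1, if_neg (by omega), hi']
    obtain ⟨m₃, e3, s3, c1⟩ := exec_set X.O X.input m₂ (.reg (66 + 2 * d)) .add
      (.reg (66 + 2 * d)) (.const 1) (i := 66 + 2 * d) (z := (i + 1 : ℕ)) rfl
      (by simp [RAM.Op.eval, RAM.Operand.eval, b2])
    have b3 : m₃.mem (65 + 2 * d) = (r + 1 : ℕ) := by rw [c1, if_neg (by omega), b1]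
    obtain ⟨m₄, e4, s4, d1⟩ := exec_set X.O X.input m₃ (.reg (65 + 2 * d)) .sub
      (.reg (65 + 2 * d)) (.const 1) (i := 65 + 2 * d) (z := r) rfl
      (by simp [RAM.Op.eval, RAM.Operand.eval, b3])
    have rep₄ : Rep X m₄ (iter (fun i τ => s.run X (τ.set x i)) (i + 1) σ) := by
      refine ⟨fun y => ?_, fun a r c hr hc => ?_, s4.trans (s3.trans rep₂.ans), ?_, fun j hj => ?_⟩
      · have := Layout.var_lt (V := V) (A := A) y
        rw [d1, if_neg (by omega), c1, if_neg (by omega)]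
        exact rep₂.var y
      · rw [d1, if_neg (by unfold addr; omega), c1, if_neg (by unfold addr; omega)]
        exact rep₂.arr a r c hr hc
      · rw [d1, if_neg (by omega), c1, if_neg (by omega)]
        exact rep₂.size
      · rw [d1]
        split_ifs
        · exact intLen_natCast_le (by omega) h9
        · rw [c1]
          split_ifs
          · exact intLen_natCast_le (i := i + 1) (by omega) h9
          · exact rep₂.bound j hj
    obtain ⟨t₅, m₅, e5, rep₅, fr₅, ht₅⟩ := ih (i + 1) m₄ (by omega) rep₄
      (by rw [d1, if_pos rfl]) (by rw [d1, if_neg (by omega), c1, if_pos rfl])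
    refine ⟨_, m₅, .while_pos (by simp [RAM.Operand.eval, hr])
      (e1.seq (e2.seq (e3.seq e4))) e5, rep₅, fun j hj hj' => ?_, ?_⟩
    · rw [fr₅ j hj hj', d1, if_neg (by omega), c1, if_neg (by omega), fr₂ j hj (by omega), a1,
        if_neg (by omega)]
    · simp only [RAM.Dest.cost, RAM.Operand.cost, l4, l5]
      rw [hr, hi', b2, b3, add_mul (r + 1)]
      omega

end Stmt

end Loop

/-! ### Simulation of arbitrary statements -/

namespace Loop

open RAM (Cmd Exec)

variable {V A : Type} [Layout V A] [DecidableEq V] [DecidableEq A] {X : Context}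

theorem sum_map_le {α : Type*} (l : List α) (f : α → ℕ) {B : ℕ} (h : ∀ x ∈ l, f x ≤ B) :
    (l.map f).sum ≤ l.length * B := by
  simpa using List.sum_le_card_nsmul (l.map f) B (by simpa using h)

/-- Induction on the statement. `Rep` fixes nothing about the counters of loops but their length, so
the preservation of the counters of the enclosing loops, in the registers from `65` to below `65 + 2
* d`, is a separate part of the claim. -/
theorem Stmt.exec_compile (hX : X.Valid) (s : Stmt V A) :
    ∀ (d : ℕ) (m : RAM.State) (σ : State V A), d ≤ 31 → s.fits d → Rep X m σ → s.Safe X σ →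
      ∃ t m', Exec X.O X.input (s.compile d) m t m' ∧ Rep X m' (s.run X σ) ∧
        (∀ i, 65 ≤ i → i < 65 + 2 * d → m'.mem i = m.mem i) ∧ t ≤ s.cost X.L := by
  have h9 := hX.nine_le
  have l0 := MemExpr.intLen_zero
  have h128 : intLen ((128 : ℕ) : ℤ) ≤ 9 := MemExpr.intLen_small (by norm_num)
  have h129 : intLen ((129 : ℕ) : ℤ) ≤ 9 := MemExpr.intLen_small (by norm_num)
  have hvar : ∀ x : V, intLen (Layout.var A x : ℤ) ≤ 9 := fun x =>
    MemExpr.intLen_small ((Layout.var_lt x).trans (by norm_num))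
  induction s with
  | assign x e =>
    intro d m σ hd31 hfit hrep hsafe
    simp only [fits, decide_eq_true_eq] at hfit
    have hx := Layout.var_lt (V := V) (A := A) x
    have hx9 := hvar x
    obtain ⟨v1, v2⟩ := hrep.eval_lower hsafe.1
    obtain ⟨t₁, m₁, e1, a1, a2, a3, a4, rep₁, a5⟩ := hrep.exec_eval hX (d := 0) hfit v2
    obtain ⟨m₂, e2, b1, b2⟩ := exec_set X.O X.input m₁ (.reg (Layout.var A x)) .add (.reg 128)
      (.const 0) (i := Layout.var A x) (z := e.eval X σ) rfl
      (by simp only [RAM.Op.eval, RAM.Operand.eval, add_zero]; rw [← v1, ← a1])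
    refine ⟨_, m₂, e1.seq e2, rep₁.set b1 (fun j _ => b2 j) hsafe.2, fun j hj hj' => ?_, ?_⟩
    · rw [b2, if_neg (by omega), a3 j (by omega)]
    · simp only [RAM.Dest.cost, RAM.Operand.cost, cost, add_mul, l0]
      simp only [add_zero] at a1
      rw [a1]
      omega
  | store a r c e =>
    intro d m σ hd31 hfit hrep hsafe
    simp only [fits, decide_eq_true_eq, Bool.and_eq_true] at hfit
    obtain ⟨⟨hr, hc, ⟨hr0, hrS⟩, hc0, hcS⟩, he, hz⟩ := hsafe
    obtain ⟨v1, v2⟩ := hrep.eval_lower he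
    obtain ⟨t₁, m₁, e1, a1, a2, a3, a4, rep₁, a5⟩ := hrep.exec_eval hX (d := 0) hfit.1 v2
    obtain ⟨r1, r2⟩ := rep₁.eval_lower hr
    obtain ⟨c1, c2⟩ := rep₁.eval_lower hc
    have p1 : (Expr.place a r c).eval X.input m₁ = _ :=
      rep₁.eval_addrExpr (k := Layout.arr V a) (r1.trans (Int.toNat_of_nonneg hr0).symm)
        (c1.trans (Int.toNat_of_nonneg hc0).symm)
    obtain ⟨t₂, m₂, e2, b1, b2, b3, b4, rep₂, b5⟩ := rep₁.exec_eval hX (d := 1)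
      (e := Expr.place a r c) hfit.2 (addrExpr_ok r2 c2)
    have hv : m₂.mem 128 = e.eval X σ := by rw [b3 128 (by omega), ← v1]; exact a1
    have hp : m₂.mem 129 = (Expr.place a r c).eval X.input m₁ := b1
    obtain ⟨m₃, e3, c1, c2⟩ := exec_set X.O X.input m₂ (.ind 129) .add (.reg 128)
      (.const 0) (i := addr X.S (Layout.arr V a) (r.eval X σ).toNat (c.eval X σ).toNat)
      (z := e.eval X σ)
      (by rw [RAM.Dest.addr, hp, p1, Int.toNat_natCast])
      (by simp only [RAM.Op.eval, RAM.Operand.eval, add_zero]; rw [hv])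
    refine ⟨_, m₃, e1.seq (e2.seq e3), rep₂.put c1 (by omega) (by omega) (fun j _ => c2 j) hz,
      fun j hj hj' => ?_, ?_⟩
    · rw [c2, b3 j (by omega), a3 j (by omega)]
      split_ifs with h
      · unfold addr at h; omega
      · rfl
    · simp only [RAM.Dest.cost, RAM.Operand.cost, cost, add_mul, l0]
      rw [hv, hp]
      rw [v1] at a5
      omega
  | seq s₁ s₂ h₁ h₂ =>
    intro d m σ hd31 hfit hrep hsafe
    simp only [fits, Bool.and_eq_true] at hfit
    obtain ⟨t₁, m₁, e1, rep₁, f1, a1⟩ := h₁ d m σ hd31 hfit.1 hrep hsafe.1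
    obtain ⟨t₂, m₂, e2, rep₂, f2, a2⟩ := h₂ d m₁ _ hd31 hfit.2 rep₁ hsafe.2
    exact ⟨_, m₂, e1.seq e2, rep₂, fun j hj hj' => (f2 j hj hj').trans (f1 j hj hj'),
      add_le_add a1 a2⟩
  | ite e s₁ s₂ h₁ h₂ =>
    intro d m σ hd31 hfit hrep hsafe
    simp only [fits, Bool.and_eq_true, decide_eq_true_eq] at hfit
    obtain ⟨v1, v2⟩ := hrep.eval_lower hsafe.1
    obtain ⟨t₁, m₁, e1, a1, a2, a3, a4, rep₁, a5⟩ := hrep.exec_eval hX (d := 0) hfit.1.1 v2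
    rw [v1] at a1 a5
    simp only [add_zero] at a1
    have hs := hsafe.2
    by_cases hpos : 0 < e.eval X σ
    · rw [if_pos hpos] at hs
      obtain ⟨t₂, m₂, e2, rep₂, f2, b2⟩ := h₁ d m₁ σ hd31 hfit.1.2 rep₁ hs
      refine ⟨_, m₂, e1.seq (.ifPos_pos (by rw [RAM.Operand.eval, a1]; exact hpos) e2), ?_,
        fun j hj hj' => ?_, ?_⟩
      · rwa [run, if_pos hpos]
      · rw [f2 j hj hj', a3 j (by omega)]
      · simp only [RAM.Operand.cost, cost, add_mul]
        rw [a1]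
        omega
    · rw [if_neg hpos] at hs
      obtain ⟨t₂, m₂, e2, rep₂, f2, b2⟩ := h₂ d m₁ σ hd31 hfit.2 rep₁ hs
      refine ⟨_, m₂, e1.seq (.ifPos_neg (by rw [RAM.Operand.eval, a1]; exact hpos) e2), ?_,
        fun j hj hj' => ?_, ?_⟩
      · rwa [run, if_neg hpos]
      · rw [f2 j hj hj', a3 j (by omega)]
      · simp only [RAM.Operand.cost, cost, add_mul]
        rw [a1]
        omega
  | skip =>
    intro d m σ _ _ hrep _
    exact ⟨_, m, .skip m, hrep, fun _ _ _ => rfl, le_rfl⟩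
  | loop x e s ih =>
    intro d m σ hd31 hfit hrep hsafe
    simp only [fits, Bool.and_eq_true, decide_eq_true_eq] at hfit
    obtain ⟨⟨hfit1, hd⟩, hfit2⟩ := hfit
    obtain ⟨he, ⟨hk0, hk⟩, hbody⟩ := hsafe
    obtain ⟨v1, v2⟩ := hrep.eval_lower he
    obtain ⟨t₁, m₁, e1, a1, a2, a3, a4, rep₁, a5⟩ := hrep.exec_eval hX (d := 0) hfit1 v2
    rw [v1] at a1 a5
    simp only [add_zero] at a1
    have l1 : intLen ((65 + 2 * d : ℕ) : ℤ) ≤ 9 := MemExpr.intLen_small (by omega)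
    have l2 : intLen ((66 + 2 * d : ℕ) : ℤ) ≤ 9 := MemExpr.intLen_small (by omega)
    obtain ⟨m₂, e2, b1, b2⟩ := exec_set X.O X.input m₁ (.reg (65 + 2 * d)) .add (.reg 128)
      (.const 0) (i := 65 + 2 * d) (z := e.eval X σ) rfl
      (by simp only [RAM.Op.eval, RAM.Operand.eval, add_zero]; exact a1)
    obtain ⟨m₃, e3, c1, c2⟩ := exec_set X.O X.input m₂ (.reg (66 + 2 * d)) .add (.const 0)
      (.const 0) (i := 66 + 2 * d) (z := (0 : ℕ)) rfl rfl
    have hk' : ((e.eval X σ).toNat : ℤ) = e.eval X σ := Int.toNat_of_nonneg hk0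
    have hkL : (e.eval X σ).toNat ≤ X.L := by omega
    have d1 : m₃.mem (65 + 2 * d) = e.eval X σ := by rw [c2, if_neg (by omega), b2, if_pos rfl]
    have rep₃ : Rep X m₃ σ := by
      refine ⟨fun y => ?_, fun a r c hr hc => ?_, c1.trans (b1.trans rep₁.ans), ?_, fun j hj => ?_⟩
      · have := Layout.var_lt (V := V) (A := A) y
        rw [c2, if_neg (by omega), b2, if_neg (by omega), rep₁.var]
      · rw [c2, if_neg (by unfold addr; omega), b2, if_neg (by unfold addr; omega),
          rep₁.arr a r c hr hc]
      · rw [c2, if_neg (by omega), b2, if_neg (by omega), rep₁.size]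
      · rw [c2]
        split_ifs
        · exact intLen_natCast_le (Nat.zero_le _) h9
        · rw [b2]
          split_ifs
          · rw [← hk']; exact intLen_natCast_le hkL h9
          · exact rep₁.bound j hj
    obtain ⟨t₄, m₄, e4, rep₄, f4, ht₄⟩ := exec_loop hX (x := x) (s := s) (T := s.cost X.L) hd
      (fun i m τ hm hs => ih (d + 1) m _ hd hfit2 hm hs) hkL hbody (e.eval X σ).toNat 0 m₃
      (by omega) rep₃ (by rw [d1, hk']) (by rw [c2, if_pos rfl])
    refine ⟨_, m₄, e1.seq (e2.seq (e3.seq e4)), rep₄, fun j hj hj' => ?_, ?_⟩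
    · rw [f4 j hj hj', c2, if_neg (by omega), b2, if_neg (by omega), a3 j (by omega)]
    · have h2 := Nat.mul_le_mul_right (s.cost X.L + 20 * X.L) (Nat.add_le_add_right hkL 1)
      simp only [RAM.Dest.cost, RAM.Operand.cost, cost, l0]
      rw [a1, add_mul _ 60, add_mul]
      omega
  | size x e =>
    intro d m σ hd31 hfit hrep hsafe
    simp only [fits, decide_eq_true_eq] at hfit
    have hx := Layout.var_lt (V := V) (A := A) x
    have hx9 := hvar x
    obtain ⟨v1, v2⟩ := hrep.eval_lower hsafe.1
    obtain ⟨t₁, m₁, e1, a1, a2, a3, a4, rep₁, a5⟩ := hrep.exec_eval hX (d := 0) hfit v2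
    rw [v1] at a1 a5
    simp only [add_zero] at a1
    obtain ⟨m₂, e2, b1, b2⟩ := exec_set X.O X.input m₁ (.reg (Layout.var A x)) .add (.const 0)
      (.const 0) (i := Layout.var A x) (z := (0 : ℕ)) rfl rfl
    have h128 : m₂.mem 128 = e.eval X σ := by rw [b2, if_neg (by omega), a1]
    obtain ⟨t₃, m₃, e3, c1, c2, c3⟩ := exec_size (O := X.O) (input := X.input) (L := X.L)
      (Z := e.lower.len * X.L) hx
      (e.eval X σ).toNat 0 m₂ (by rw [h128]) (by rw [h128]; exact a5)
      (by rw [b2, if_pos rfl]) (fun j hj => by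
        refine (intLen_mono ?_).trans hsafe.2
        simpa using hj)
    refine ⟨_, m₃, e1.seq (e2.seq e3), rep₁.set (c1.trans b1) (fun j hj => ?_) hsafe.2,
      fun j hj hj' => ?_, ?_⟩
    · rw [c2 j hj, zero_add, b2]
      split_ifs <;> rfl
    · rw [c2 j (by omega), if_neg (by omega), b2, if_neg (by omega), a3 j (by omega)]
    · have h1 : (e.eval X σ).toNat.size ≤ e.lower.len * X.L := by
        refine le_trans ?_ a5
        refine (Nat.size_le_size ?_).trans (Nat.le_add_right _ 1)
        omega
      have h2 := Nat.mul_le_mul (Nat.add_le_add_right h1 1)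
        (show 2 * (e.lower.len * X.L) + X.L + 62 ≤ (2 * e.lower.len + 10) * X.L by
          rw [add_mul, mul_assoc]; omega)
      simp only [RAM.Dest.cost, RAM.Operand.cost, cost, l0]
      rw [add_mul _ 20]
      omega
  | query a =>
    intro d m σ hd31 hfit hrep hsafe
    have hsafe : (σ.arr a 0 0).toNat + 1 ≤ X.S := hsafe
    have p1 : (Expr.origin V a).eval X.input m = _ :=
      hrep.eval_addrExpr (k := Layout.arr V a) (r := 0) (c := 0) rfl rfl
    obtain ⟨t₁, m₁, e1, a1, a2, a3, a4, rep₁, a5⟩ := hrep.exec_eval hX (d := 0)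
      (e := Expr.origin V a) (by simp [Expr.origin, addrExpr, MemExpr.depth]) (addrExpr_ok trivial trivial)
    rw [p1] at a1 a5
    simp only [add_zero] at a1
    have hadr : (RAM.Operand.eval X.input m₁ (.reg 128)).toNat = addr X.S (Layout.arr V a) 0 0 := by
      rw [RAM.Operand.eval, a1, Int.toNat_natCast]
    have hlen : m₁.mem (addr X.S (Layout.arr V a) 0 0) = σ.arr a 0 0 :=
      rep₁.arr a 0 0 (by omega) (by omega)
    have hblock : m₁.block (addr X.S (Layout.arr V a) 0 0) = σ.block a := by
      unfold RAM.State.block State.block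
      rw [hlen]
      refine List.map_congr_left fun j hj => ?_
      rw [List.mem_range] at hj
      rw [← rep₁.arr a 0 (1 + j) (by omega) (by omega)]
      simp only [addr, Nat.add_zero, Nat.add_assoc]
    refine ⟨_, _, e1.seq (.query _ _), ⟨rep₁.var, rep₁.arr, ?_, rep₁.size, rep₁.bound⟩,
      fun j hj hj' => a3 j (by omega), ?_⟩
    · rw [hadr, hblock]; rfl
    · rw [hadr, hblock, hlen]
      have h1 : intLen (σ.arr a 0 0) ≤ X.L := by
        rw [← hlen]; exact rep₁.bound _ (Or.inr (by unfold addr; omega))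
      -- The query occupies part of one row: fewer than `S ≤ L` entries, each of length at most `L`.
      have h2 : listSize (σ.block a) ≤ X.L * X.L := by
        refine (sum_map_le _ _ (B := X.L) fun z hz => ?_).trans
          (Nat.mul_le_mul_right _ ?_)
        · simp only [State.block, List.mem_map, List.mem_range] at hz
          obtain ⟨j, hj, rfl⟩ := hz
          rw [← rep₁.arr a 0 (1 + j) (by omega) (by omega)]
          exact rep₁.bound _ (Or.inr (by unfold addr; omega))
        · have := hX.size_le
          simp only [State.block, List.length_map, List.length_range]
          omega
      simp only [RAM.Operand.cost, cost, add_mul]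
      rw [a1]
      omega

end Loop

/-! ## The program -/

namespace ApproxProgram

open Loop Loop.Expr Loop.Stmt

inductive Var
  | res | n | init | D | i | j | k | l | c | acc | W | rest | len | r | x | size | rank | w | a | b | t
  | p | u
  deriving DecidableEq

inductive Arr
  | live | A | N | M | num | den | wt | rep | query
  deriving DecidableEq

def Var.index (y : Var) : ℕ := y.ctorIdx

def Arr.index (y : Arr) : ℕ := y.ctorIdx

instance : Layout Var Arr where
  var := Var.index
  var_injective y z h := by
    have h2 := congrArg (Var.ofNat) h
    rwa [Var.index, Var.index, Var.ofNat_ctorIdx, Var.ofNat_ctorIdx] at h2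
  var_lt y := by cases y <;> decide
  arr := Arr.index
  arr_injective y z h := by
    have h2 := congrArg (Arr.ofNat) h
    rwa [Arr.index, Arr.index, Arr.ofNat_ctorIdx, Arr.ofNat_ctorIdx] at h2
  arr_lt y := by cases y <;> decide

abbrev E := Expr Var Arr

abbrev S := Stmt Var Arr

local infixr:50 " ;; " => Stmt.seq

abbrev v (y : Var) : E := var y
abbrev get (y : Arr) (i j : E) : E := arr y i j
abbrev input (i : E) : E := inp i
abbrev digit (i : E) : E := ans i

def transNum (i j : E) : E := input (2 + 2 * (i * v .n + j))
def transDen (i j : E) : E := input (3 + 2 * (i * v .n + j))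
def flag (i : E) : E := input (2 + 2 * (v .n * v .n) + 3 * i)
def rewardNum (i : E) : E := input (3 + 2 * (v .n * v .n) + 3 * i)
def rewardDen (i : E) : E := input (4 + 2 * (v .n * v .n) + 3 * i)
def tail (k : ℕ) : E := input (2 + 2 * (v .n * v .n) + 3 * v .n + (const k : E))

def readSizes : S :=
  assign .n (input 0) ;;
  assign .init (input 1)

def commonDenominator : S :=
  assign .D 1 ;;
  loop .i (v .n * v .n) (assign .D (v .D * input (3 + 2 * v .i)))

/-- Marks are updated in place, so a round may mark more states than one step of the closure would;
`n` rounds suffice in any case. The product is positive exactly if the transition exists and its end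
is marked. -/
def reach : S :=
  loop .i (v .n) (store .live 0 (v .i) (flag (v .i))) ;;
  loop .k (v .n) (loop .i (v .n) (loop .j (v .n)
    (ite (transNum (v .i) (v .j) * get .live 0 (v .j)) (store .live 0 (v .i) 1) skip)))

/-- The factor formed from `flag` and `live` erases the transitions of the targets and of the states
that cannot reach a target. -/
def matrix : S :=
  loop .i (v .n)
    (loop .j (v .n)
      (store .A (v .i) (v .j) (0 - (1 - flag (v .i)) * get .live 0 (v .i) *
        (v .D / transDen (v .i) (v .j) * transNum (v .i) (v .j)))) ;;
    store .A (v .i) (v .i) (get .A (v .i) (v .i) + v .D))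

def addScalar : S :=
  loop .i (v .n)
    (loop .j (v .n) (store .M (v .i) (v .j) (get .N (v .i) (v .j))) ;;
    store .M (v .i) (v .i) (get .M (v .i) (v .i) + v .c))

def multiply : S :=
  assign .acc 0 ;;
  loop .i (v .n)
    (loop .j (v .n)
      (assign .t 0 ;;
      loop .l (v .n)
        (assign .t (v .t + get .A (v .i) (v .l) * get .M (v .l) (v .j))) ;;
      store .N (v .i) (v .j) (v .t)) ;;
    assign .acc (v .acc + get .N (v .i) (v .i)))

/-- The array `N` has to be zero at the start, which holds because nothing has been written to it
before. At the end, `M` holds the last auxiliary matrix, the one that inverts `A` up to a scalar. -/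
def leVerrier : S :=
  assign .c 1 ;;
  loop .k (v .n)
    (addScalar ;;
    multiply ;;
    assign .c (0 - v .acc / (v .k + 1)))

/-- All weights are probabilities scaled by `W = c * c`. Candidates of states that are no targets
have value `0` and weight `0`; the extra candidate with index `n` takes the probability of never
entering the target set. -/
def candidates : S :=
  assign .W (v .c * v .c) ;;
  assign .rest (v .W) ;;
  loop .i (v .n)
    (store .num 0 (v .i) (rewardNum (v .i)) ;;
    store .den 0 (v .i) (rewardDen (v .i)) ;;
    store .wt 0 (v .i) (0 - v .D * v .c * get .M (v .init) (v .i) * flag (v .i)) ;;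
    assign .rest (v .rest - get .wt 0 (v .i))) ;;
  store .num 0 (v .n) 0 ;;
  store .den 0 (v .n) 1 ;;
  store .wt 0 (v .n) (v .rest)

/-- The sign of this number is that of the difference of the values of two candidates. -/
def diff (i j : E) : E :=
  get .num 0 i * get .den 0 j - get .num 0 j * get .den 0 i

def representatives : S :=
  assign .len 0 ;;
  loop .i (v .n + 1)
    (assign .r 1 ;;
    loop .j (v .i)
      (assign .x (diff (v .i) (v .j)) ;;
      ite (1 - v .x * v .x) (assign .r 0) skip) ;;
    store .rep 0 (v .i) (v .r) ;;
    assign .len (v .len + v .r))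

def rankAndWeight : S :=
  assign .rank 0 ;;
  assign .w 0 ;;
  loop .j (v .n + 1)
    (assign .x (diff (v .i) (v .j)) ;;
    ite (v .x) (assign .rank (v .rank + get .rep 0 (v .j))) skip ;;
    ite (1 - v .x * v .x) (assign .w (v .w + get .wt 0 (v .j))) skip)

/-- A fixed number of rounds replaces the loop until `b = 0`; rounds after that do nothing. -/
def euclid : S :=
  assign .a (v .w) ;;
  assign .b (v .W) ;;
  loop .j (2 * v .size + 1)
    (ite (v .b)
      (assign .t (v .a - v .b * (v .a / v .b)) ;;
      assign .a (v .b) ;;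
      assign .b (v .t))
      skip)

/-- The entries `0`, `1`, `2` are reserved for the length of the query and its precision. Candidates
of equal value have the same rank and write the same row again. -/
def rows : S :=
  size .size (v .W) ;;
  loop .i (v .n + 1)
    (rankAndWeight ;;
    euclid ;;
    store .query 0 (3 + 4 * v .rank) (get .num 0 (v .i)) ;;
    store .query 0 (4 + 4 * v .rank) (get .den 0 (v .i)) ;;
    store .query 0 (5 + 4 * v .rank) (v .w / v .a) ;;
    store .query 0 (6 + 4 * v .rank) (v .W / v .a))

def ask : S :=
  store .query 0 0 (2 + 4 * v .len) ;;
  store .query 0 1 (tail 0) ;;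
  store .query 0 2 (tail 1) ;;
  query .query

/-- Position `0` of the answer is the sign and position `i + 1` the binary digit `i`. Since `u` may
be negative, `u * u` serves to find `s` with `|u| < 2 ^ s`. The lower `s` digits are collected, and
if there is a further digit, `2 ^ s` replaces the whole number. -/
def decode : S :=
  assign .u (tail 2 * tail 1) ;;
  size .size (v .u * v .u) ;;
  assign .p 1 ;;
  assign .acc 0 ;;
  loop .i (v .size)
    (ite (digit (v .i + 1) - 1) (assign .acc (v .acc + v .p)) skip ;;
    assign .p (v .p * 2)) ;;
  ite (digit (v .size + 1)) (assign .acc (v .p)) skip ;;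
  ite (digit 0 - 1) (assign .acc (0 - v .acc)) skip ;;
  assign .res (v .acc * (tail 0 * tail 3) - v .u)

def program : S :=
  readSizes ;; commonDenominator ;; reach ;; matrix ;; leVerrier ;; candidates ;;
  representatives ;; rows ;; ask ;; decode

theorem fits_program : program.fits 0 = true := by decide +kernel

end ApproxProgram

/-! ### From programs to commands of the machine -/

namespace Loop

open RAM

variable {V A : Type} [Layout V A] [DecidableEq V] [DecidableEq A]

def State.zero (V A : Type) : Loop.State V A := ⟨fun _ => 0, fun _ _ _ => 0, []⟩

/-- Store the number of rows and columns of the arrays, computed from the first entry of the input,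
and then run the program. -/
def Stmt.toCmd (s : Stmt V A) : Cmd :=
  .seq (.set (.reg 64) .add (.inp 0) (.const 0))
    (.seq (.set (.reg 64) .mul (.reg 64) (.const 4))
      (.seq (.set (.reg 64) .add (.reg 64) (.const 8)) (s.compile 0)))

theorem Stmt.returnsWithin_toCmd {X : Context} (hX : X.Valid) {s : Stmt V A}
    (hfit : s.fits 0 = true) {x : V} (hx : Layout.var A x = 0) {n : ℕ}
    (hn : X.input.getD 0 0 = n) (hS : X.S = 4 * n + 8)
    {Q : ℤ → Prop} (h : s.Ensures X (State.zero V A) fun τ => Q (τ.scal x)) :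
    ∃ z, Q z ∧
      ReturnsWithin X.O s.toCmd X.input (s.cost X.L + 20 * X.L) (decide (0 < z)) := by
  have h9 := hX.nine_le
  have h64 : intLen ((64 : ℕ) : ℤ) ≤ 9 := MemExpr.intLen_small (by norm_num)
  have l0 := MemExpr.intLen_zero
  have l4 : intLen 4 = 4 := by decide
  have l8 : intLen 8 = 5 := by decide
  have ln : intLen (n : ℤ) ≤ X.L := by
    rw [← hn]; exact MemExpr.intLen_getD_le hX.input_le (by omega) 0
  have hSL := hX.size_le
  have l4n : intLen ((4 * n : ℕ) : ℤ) ≤ X.L := intLen_natCast_le (by omega) h9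
  obtain ⟨m₁, e1, a1, a2⟩ := exec_set X.O X.input State.initial (.reg 64) .add (.inp 0) (.const 0)
    (i := 64) (z := n) rfl (by
      simp only [Op.eval, Operand.eval, State.initial, Int.toNat_zero, hn, add_zero])
  have v1 : m₁.mem 64 = n := by rw [a2, if_pos rfl]
  obtain ⟨m₂, e2, b1, b2⟩ := exec_set X.O X.input m₁ (.reg 64) .mul (.reg 64) (.const 4)
    (i := 64) (z := (4 * n : ℕ)) rfl (by
      simp only [Op.eval, Operand.eval, v1]; push_cast; ring)
  have v2 : m₂.mem 64 = (4 * n : ℕ) := by rw [b2, if_pos rfl]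
  obtain ⟨m₃, e3, c1, c2⟩ := exec_set X.O X.input m₂ (.reg 64) .add (.reg 64) (.const 8)
    (i := 64) (z := X.S) rfl (by
      simp only [Op.eval, Operand.eval, v2, hS]; push_cast; ring)
  have hm : ∀ j, j ≠ 64 → m₃.mem j = 0 := by
    intro j hj
    rw [c2, if_neg hj, b2, if_neg hj, a2, if_neg hj]; rfl
  have rep : Rep X m₃ (State.zero V A) := by
    refine ⟨fun y => ?_, fun a r c _ _ => ?_, c1.trans (b1.trans a1), by rw [c2, if_pos rfl],
      fun j _ => ?_⟩
    · have := Layout.var_lt (V := V) (A := A) y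
      rw [hm _ (by omega)]; rfl
    · rw [hm _ (by unfold addr; omega)]; rfl
    · by_cases hj : j = 64
      · rw [c2, if_pos hj]; exact intLen_natCast_le hSL h9
      · rw [hm j hj, l0]; omega
  obtain ⟨t, m₄, e4, rep₄, -, ht⟩ := s.exec_compile hX 0 m₃ _ (Nat.zero_le _) hfit rep h.1
  refine ⟨_, h.2, _, m₄, e1.seq (e2.seq (e3.seq e4)), ?_, ?_⟩
  · simp only [Dest.cost, Operand.cost, v1, v2, l0, l4, l8, State.initial, Int.toNat_zero, hn,
      Nat.cast_zero]
    omega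
  · rw [← rep₄.var, hx]

end Loop

/-! ## Reading the encoding of an instance -/

theorem List.length_flatten_ofFn {α : Type*} {n k : ℕ} {f : Fin n → List α}
    (hf : ∀ i, (f i).length = k) : (List.ofFn f).flatten.length = n * k := by
  simp [List.length_flatten, List.map_ofFn, Function.comp_def, hf]

theorem List.getD_flatten_ofFn {α : Type*} {n k : ℕ} {f : Fin n → List α}
    (hf : ∀ i, (f i).length = k) (i : Fin n) {r : ℕ} (hr : r < k) (d : α) :
    (List.ofFn f).flatten.getD (i * k + r) d = (f i).getD r d := by
  induction n with
  | zero => exact i.elim0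
  | succ n ih =>
    rw [List.ofFn_succ, List.flatten_cons]
    refine Fin.cases ?_ (fun j => ?_) i
    · rw [List.getD_append _ _ _ _ (by rw [hf]; simpa using hr)]
      simp
    · rw [List.getD_append_right _ _ _ _ (by rw [hf, Fin.val_succ, add_mul]; omega), hf,
        ← ih (fun j => hf j.succ) j, Fin.val_succ, add_mul]
      congr 1
      omega

namespace ApproxInstance

variable (I : ApproxInstance)

/-- The reward of a state, which is `0` outside of the set of target states. -/
def reward (s : Fin I.M.n) : ℚ := if h : s ∈ I.Φ.F then I.Φ.r ⟨s, h⟩ else 0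

def transitions : List ℤ :=
  (List.ofFn fun s => (List.ofFn fun t => encodeRat (I.M.δ s t)).flatten).flatten

def rewards : List ℤ :=
  (List.ofFn fun s => (if s ∈ I.Φ.F then 1 else 0) :: encodeRat (I.reward s)).flatten

theorem encode_eq : I.encode = [(I.M.n : ℤ), (I.M.init : ℕ)] ++ (I.transitions ++ (I.rewards ++
    [I.ε.num, (I.ε.den : ℤ), I.v.num, (I.v.den : ℤ)])) := by
  have h : (fun s => if h : s ∈ I.Φ.F then (1 : ℤ) :: encodeRat (I.Φ.r ⟨s, h⟩)
      else 0 :: encodeRat 0) =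
      fun s => (if s ∈ I.Φ.F then 1 else 0) :: encodeRat (I.reward s) := by
    funext s
    by_cases hs : s ∈ I.Φ.F <;> simp [reward, hs]
  rw [encode, h]
  simp [transitions, rewards, encodeRat]

theorem length_row (s : Fin I.M.n) :
    (List.ofFn fun t => encodeRat (I.M.δ s t)).flatten.length = I.M.n * 2 :=
  List.length_flatten_ofFn fun _ => rfl

theorem length_transitions : I.transitions.length = 2 * (I.M.n * I.M.n) := by
  rw [transitions, List.length_flatten_ofFn I.length_row]
  ring

theorem length_rewards : I.rewards.length = 3 * I.M.n := by
  rw [rewards, List.length_flatten_ofFn (k := 3) fun _ => rfl, mul_comm]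

theorem encode_zero : I.encode.getD 0 0 = I.M.n := by
  rw [encode_eq]; rfl

theorem encode_one : I.encode.getD 1 0 = (I.M.init : ℕ) := by
  rw [encode_eq]; rfl

theorem encode_transitions {k : ℕ} (hk : k < 2 * (I.M.n * I.M.n)) :
    I.encode.getD (2 + k) 0 = I.transitions.getD k 0 := by
  rw [encode_eq, List.getD_append_right _ _ _ _ (by simp),
    List.getD_append _ _ _ _ (by simp [length_transitions, hk])]
  simp

theorem pair_lt {n s t : ℕ} (hs : s < n) (ht : t < n) : s * n + t < n * n := by
  nlinarith

theorem encode_num (s t : Fin I.M.n) :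
    I.encode.getD (2 + 2 * (s * I.M.n + t)) 0 = (I.M.δ s t).num := by
  have h := pair_lt s.2 t.2
  rw [encode_transitions _ (by omega),
    show 2 * ((s : ℕ) * I.M.n + t) = s * (I.M.n * 2) + (t * 2 + 0) by ring, transitions,
    List.getD_flatten_ofFn I.length_row _ (by omega),
    List.getD_flatten_ofFn (k := 2) (fun _ => rfl) _ (by norm_num)]
  rfl

theorem encode_den (s t : Fin I.M.n) :
    I.encode.getD (3 + 2 * (s * I.M.n + t)) 0 = (I.M.δ s t).den := by
  have h := pair_lt s.2 t.2
  rw [show 3 + 2 * ((s : ℕ) * I.M.n + t) = 2 + (2 * (s * I.M.n + t) + 1) by ring,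
    encode_transitions _ (by omega),
    show 2 * ((s : ℕ) * I.M.n + t) + 1 = s * (I.M.n * 2) + (t * 2 + 1) by ring, transitions,
    List.getD_flatten_ofFn I.length_row _ (by omega),
    List.getD_flatten_ofFn (k := 2) (fun _ => rfl) _ (by norm_num)]
  rfl

theorem encode_rewards {k : ℕ} (hk : k < 3 * I.M.n) :
    I.encode.getD (2 + (2 * (I.M.n * I.M.n) + k)) 0 = I.rewards.getD k 0 := by
  rw [encode_eq, List.getD_append_right _ _ _ _ (by simp),
    List.getD_append_right _ _ _ _ (by simp [length_transitions]),
    List.getD_append _ _ _ _ (by simp [length_transitions, length_rewards, hk])]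
  simp [length_transitions]

theorem encode_flag (s : Fin I.M.n) :
    I.encode.getD (2 + 2 * (I.M.n * I.M.n) + 3 * s) 0 = if s ∈ I.Φ.F then 1 else 0 := by
  rw [show 2 + 2 * (I.M.n * I.M.n) + 3 * (s : ℕ) = 2 + (2 * (I.M.n * I.M.n) + (s * 3 + 0)) by ring,
    encode_rewards _ (by omega), rewards, List.getD_flatten_ofFn (k := 3) (fun _ => rfl) _ (by norm_num)]
  rfl

theorem encode_rewardNum (s : Fin I.M.n) :
    I.encode.getD (3 + 2 * (I.M.n * I.M.n) + 3 * s) 0 = (I.reward s).num := by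
  rw [show 3 + 2 * (I.M.n * I.M.n) + 3 * (s : ℕ) = 2 + (2 * (I.M.n * I.M.n) + (s * 3 + 1)) by ring,
    encode_rewards _ (by omega), rewards, List.getD_flatten_ofFn (k := 3) (fun _ => rfl) _ (by norm_num)]
  rfl

theorem encode_rewardDen (s : Fin I.M.n) :
    I.encode.getD (4 + 2 * (I.M.n * I.M.n) + 3 * s) 0 = (I.reward s).den := by
  rw [show 4 + 2 * (I.M.n * I.M.n) + 3 * (s : ℕ) = 2 + (2 * (I.M.n * I.M.n) + (s * 3 + 2)) by ring,
    encode_rewards _ (by omega), rewards, List.getD_flatten_ofFn (k := 3) (fun _ => rfl) _ (by norm_num)]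
  rfl

theorem encode_tail (k : ℕ) :
    I.encode.getD (2 + 2 * (I.M.n * I.M.n) + 3 * I.M.n + k) 0 =
      [I.ε.num, (I.ε.den : ℤ), I.v.num, (I.v.den : ℤ)].getD k 0 := by
  rw [encode_eq, List.getD_append_right _ _ _ _ (by simp; omega),
    List.getD_append_right _ _ _ _ (by simp [length_transitions]; omega),
    List.getD_append_right _ _ _ _ (by simp [length_transitions, length_rewards]; omega)]
  congr 1
  simp [length_transitions, length_rewards]
  omega

/-! ### Bounds in terms of the length of the encoding -/

theorem intLen_le_listSize {l : List ℤ} {z : ℤ} (hz : z ∈ l) : intLen z ≤ listSize l :=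
  List.single_le_sum (fun _ _ => Nat.zero_le _) _ (List.mem_map_of_mem hz)

theorem length_le_listSize (l : List ℤ) : l.length ≤ listSize l := by
  have h := List.card_nsmul_le_sum (l.map intLen) 1 (by
    simp only [List.mem_map, forall_exists_index, and_imp, forall_apply_eq_imp_iff₂]
    exact fun z _ => intLen_pos z)
  simpa [listSize] using h

theorem natAbs_getD_lt (k : ℕ) : (I.encode.getD k 0).natAbs < 2 ^ listSize I.encode := by
  have h1 : 1 ≤ listSize I.encode := by
    refine le_trans ?_ (length_le_listSize I.encode)
    rw [encode_eq]; simp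
  have h2 := Loop.MemExpr.intLen_getD_le (input := I.encode) (L := listSize I.encode)
    (fun z hz => intLen_le_listSize hz) h1 k
  exact intLen_le_iff.1 (h2.trans (Nat.le_succ _))

theorem length_encode : I.encode.length = 6 + 2 * (I.M.n * I.M.n) + 3 * I.M.n := by
  rw [encode_eq]
  simp [length_transitions, length_rewards]
  omega

end ApproxInstance

/-! ## Bounds for the numbers computed by the program -/

/-- `z` is at most `2 ^ (e * k)` in absolute value. -/
def PowBound (e k : ℕ) (z : ℤ) : Prop := |z| ≤ 2 ^ (e * k)

namespace PowBound

variable {e k l : ℕ} {y z : ℤ}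

theorem mono (h : PowBound e k z) (hkl : k ≤ l) : PowBound e l z :=
  h.trans (pow_le_pow_right₀ (by norm_num) (Nat.mul_le_mul_left e hkl))

theorem of_abs_le (h : PowBound e k z) (hy : |y| ≤ |z|) : PowBound e k y := hy.trans h

theorem neg (h : PowBound e k z) : PowBound e k (-z) := by rwa [PowBound, abs_neg]

theorem mul (hy : PowBound e k y) (hz : PowBound e l z) : PowBound e (k + l) (y * z) := by
  rw [PowBound, abs_mul, mul_add, pow_add]
  exact mul_le_mul hy hz (abs_nonneg _) (by positivity)

theorem two_mul_pow_le (he : 1 ≤ e) : 2 * (2 : ℤ) ^ (e * k) ≤ 2 ^ (e * (k + 1)) := by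
  rw [← pow_succ']
  exact pow_le_pow_right₀ (by norm_num) (by rw [mul_add]; omega)

theorem add (he : 1 ≤ e) (hy : PowBound e k y) (hz : PowBound e k z) : PowBound e (k + 1) (y + z) := by
  have h := two_mul_pow_le (k := k) he
  have := abs_add_le y z
  rw [PowBound] at *
  linarith

theorem sub (he : 1 ≤ e) (hy : PowBound e k y) (hz : PowBound e k z) : PowBound e (k + 1) (y - z) := by
  rw [sub_eq_add_neg]; exact hy.add he hz.neg

theorem div (hy : PowBound e k y) : PowBound e k (y / z) := by
  refine hy.of_abs_le ?_
  have := Int.natAbs_ediv_le_natAbs y z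
  rw [Int.abs_eq_natAbs, Int.abs_eq_natAbs]
  exact_mod_cast this

theorem natCast {n : ℕ} (hn : n ≤ e) : PowBound e 1 n := by
  rw [PowBound, Nat.abs_cast, mul_one]
  exact_mod_cast hn.trans Nat.lt_two_pow_self.le

/-- A sum of at most `e ≤ 2 ^ e` terms raises the degree `k` by one, just like a single addition. -/
theorem sum {ι : Type*} {s : Finset ι} {f : ι → ℤ} (hs : s.card ≤ e) (hf : ∀ i ∈ s, PowBound e k (f i)) :
    PowBound e (k + 1) (∑ i ∈ s, f i) := by
  have h1 : |∑ i ∈ s, f i| ≤ s.card * 2 ^ (e * k) := by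
    refine (Finset.abs_sum_le_sum_abs f s).trans ?_
    have := Finset.sum_le_card_nsmul s (fun i => |f i|) (2 ^ (e * k)) hf
    simpa using this
  refine h1.trans ?_
  rw [add_comm k, mul_add, pow_add]
  gcongr
  have := natCast hs
  rwa [PowBound, Nat.abs_cast] at this

theorem zero : PowBound e k 0 := by simp [PowBound]

theorem one : PowBound e k 1 := by
  rw [PowBound, abs_one]; exact one_le_pow₀ (by norm_num)

/-- Ten is ample for the degrees of all numbers in the program, which is the origin of `L = 10 * e +
10`. -/
theorem intLen_le (h : PowBound e k z) (hk : k ≤ 10) : intLen z ≤ 10 * e + 10 := by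
  have h := h.mono hk
  rw [intLen_le_iff (k := 10 * e + 9)]
  have h2 : |z| < 2 ^ (10 * e + 9) :=
    h.trans_lt (pow_lt_pow_right₀ (by norm_num) (by omega))
  rw [Int.abs_eq_natAbs] at h2
  exact_mod_cast h2

theorem size_le (h : PowBound e k z) : z.toNat.size ≤ e * k + 1 := by
  rw [Nat.size_le, pow_succ]
  have h2 : (z.toNat : ℤ) ≤ 2 ^ (e * k) := by
    rw [Int.toNat_eq_max]
    exact max_le ((le_abs_self z).trans h) (by positivity)
  have h3 : z.toNat ≤ 2 ^ (e * k) := by exact_mod_cast h2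
  have := Nat.one_le_two_pow (n := e * k)
  omega

end PowBound

/-! ### A common denominator of the transition probabilities -/

namespace ApproxInstance

variable (I : ApproxInstance)

/-- A common denominator of the transition probabilities. -/
def commonDen : ℤ := ∏ k ∈ Finset.range (I.M.n * I.M.n), I.encode.getD (3 + 2 * k) 0

theorem one_le_getD_den {k : ℕ} (hk : k < I.M.n * I.M.n) : 1 ≤ I.encode.getD (3 + 2 * k) 0 := by
  have hn : 0 < I.M.n := Nat.pos_of_ne_zero (by rintro h; simp [h] at hk)
  have h := I.encode_den ⟨k / I.M.n, Nat.div_lt_of_lt_mul hk⟩ ⟨k % I.M.n, Nat.mod_lt _ hn⟩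
  rw [show k / I.M.n * I.M.n + k % I.M.n = k from Nat.div_add_mod' k I.M.n] at h
  rw [h]
  exact_mod_cast (I.M.δ _ _).pos

/-- All factors are at least `1`, so a bound for the full product bounds every intermediate value of
the accumulator. -/
theorem prod_den_mono {k l : ℕ} (hkl : k ≤ l) (hl : l ≤ I.M.n * I.M.n) :
    1 ≤ ∏ j ∈ Finset.range k, I.encode.getD (3 + 2 * j) 0 ∧
      ∏ j ∈ Finset.range k, I.encode.getD (3 + 2 * j) 0 ≤
        ∏ j ∈ Finset.range l, I.encode.getD (3 + 2 * j) 0 := by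
  induction l, hkl using Nat.le_induction with
  | base =>
    refine ⟨?_, le_rfl⟩
    refine Finset.prod_induction _ (1 ≤ ·) (fun a b ha hb => one_le_mul_of_one_le_of_one_le ha hb)
      le_rfl fun j hj => I.one_le_getD_den ?_
    have := Finset.mem_range.1 hj
    omega
  | succ l hkl ih =>
    obtain ⟨h1, h2⟩ := ih (by omega)
    refine ⟨h1, h2.trans ?_⟩
    rw [Finset.prod_range_succ]
    have := I.one_le_getD_den (k := l) (by omega)
    nlinarith

theorem one_le_commonDen : 1 ≤ I.commonDen := (I.prod_den_mono le_rfl le_rfl).1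

theorem den_dvd_commonDen (s t : Fin I.M.n) : ((I.M.δ s t).den : ℤ) ∣ I.commonDen := by
  rw [← encode_den]
  exact Finset.dvd_prod_of_mem (fun k => I.encode.getD (3 + 2 * k) 0)
    (Finset.mem_range.2 (pair_lt s.2 t.2))

theorem commonDen_div_mul (s t : Fin I.M.n) :
    ((I.commonDen / (I.M.δ s t).den * (I.M.δ s t).num : ℤ) : ℚ) = I.commonDen * I.M.δ s t := by
  obtain ⟨c, hc⟩ := I.den_dvd_commonDen s t
  have h0 : ((I.M.δ s t).den : ℚ) ≠ 0 := by exact_mod_cast (I.M.δ s t).den_nz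
  have h1 : ((I.M.δ s t).den : ℤ) ≠ 0 := by exact_mod_cast (I.M.δ s t).den_nz
  have h2 : ((I.M.δ s t).num : ℚ) = (I.M.δ s t).den * I.M.δ s t := by
    rw [mul_comm, Rat.mul_den_eq_num]
  rw [hc, Int.mul_ediv_cancel_left _ h1]
  push_cast
  rw [h2]
  ring

end ApproxInstance

/-! ### Bounds for an instance and access to its input -/

namespace ApproxProgram

open Loop Loop.Expr Loop.Stmt

/-- The context `X` belongs to the instance `I`, and `2 ^ e` bounds the relevant numbers. -/
structure Setting (I : ApproxInstance) (X : Context) (e : ℕ) : Prop where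
  input_eq : X.input = I.encode
  S : X.S = 4 * I.M.n + 8
  L : X.L = 10 * e + 10
  small : ∀ k, PowBound e 1 (I.encode.getD k 0)
  sq_le : I.M.n * I.M.n ≤ e
  lt : I.M.n < e
  pow_le : 2 * (2 * (I.M.n : ℤ) ^ 2 * I.commonDen) ^ I.M.n ≤ 2 ^ e

namespace Setting

variable {I : ApproxInstance} {X : Context} {e k : ℕ}

theorem one_le (h : Setting I X e) : 1 ≤ e := by have := h.lt; omega

theorem intLen_le (h : Setting I X e) {z : ℤ} (hz : PowBound e k z) (hk : k ≤ 10 := by norm_num) : intLen z ≤ X.L :=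
  h.L ▸ hz.intLen_le hk

end Setting

variable {I : ApproxInstance} {X : Context} {e : ℕ} {σ : State Var Arr}

section

variable {i j : E} {s t : Fin I.M.n}

theorem eval_transNum (h : Setting I X e) (hn : σ.scal .n = I.M.n)
    (hi : i.eval X σ = (s : ℕ)) (hj : j.eval X σ = (t : ℕ)) :
    (transNum i j).eval X σ = (I.M.δ s t).num := by
  rw [← I.encode_num, ← h.input_eq]
  simp only [transNum, input, v, eval_inp, eval_add, eval_mul, eval_ofNat, eval_var, hi, hj, hn]
  congr 1

theorem eval_transDen (h : Setting I X e) (hn : σ.scal .n = I.M.n)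
    (hi : i.eval X σ = (s : ℕ)) (hj : j.eval X σ = (t : ℕ)) :
    (transDen i j).eval X σ = (I.M.δ s t).den := by
  rw [← I.encode_den, ← h.input_eq]
  simp only [transDen, input, v, eval_inp, eval_add, eval_mul, eval_ofNat, eval_var, hi, hj, hn]
  congr 1

theorem eval_flag (h : Setting I X e) (hn : σ.scal .n = I.M.n) (hi : i.eval X σ = (s : ℕ)) :
    (flag i).eval X σ = if s ∈ I.Φ.F then 1 else 0 := by
  rw [← I.encode_flag, ← h.input_eq]
  simp only [flag, input, v, eval_inp, eval_add, eval_mul, eval_ofNat, eval_var, hi, hn]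
  congr 1

theorem eval_rewardNum (h : Setting I X e) (hn : σ.scal .n = I.M.n) (hi : i.eval X σ = (s : ℕ)) :
    (rewardNum i).eval X σ = (I.reward s).num := by
  rw [← I.encode_rewardNum, ← h.input_eq]
  simp only [rewardNum, input, v, eval_inp, eval_add, eval_mul, eval_ofNat, eval_var, hi, hn]
  congr 1

theorem eval_rewardDen (h : Setting I X e) (hn : σ.scal .n = I.M.n) (hi : i.eval X σ = (s : ℕ)) :
    (rewardDen i).eval X σ = (I.reward s).den := by
  rw [← I.encode_rewardDen, ← h.input_eq]
  simp only [rewardDen, input, v, eval_inp, eval_add, eval_mul, eval_ofNat, eval_var, hi, hn]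
  congr 1

theorem eval_tail (h : Setting I X e) (hn : σ.scal .n = I.M.n) (k : ℕ) :
    (tail k).eval X σ = [I.ε.num, (I.ε.den : ℤ), I.v.num, (I.v.den : ℤ)].getD k 0 := by
  rw [← I.encode_tail, ← h.input_eq]
  simp only [tail, input, v, eval_inp, eval_add, eval_mul, eval_ofNat, eval_var, eval_const, hn]
  congr 1

@[simp] theorem ok_transNum : (transNum i j).Ok X σ ↔ i.Ok X σ ∧ j.Ok X σ := by simp [transNum]
@[simp] theorem ok_transDen : (transDen i j).Ok X σ ↔ i.Ok X σ ∧ j.Ok X σ := by simp [transDen]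
@[simp] theorem ok_flag : (flag i).Ok X σ ↔ i.Ok X σ := by simp [flag]
@[simp] theorem ok_rewardNum : (rewardNum i).Ok X σ ↔ i.Ok X σ := by simp [rewardNum]
@[simp] theorem ok_rewardDen : (rewardDen i).Ok X σ ↔ i.Ok X σ := by simp [rewardDen]
@[simp] theorem ok_tail (k : ℕ) : (tail k).Ok X σ := by simp [tail]

end

namespace Setting

theorem readSizes (h : Setting I X e) : readSizes.Ensures X σ fun τ =>
    τ.scal .n = I.M.n ∧ τ.scal .init = (I.M.init : ℕ) := by
  simp only [ApproxProgram.readSizes, ensures_seq_iff, ensures_assign_iff, ok_inp, ok_ofNat,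
    eval_inp, eval_ofNat, State.set_scal, h.input_eq]
  refine ⟨trivial, h.intLen_le (h.small _), trivial, h.intLen_le (h.small _), ?_⟩
  simpa using ⟨I.encode_zero, I.encode_one⟩

theorem commonDen_small (h : Setting I X e) : |I.commonDen| ≤ 2 ^ e := by
  have hD := I.one_le_commonDen
  have h1 : (1 : ℤ) ≤ I.M.n := by have := I.M.init.2; omega
  have h2 : (1 : ℤ) ≤ 2 * (I.M.n : ℤ) ^ 2 * I.commonDen := by nlinarith
  have h3 := le_self_pow₀ h2 (n := I.M.n) (by omega)
  rw [abs_of_pos (by omega)]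
  have h4 : I.commonDen ≤ 2 * (I.M.n : ℤ) ^ 2 * I.commonDen :=
    le_mul_of_one_le_left (by omega) (by nlinarith)
  have := h.pow_le
  omega

theorem commonDenominator (h : Setting I X e) (hn : σ.scal .n = I.M.n) :
    commonDenominator.Ensures X σ fun τ => τ.scal .D = I.commonDen := by
  rw [ApproxProgram.commonDenominator, ensures_seq_iff, ensures_assign_iff]
  refine ⟨trivial, h.intLen_le (k := 0) PowBound.one, ensures_loop (I.M.n * I.M.n)
    (fun i τ => τ.scal .D = ∏ k ∈ Finset.range i, I.encode.getD (3 + 2 * k) 0) (by simp)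
    (by simp [hn]) ?_ (by simp) ?_ (fun τ _ h => h)⟩
  · have := h.sq_le; have := h.L; omega
  · intro i hi τ _ hτ
    have e1 : (v .D * input (3 + 2 * v .i) : E).eval X (τ.set .i i) =
        ∏ k ∈ Finset.range (i + 1), I.encode.getD (3 + 2 * k) 0 := by
      simp only [v, input, eval_mul, eval_var, eval_inp, eval_add, eval_ofNat, State.set_scal,
        Finset.prod_range_succ, h.input_eq]
      congr 1
    rw [ensures_assign_iff, e1]
    obtain ⟨h1, h2⟩ := I.prod_den_mono (k := i + 1) hi le_rfl
    refine ⟨by simp, h.intLen_le (k := 1) ?_, by simp⟩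
    have h3 := h.commonDen_small
    rw [PowBound, abs_of_pos (by omega), mul_one]
    exact h2.trans ((le_abs_self _).trans h3)

end Setting

end ApproxProgram

/-! ## States from which the targets can be reached -/

namespace MarkovChain

variable (M : MarkovChain) (F : Finset (Fin M.n))

/-- The states from which `F` can be reached in at most `k` steps. -/
def canReachWithin : ℕ → Finset (Fin M.n)
  | 0 => F
  | k + 1 => canReachWithin k ∪ Finset.univ.filter fun s => ∃ t ∈ canReachWithin k, 0 < M.δ s t

theorem canReachWithin_mono : Monotone (M.canReachWithin F) :=
  monotone_nat_of_le_succ fun _ => Finset.subset_union_left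

/-- An increasing chain of subsets of a set with `n` elements, in which each member determines the
next, is constant from index `n` on. -/
theorem CanReach.mem_canReachWithin {s : Fin M.n} (h : CanReach M F s) :
    s ∈ M.canReachWithin F M.n := by
  have hex : ∃ k, s ∈ M.canReachWithin F k := by
    induction h with
    | mem h => exact ⟨0, h⟩
    | step hst _ ih =>
      obtain ⟨k, hk⟩ := ih
      refine ⟨k + 1, ?_⟩
      simp only [canReachWithin, Finset.mem_union, Finset.mem_filter, Finset.mem_univ, true_and]
      exact Or.inr ⟨_, hk, hst⟩
  obtain ⟨k, hk⟩ := hex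
  have hmono := M.canReachWithin_mono F
  have hstab : ∀ m, M.n ≤ m → (M.canReachWithin F m).card = (M.canReachWithin F M.n).card := by
    intro m hm
    refine Nat.stabilises_of_monotone (f := fun m => (M.canReachWithin F m).card) (b := M.n) (n := m)
      (fun a b hab => Finset.card_le_card (hmono hab)) (fun m => ?_) (fun m h => ?_) hm
    · exact (Finset.card_le_univ _).trans (by simp)
    · have h2 := Finset.eq_of_subset_of_card_le (hmono (Nat.le_succ m)) h.ge
      have h3 : ∀ a b, M.canReachWithin F a = M.canReachWithin F b →
          M.canReachWithin F (a + 1) = M.canReachWithin F (b + 1) :=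
        fun a b hab => by simp only [canReachWithin, hab]
      exact congrArg Finset.card (h3 _ _ h2)
  by_cases hkn : k ≤ M.n
  · exact hmono hkn hk
  · rwa [Finset.eq_of_subset_of_card_le (hmono (not_le.1 hkn).le) (hstab k (not_le.1 hkn).le).le]

end MarkovChain

namespace ApproxProgram

open Loop Loop.Expr Loop.Stmt

variable {I : ApproxInstance} {X : Context} {e : ℕ} {σ : State Var Arr}

/-- All states in `G` are marked, and only states from which the targets can be reached. -/
def Marked (I : ApproxInstance) (G : Set (Fin I.M.n)) (f : ℕ → ℤ) : Prop :=
  ∀ s : Fin I.M.n, (f s = 0 ∨ f s = 1 ∧ I.M.CanReach I.Φ.F s) ∧ (s ∈ G → f s = 1)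

theorem Marked.mono {G H : Set (Fin I.M.n)} {f : ℕ → ℤ} (h : Marked I G f) (hH : H ⊆ G) :
    Marked I H f :=
  fun s => ⟨(h s).1, fun hs => (h s).2 (hH hs)⟩

theorem Marked.update {G H : Set (Fin I.M.n)} {f g : ℕ → ℤ} (h : Marked I G f) {t : Fin I.M.n}
    (ht : I.M.CanReach I.Φ.F t) (hH : H ⊆ insert t G)
    (hg : ∀ s, g s = if s = t then 1 else f s) : Marked I H g := by
  intro s
  rw [hg]
  by_cases hs : s = t
  · subst hs; simpa using ht
  · rw [if_neg (by rwa [Fin.val_inj])]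
    exact ⟨(h s).1, fun h2 => (h s).2 ((hH h2).resolve_left hs)⟩

namespace Setting

/-- Because of the updates in place, the set of marked states is only enclosed: after `k` rounds it
contains `canReachWithin k` and consists of states that can reach a target. For `k = n` both bounds
agree. -/
theorem reach (h : Setting I X e) (hn : σ.scal .n = I.M.n) :
    reach.Ensures X σ fun τ => ∀ s : Fin I.M.n,
      τ.arr .live 0 s = 1 ∧ I.M.CanReach I.Φ.F s ∨ τ.arr .live 0 s = 0 ∧ ¬ I.M.CanReach I.Φ.F s := by
  have hL := h.L
  have hS := h.S
  have hlt := h.lt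
  refine Ensures.seq (Q := fun τ => Marked I I.Φ.F (τ.arr .live 0)) ?_ ?_
  · refine ensures_loop I.M.n (fun i τ => ∀ s : Fin I.M.n, (s : ℕ) < i →
      τ.arr .live 0 s = if s ∈ I.Φ.F then 1 else 0) (by simp) (by simp [hn]) (by omega) (by simp)
      ?_ ?_
    · intro i hi τ fr hτ
      have hn' : τ.scal .n = I.M.n := (fr.scal .n (by decide)).trans hn
      have e1 : (flag (v .i)).eval X (τ.set .i i) = if (⟨i, hi⟩ : Fin I.M.n) ∈ I.Φ.F then 1 else 0 :=
        eval_flag h (by simp [hn']) (by simp)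
      rw [ensures_store_iff, e1]
      refine ⟨by simp; omega, by simp, h.intLen_le (k := 0) ?_, fun s hs => ?_⟩
      · split_ifs
        exacts [PowBound.one, PowBound.zero]
      · simp only [State.put_arr, State.set_arr, eval_var, eval_ofNat, State.set_scal]
        by_cases hsi : (s : ℕ) = i
        · subst hsi; simp
        · simpa [hsi] using hτ s (by omega)
    · intro τ _ hτ s
      rw [hτ s s.2]
      by_cases hs : s ∈ I.Φ.F
      · simp [hs, MarkovChain.CanReach.mem hs]
      · simp [hs]
  · intro σ₁ fr₁ h₁
    have hn₁ : σ₁.scal .n = I.M.n := (fr₁.scal .n (by decide)).trans hn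
    refine ensures_loop I.M.n (fun k τ => Marked I (I.M.canReachWithin I.Φ.F k) (τ.arr .live 0))
      (by simp) (by simp [hn₁]) (by omega) h₁ ?_ ?_
    · intro k hk τ fr hτ
      have hn₂ : τ.scal .n = I.M.n := (fr.scal .n (by decide)).trans hn₁
      refine ensures_loop I.M.n (fun i υ => Marked I {s | s ∈ I.M.canReachWithin I.Φ.F k ∨
        (s : ℕ) < i ∧ s ∈ I.M.canReachWithin I.Φ.F (k + 1)} (υ.arr .live 0)) (by simp)
        (by simp [hn₂]) (by omega) (by simpa using hτ) ?_ ?_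
      · intro i hi υ fr₃ hυ
        have hn₃ : υ.scal .n = I.M.n := (fr₃.scal .n (by decide)).trans (by simpa using hn₂)
        -- While the successors of `i` are scanned, the lower bound grows by `i` itself, provided
        -- that a successor scanned so far belongs to the previous stage.
        refine ensures_loop I.M.n (fun j ω => Marked I ({s | s ∈ I.M.canReachWithin I.Φ.F k ∨
          (s : ℕ) < i ∧ s ∈ I.M.canReachWithin I.Φ.F (k + 1)} ∪
          {s | s = i ∧ ∃ t ∈ I.M.canReachWithin I.Φ.F k, (t : ℕ) < j ∧ 0 < I.M.δ s t})
          (ω.arr .live 0)) (by simp) (by simp [hn₃]) (by omega) (by simpa using hυ) ?_ ?_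
        · intro j hj ω fr₄ hω
          have hn₄ : ω.scal .n = I.M.n := (fr₄.scal .n (by decide)).trans (by simpa using hn₃)
          have hi₄ : ω.scal .i = i := (fr₄.scal .i (by decide)).trans (by simp)
          have e1 : (transNum (v .i) (v .j)).eval X (ω.set .j j) =
              (I.M.δ (⟨i, hi⟩ : Fin I.M.n) (⟨j, hj⟩ : Fin I.M.n)).num :=
            eval_transNum h (by simp [hn₄]) (by simp [hi₄]) (by simp)
          rw [ensures_ite_iff, eval_mul, e1]
          have e2 : (get .live 0 (v .j)).eval X (ω.set .j j) = ω.arr .live 0 j := by simp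
          rw [e2]
          refine ⟨by simp; omega, fun hpos => ?_, fun hpos => ?_⟩
          · rw [ensures_store_iff]
            refine ⟨by simp [hi₄]; omega, by simp, h.intLen_le (k := 0) PowBound.one, ?_⟩
            have hjr : ω.arr .live 0 j = 1 ∧ I.M.CanReach I.Φ.F ⟨j, hj⟩ := by
              refine (hω ⟨j, hj⟩).1.resolve_left fun h0 => ?_
              simp only at h0
              simp [h0] at hpos
            rw [hjr.1, mul_one, Rat.num_pos] at hpos
            refine hω.update (t := ⟨i, hi⟩) (.step hpos hjr.2) ?_ ?_
            · rintro s (hs | ⟨hs, -⟩)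
              · exact Or.inr (Or.inl hs)
              · exact Or.inl (Fin.ext hs)
            · intro s
              simp [State.put_arr, hi₄]
          · rw [ensures_skip_iff]
            refine hω.mono ?_
            rintro s (hs | ⟨hs, t, ht, htj, hst⟩)
            · exact Or.inl hs
            · refine Or.inr ⟨hs, t, ht, ?_, hst⟩
              refine lt_of_le_of_ne (by omega) fun htj' => hpos ?_
              obtain rfl : s = ⟨i, hi⟩ := Fin.ext hs
              obtain rfl : t = ⟨j, hj⟩ := Fin.ext htj'
              have := (hω ⟨j, hj⟩).2 (Or.inl (Or.inl ht))
              simp only at this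
              rw [this, mul_one, Rat.num_pos]
              exact hst
        · intro ω _ hω
          refine hω.mono ?_
          rintro s (hs | ⟨hs, hs2⟩)
          · exact Or.inl (Or.inl hs)
          · by_cases hsi : (s : ℕ) < i
            · exact Or.inl (Or.inr ⟨hsi, hs2⟩)
            · simp only [MarkovChain.canReachWithin, Finset.mem_union, Finset.mem_filter,
                Finset.mem_univ, true_and] at hs2
              rcases hs2 with hs2 | ⟨t, ht, hst⟩
              · exact Or.inl (Or.inl hs2)
              · exact Or.inr ⟨by omega, t, ht, t.2, hst⟩
      · intro υ _ hυ
        exact hυ.mono fun s hs => Or.inr ⟨s.2, hs⟩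
    · intro τ _ hτ s
      by_cases hs : I.M.CanReach I.Φ.F s
      · exact Or.inl ⟨(hτ s).2 (MarkovChain.CanReach.mem_canReachWithin _ _ hs), hs⟩
      · exact Or.inr ⟨(hτ s).1.resolve_right fun h => hs h.2, hs⟩

end Setting

end ApproxProgram

/-! ## The matrix of the linear equations and its adjugate -/

theorem Fin.sum_filter_lt_succ {n : ℕ} (f : Fin n → ℤ) {i : ℕ} (hi : i < n) :
    ∑ l : Fin n with Fin.val l < i + 1, f l = (∑ l : Fin n with Fin.val l < i, f l) + f ⟨i, hi⟩ := by
  have : (Finset.univ.filter fun l : Fin n => (l : ℕ) < i + 1) =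
      insert ⟨i, hi⟩ (Finset.univ.filter fun l : Fin n => (l : ℕ) < i) := by
    ext l
    simp only [Finset.mem_filter, Finset.mem_univ, true_and, Finset.mem_insert, Fin.ext_iff]
    omega
  rw [this, Finset.sum_insert (by simp), add_comm]

theorem Fin.sum_filter_lt_self {n : ℕ} (f : Fin n → ℤ) : ∑ l : Fin n with Fin.val l < n, f l = ∑ l, f l := by
  simp

theorem Fin.abs_sum_filter_le {n : ℕ} {f : Fin n → ℤ} {b : ℤ} (hf : ∀ l, |f l| ≤ b)
    (p : Fin n → Prop) [DecidablePred p] : |∑ l with p l, f l| ≤ n * b := by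
  calc |∑ l with p l, f l| ≤ ∑ l with p l, |f l| := Finset.abs_sum_le_sum_abs _ _
    _ ≤ ∑ l, |f l| := Finset.sum_le_univ_sum_of_nonneg fun l => abs_nonneg _
    _ ≤ n * b := by
      have := Finset.sum_le_card_nsmul Finset.univ (fun l => |f l|) b fun l _ => hf l
      simpa using this

/-- With `R` the bound for round `k`, the auxiliary matrix has entries up to `2 R`, its product with
`A` up to `n D 2 R`, and the trace of this product up to `n` times as much, which is `2 n² D R`; the
division only decreases it. -/
theorem Matrix.abs_leVerrier_le {n : ℕ} {A : Matrix (Fin n) (Fin n) ℤ} {D : ℤ}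
    (hA : ∀ s t, |A s t| ≤ D) (k : ℕ) :
    (∀ s t, |(leVerrier A k).1 s t| ≤ (2 * (n : ℤ) ^ 2 * D) ^ k) ∧
      |(leVerrier A k).2| ≤ (2 * (n : ℤ) ^ 2 * D) ^ k := by
  induction k with
  | zero => simp [leVerrier]
  | succ k ih =>
    obtain ⟨h1, h2⟩ := ih
    have hR : 0 ≤ (2 * (n : ℤ) ^ 2 * D) ^ k := (abs_nonneg _).trans h2
    set R := (2 * (n : ℤ) ^ 2 * D) ^ k with hRdef
    have hM : ∀ s t, |((leVerrier A k).1 + (leVerrier A k).2 • 1) s t| ≤ 2 * R := by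
      intro s t
      have h3 : |(leVerrier A k).2 * (1 : Matrix (Fin n) (Fin n) ℤ) s t| ≤ R := by
        rw [Matrix.one_apply]
        split_ifs <;> simp [h2, hR]
      have := abs_add_le ((leVerrier A k).1 s t)
        ((leVerrier A k).2 * (1 : Matrix (Fin n) (Fin n) ℤ) s t)
      have := h1 s t
      simp only [Matrix.add_apply, Matrix.smul_apply, smul_eq_mul]
      linarith
    have hN : ∀ s t, |(leVerrier A (k + 1)).1 s t| ≤ n * (D * (2 * R)) := by
      intro s t
      have h3 : (leVerrier A (k + 1)).1 s t =
          ∑ l : Fin n with Fin.val l < n, A s l * ((leVerrier A k).1 + (leVerrier A k).2 • 1) l t := by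
        rw [Fin.sum_filter_lt_self]; rfl
      rw [h3]
      refine Fin.abs_sum_filter_le (fun l => ?_) _
      rw [abs_mul]
      exact mul_le_mul (hA _ _) (hM _ _) (abs_nonneg _) ((abs_nonneg _).trans (hA s s))
    have htr : |(leVerrier A (k + 1)).1.trace| ≤ n * (n * (D * (2 * R))) := by
      have := Fin.abs_sum_filter_le (fun l => hN l l) (fun l : Fin n => (l : ℕ) < n)
      rw [Fin.sum_filter_lt_self] at this
      exact this
    have hpow : (2 * (n : ℤ) ^ 2 * D) ^ (k + 1) = n * (n * (D * (2 * R))) := by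
      rw [pow_succ, ← hRdef]; ring
    rw [hpow]
    refine ⟨fun s t => (hN s t).trans ?_, ?_⟩
    · have h0 := (abs_nonneg _).trans (hN s t)
      have hn : (1 : ℤ) ≤ n := by have := s.2; omega
      nlinarith
    · have h3 : (leVerrier A (k + 1)).2 = -((leVerrier A (k + 1)).1.trace / ((k : ℤ) + 1)) := rfl
      rw [h3, abs_neg]
      refine le_trans ?_ htr
      have := Int.natAbs_ediv_le_natAbs (leVerrier A (k + 1)).1.trace ((k : ℤ) + 1)
      rw [Int.abs_eq_natAbs, Int.abs_eq_natAbs]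
      exact_mod_cast this

namespace MarkovChain

theorem δ_le_one (M : MarkovChain) (s t : Fin M.n) : M.δ s t ≤ 1 := by
  rw [← M.δ_sum s]
  exact Finset.single_le_sum (f := fun t => M.δ s t) (fun t _ => M.δ_nonneg s t) (Finset.mem_univ t)

end MarkovChain

namespace ApproxInstance

variable (I : ApproxInstance)

open Classical in
noncomputable def reachMatrix : Matrix (Fin I.M.n) (Fin I.M.n) ℤ := fun s t =>
  (if s = t then I.commonDen else 0) -
    if s ∉ I.Φ.F ∧ I.M.CanReach I.Φ.F s then I.commonDen / (I.M.δ s t).den * (I.M.δ s t).num else 0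

theorem isReachMatrix : I.M.IsReachMatrix I.Φ.F I.commonDen I.reachMatrix := by
  classical
  intro s t
  rw [reachMatrix, Int.cast_sub, mul_sub]
  congr 1
  · split_ifs <;> simp
  · split_ifs
    · exact I.commonDen_div_mul s t
    · simp

/-- Up to the factor `D`, an entry is `0` or `1` minus a number between `0` and `1`. -/
theorem abs_reachMatrix_le (s t : Fin I.M.n) : |I.reachMatrix s t| ≤ I.commonDen := by
  classical
  have hD : (1 : ℚ) ≤ I.commonDen := by exact_mod_cast I.one_le_commonDen
  have h : |(I.reachMatrix s t : ℚ)| ≤ I.commonDen := by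
    rw [I.isReachMatrix s t, abs_mul, abs_of_pos (by linarith : (0 : ℚ) < I.commonDen)]
    refine mul_le_of_le_one_right (by linarith) ?_
    have h0 := I.M.δ_nonneg s t
    have h1 := I.M.δ_le_one s t
    rw [abs_le]
    constructor <;> split_ifs <;> linarith
  exact_mod_cast h

theorem commonDen_div_small (s t : Fin I.M.n) :
    |I.commonDen / (I.M.δ s t).den * (I.M.δ s t).num| ≤ I.commonDen := by
  have hD : (1 : ℚ) ≤ I.commonDen := by exact_mod_cast I.one_le_commonDen
  have h : |((I.commonDen / (I.M.δ s t).den * (I.M.δ s t).num : ℤ) : ℚ)| ≤ I.commonDen := by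
    have h0 := I.M.δ_nonneg s t
    have h1 := I.M.δ_le_one s t
    rw [I.commonDen_div_mul, abs_of_nonneg (by positivity)]
    exact mul_le_of_le_one_right (by linarith) h1
  exact_mod_cast h

end ApproxInstance

namespace ApproxProgram

open Loop Loop.Expr Loop.Stmt

variable {I : ApproxInstance} {X : Context} {e : ℕ} {σ : State Var Arr}

/-- The array `f` holds the entries of the matrix `A`. -/
def Holds {n : ℕ} (f : ℕ → ℕ → ℤ) (A : Matrix (Fin n) (Fin n) ℤ) : Prop :=
  ∀ s t : Fin n, f s t = A s t

namespace Setting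

theorem matrix (h : Setting I X e) (hn : σ.scal .n = I.M.n) (hD : σ.scal .D = I.commonDen)
    (hlive : ∀ s : Fin I.M.n, σ.arr .live 0 s = 1 ∧ I.M.CanReach I.Φ.F s ∨
      σ.arr .live 0 s = 0 ∧ ¬ I.M.CanReach I.Φ.F s) :
    matrix.Ensures X σ fun τ => Holds (τ.arr .A) I.reachMatrix := by
  classical
  have hL := h.L
  have hS := h.S
  have hlt := h.lt
  have hDe := h.commonDen_small
  rw [abs_of_pos (by have := I.one_le_commonDen; omega)] at hDe
  refine ensures_loop I.M.n (fun i τ => ∀ s t : Fin I.M.n, (s : ℕ) < i →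
      τ.arr .A s t = I.reachMatrix s t) (by simp) (by simp [hn]) (by omega) (by simp) ?_
      (fun τ _ hτ s t => hτ s t s.2)
  intro i hi τ fr hτ
  set i' : Fin I.M.n := ⟨i, hi⟩ with hi'
  have hn₁ : τ.scal .n = I.M.n := (fr.scal .n (by decide)).trans hn
  have hD₁ : τ.scal .D = I.commonDen := (fr.scal .D (by decide)).trans hD
  have hl₁ : τ.arr .live = σ.arr .live := fr.arr .live (by decide)
  -- Row `i` is filled without its diagonal term first; `D` is added to the diagonal entry
  -- afterwards.
  refine Ensures.seq (Q := fun υ => (∀ s t : Fin I.M.n, (s : ℕ) < i →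
      υ.arr .A s t = I.reachMatrix s t) ∧ ∀ t : Fin I.M.n, υ.arr .A i t =
        I.reachMatrix i' t - if i' = t then I.commonDen else 0) ?_ ?_
  · refine ensures_loop I.M.n (fun j υ => (∀ s t : Fin I.M.n, (s : ℕ) < i →
      υ.arr .A s t = I.reachMatrix s t) ∧ ∀ t : Fin I.M.n, (t : ℕ) < j → υ.arr .A i t =
        I.reachMatrix i' t - if i' = t then I.commonDen else 0) (by simp) (by simp [hn₁]) (by omega)
        ⟨by simpa using hτ, by simp⟩ ?_ (fun υ _ hυ => ⟨hυ.1, fun t => hυ.2 t t.2⟩)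
    intro j hj υ fr₂ hυ
    set j' : Fin I.M.n := ⟨j, hj⟩ with hj'
    have hn₂ : υ.scal .n = I.M.n := (fr₂.scal .n (by decide)).trans (by simpa using hn₁)
    have hD₂ : υ.scal .D = I.commonDen := (fr₂.scal .D (by decide)).trans (by simpa using hD₁)
    have hi₂ : υ.scal .i = i := (fr₂.scal .i (by decide)).trans (by simp)
    have hl₂ : υ.arr .live = σ.arr .live := (fr₂.arr .live (by decide)).trans (by simpa using hl₁)
    have e1 : (flag (v .i)).eval X (υ.set .j j) = if i' ∈ I.Φ.F then 1 else 0 :=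
      eval_flag h (by simp [hn₂]) (by simp [hi₂, hi'])
    have e2 : (transNum (v .i) (v .j)).eval X (υ.set .j j) = (I.M.δ i' j').num :=
      eval_transNum h (by simp [hn₂]) (by simp [hi₂, hi']) (by simp [hj'])
    have e3 : (transDen (v .i) (v .j)).eval X (υ.set .j j) = (I.M.δ i' j').den :=
      eval_transDen h (by simp [hn₂]) (by simp [hi₂, hi']) (by simp [hj'])
    have e4 : (0 - (1 - flag (v .i)) * get .live 0 (v .i) *
        (v .D / transDen (v .i) (v .j) * transNum (v .i) (v .j)) : E).eval X (υ.set .j j) =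
        I.reachMatrix i' j' - if i' = j' then I.commonDen else 0 := by
      simp only [eval_sub, eval_mul, eval_div, e1, e2, e3, eval_ofNat, eval_arr, eval_var,
        State.set_scal, State.set_arr, hi₂, hD₂, hl₂, ApproxInstance.reachMatrix]
      by_cases hF : i' ∈ I.Φ.F
      · simp [hF]
      · have hF' : (⟨i, hi⟩ : Fin I.M.n) ∉ I.Φ.F := hF
        rcases hlive i' with h1 | h1
        · simp only [hi'] at h1
          simp [h1.1, h1.2, hF', hi']
        · simp only [hi'] at h1
          simp [h1.1, h1.2, hi']
    rw [ensures_store_iff, e4]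
    refine ⟨by simp [hi₂]; omega, by simp [hi₂]; omega, h.intLen_le (k := 1) ?_, ?_, ?_⟩
    · rw [PowBound, mul_one]
      refine le_trans ?_ hDe
      have h1 := I.commonDen_div_small i' j'
      rw [ApproxInstance.reachMatrix]
      have hD0 := I.one_le_commonDen
      split_ifs <;> simp_all <;> omega
    · intro s t hs
      simp only [State.put_arr, State.set_arr, eval_var, State.set_scal, hi₂]
      simp only [true_and]
      rw [if_neg (by simp; omega)]
      exact hυ.1 s t hs
    · intro t ht
      simp only [State.put_arr, State.set_arr, eval_var, State.set_scal, hi₂]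
      by_cases htj : (t : ℕ) = j
      · obtain rfl : t = j' := Fin.ext htj
        simp [hj']
      · simpa [htj] using hυ.2 t (by omega)
  · intro υ fr₂ hυ
    have hD₂ : υ.scal .D = I.commonDen := (fr₂.scal .D (by decide)).trans (by simpa using hD₁)
    have hi₂ : υ.scal .i = i := (fr₂.scal .i (by decide)).trans (by simp)
    have e4 : (get .A (v .i) (v .i) + v .D : E).eval X υ = I.reachMatrix i' i' := by
      have := hυ.2 i'
      simp only [hi', if_true] at this
      simp [hi₂, hD₂, this, hi']
    rw [ensures_store_iff, e4]
    refine ⟨by simp [hi₂]; omega, by simp [hi₂]; omega, h.intLen_le (k := 1) ?_, ?_⟩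
    · rw [PowBound, mul_one]
      exact (I.abs_reachMatrix_le _ _).trans hDe
    · intro s t hs
      simp only [State.put_arr, eval_var, hi₂, Int.toNat_natCast, true_and]
      by_cases hsi : (s : ℕ) = i
      · obtain rfl : s = i' := Fin.ext hsi
        by_cases hti : (t : ℕ) = i
        · obtain rfl : t = i' := Fin.ext hti
          simp [hi']
        · have h2 := hυ.2 t
          have h3 : i' ≠ t := fun h4 => hti (by rw [← h4])
          rw [if_neg h3, sub_zero] at h2
          simpa [hti, hi'] using h2
      · rw [if_neg (by tauto)]
        exact hυ.1 s t (by omega)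

end Setting

end ApproxProgram

/-! ### Correctness of the Faddeev–LeVerrier part -/

namespace ApproxProgram

open Loop Loop.Expr Loop.Stmt

variable {I : ApproxInstance} {X : Context} {e : ℕ} {σ : State Var Arr}

namespace Setting

theorem addScalar (h : Setting I X e) (hn : σ.scal .n = I.M.n)
    {N : Matrix (Fin I.M.n) (Fin I.M.n) ℤ} (hN : Holds (σ.arr .N) N) {b : ℤ}
    (hb : ∀ s t, |N s t| ≤ b) (hc : |σ.scal .c| ≤ b) (hbe : 2 * b ≤ 2 ^ e) :
    addScalar.Ensures X σ fun τ => Holds (τ.arr .M) (N + σ.scal .c • 1) := by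
  have hL := h.L
  have hS := h.S
  have hlt := h.lt
  have hb0 := (abs_nonneg _).trans hc
  set B : Matrix (Fin I.M.n) (Fin I.M.n) ℤ := N + σ.scal .c • 1 with hB
  have hBs : ∀ s t, B s t = N s t + if s = t then σ.scal .c else 0 := by
    intro s t
    rw [hB, Matrix.add_apply, Matrix.smul_apply, Matrix.one_apply, smul_eq_mul, mul_ite, mul_one,
      mul_zero]
  refine ensures_loop I.M.n (fun i τ => ∀ s t : Fin I.M.n, (s : ℕ) < i → τ.arr .M s t = B s t)
    (by simp) (by simp [hn]) (by omega) (by simp) ?_ (fun τ _ hτ s t => hτ s t s.2)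
  intro i hi τ fr hτ
  have hn₁ : τ.scal .n = I.M.n := (fr.scal .n (by decide)).trans hn
  have hc₁ : τ.scal .c = σ.scal .c := fr.scal .c (by decide)
  have hN₁ : τ.arr .N = σ.arr .N := fr.arr .N (by decide)
  set i' : Fin I.M.n := ⟨i, hi⟩ with hi'
  refine Ensures.seq (Q := fun υ => (∀ s t : Fin I.M.n, (s : ℕ) < i → υ.arr .M s t = B s t) ∧
    ∀ t : Fin I.M.n, υ.arr .M i t = N i' t) ?_ ?_
  · refine ensures_loop I.M.n (fun j υ => (∀ s t : Fin I.M.n, (s : ℕ) < i →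
      υ.arr .M s t = B s t) ∧ ∀ t : Fin I.M.n, (t : ℕ) < j → υ.arr .M i t = N i' t) (by simp)
        (by simp [hn₁]) (by omega) ⟨by simpa using hτ, by simp⟩ ?_
        (fun υ _ hυ => ⟨hυ.1, fun t => hυ.2 t t.2⟩)
    intro j hj υ fr₂ hυ
    set j' : Fin I.M.n := ⟨j, hj⟩ with hj'
    have hi₂ : υ.scal .i = i := (fr₂.scal .i (by decide)).trans (by simp)
    have hN₂ : υ.arr .N = σ.arr .N := (fr₂.arr .N (by decide)).trans (by simpa using hN₁)
    have e4 : (get .N (v .i) (v .j)).eval X (υ.set .j j) = N i' j' := by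
      simpa [hi₂, hN₂] using hN i' j'
    rw [ensures_store_iff, e4]
    refine ⟨by simp [hi₂]; omega, by simp [hi₂]; omega, h.intLen_le (k := 1) ?_, ?_, ?_⟩
    · rw [PowBound, mul_one]
      have := hb i' j'
      omega
    · intro s t hs
      simp only [State.put_arr, State.set_arr, eval_var, State.set_scal, hi₂]
      simp only [true_and]
      rw [if_neg (by simp; omega)]
      exact hυ.1 s t hs
    · intro t ht
      simp only [State.put_arr, State.set_arr, eval_var, State.set_scal, hi₂]
      by_cases htj : (t : ℕ) = j
      · obtain rfl : t = j' := Fin.ext htj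
        simp [hj']
      · simpa [htj] using hυ.2 t (by omega)
  · intro υ fr₂ hυ
    have hc₂ : υ.scal .c = σ.scal .c := (fr₂.scal .c (by decide)).trans (by simpa using hc₁)
    have hi₂ : υ.scal .i = i := (fr₂.scal .i (by decide)).trans (by simp)
    have e4 : (get .M (v .i) (v .i) + v .c : E).eval X υ = B i' i' := by
      have := hυ.2 i'
      simp only [hi'] at this
      simp [hi₂, hc₂, this, hBs, hi']
    rw [ensures_store_iff, e4]
    refine ⟨by simp [hi₂]; omega, by simp [hi₂]; omega, h.intLen_le (k := 1) ?_, ?_⟩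
    · rw [PowBound, mul_one, hBs, if_pos rfl]
      have := abs_add_le (N i' i') (σ.scal .c)
      have := hb i' i'
      omega
    · intro s t hs
      simp only [State.put_arr, eval_var, hi₂, Int.toNat_natCast, true_and]
      by_cases hsi : (s : ℕ) = i
      · obtain rfl : s = i' := Fin.ext hsi
        by_cases hti : (t : ℕ) = i
        · obtain rfl : t = i' := Fin.ext hti
          simp [hi']
        · have h2 := hυ.2 t
          have h3 : i' ≠ t := fun h4 => hti (by rw [← h4])
          have h4 := hBs i' t
          rw [if_neg h3, add_zero] at h4
          rw [h4]
          simpa [hti, hi'] using h2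
      · rw [if_neg (by tauto)]
        exact hυ.1 s t (by omega)

theorem multiply (h : Setting I X e) (hn : σ.scal .n = I.M.n)
    {A B : Matrix (Fin I.M.n) (Fin I.M.n) ℤ} (hA : Holds (σ.arr .A) A) (hB : Holds (σ.arr .M) B)
    {a b : ℤ} (ha : ∀ s t, |A s t| ≤ a) (hb : ∀ s t, |B s t| ≤ b)
    (hab : I.M.n * (I.M.n * (a * b)) ≤ 2 ^ e) :
    multiply.Ensures X σ fun τ => Holds (τ.arr .N) (A * B) ∧ τ.scal .acc = (A * B).trace := by
  have hL := h.L
  have hS := h.S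
  have hlt := h.lt
  have hn1 : (1 : ℤ) ≤ I.M.n := by have := I.M.init.2; omega
  have ha0 := (abs_nonneg _).trans (ha I.M.init I.M.init)
  have hb0 := (abs_nonneg _).trans (hb I.M.init I.M.init)
  have hab0 := mul_nonneg ha0 hb0
  have hAB : ∀ s t l, |A s l * B l t| ≤ a * b := fun s t l => by
    rw [abs_mul]
    exact mul_le_mul (ha _ _) (hb _ _) (abs_nonneg _) ha0
  have hABs : ∀ s t, (A * B) s t = ∑ l : Fin I.M.n with Fin.val l < I.M.n, A s l * B l t := by
    intro s t
    rw [Fin.sum_filter_lt_self]; rfl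
  have hABle : ∀ s t, |(A * B) s t| ≤ I.M.n * (a * b) := by
    intro s t
    rw [hABs]
    exact Fin.abs_sum_filter_le (hAB s t) _
  have hab' : I.M.n * (a * b) ≤ 2 ^ e := (le_mul_of_one_le_left (by positivity) hn1).trans hab
  rw [ApproxProgram.multiply, ensures_seq_iff, ensures_assign_iff]
  refine ⟨by simp, h.intLen_le (k := 0) PowBound.zero, ?_⟩
  refine ensures_loop I.M.n (fun i τ => (∀ s t : Fin I.M.n, (s : ℕ) < i →
    τ.arr .N s t = (A * B) s t) ∧ τ.scal .acc = ∑ s : Fin I.M.n with Fin.val s < i, (A * B) s s)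
    (by simp) (by simp [hn]) (by omega) (by simp) ?_
    (fun τ _ hτ => ⟨fun s t => hτ.1 s t s.2, by rw [hτ.2, Fin.sum_filter_lt_self]; rfl⟩)
  rintro i hi τ fr ⟨hτ, hacc⟩
  have hn₁ : τ.scal .n = I.M.n := (fr.scal .n (by decide)).trans (by simpa using hn)
  have hA₁ : τ.arr .A = σ.arr .A := fr.arr .A (by decide)
  have hB₁ : τ.arr .M = σ.arr .M := fr.arr .M (by decide)
  set i' : Fin I.M.n := ⟨i, hi⟩ with hi'
  refine Ensures.seq (Q := fun υ => ∀ s t : Fin I.M.n, (s : ℕ) < i + 1 →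
    υ.arr .N s t = (A * B) s t) ?_ ?_
  · refine ensures_loop I.M.n (fun j υ => ∀ s t : Fin I.M.n, (s : ℕ) < i ∨ (s : ℕ) = i ∧ (t : ℕ) < j →
      υ.arr .N s t = (A * B) s t) (by simp) (by simp [hn₁]) (by omega) (by simpa using hτ) ?_
      (fun υ _ hυ s t hs => hυ s t (by have := t.2; omega))
    intro j hj υ fr₂ hυ
    have hn₂ : υ.scal .n = I.M.n := (fr₂.scal .n (by decide)).trans (by simpa using hn₁)
    have hi₂ : υ.scal .i = i := (fr₂.scal .i (by decide)).trans (by simp)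
    have hA₂ : υ.arr .A = σ.arr .A := (fr₂.arr .A (by decide)).trans (by simpa using hA₁)
    have hB₂ : υ.arr .M = σ.arr .M := (fr₂.arr .M (by decide)).trans (by simpa using hB₁)
    set j' : Fin I.M.n := ⟨j, hj⟩ with hj'
    rw [ensures_seq_iff, ensures_assign_iff]
    refine ⟨by simp, h.intLen_le (k := 0) PowBound.zero, ?_⟩
    refine Ensures.seq (Q := fun ω => ω.scal .t = (A * B) i' j') ?_ ?_
    · refine ensures_loop I.M.n (fun l ω => ω.scal .t =
        ∑ k : Fin I.M.n with Fin.val k < l, A i' k * B k j') (by simp) (by simp [hn₂]) (by omega)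
        (by simp) ?_ (fun ω _ hω => by rw [hω, hABs])
      intro l hl ω fr₃ hω
      have hi₃ : ω.scal .i = i := (fr₃.scal .i (by decide)).trans (by simpa using hi₂)
      have hj₃ : ω.scal .j = j := (fr₃.scal .j (by decide)).trans (by simp)
      have hA₃ : ω.arr .A = σ.arr .A := (fr₃.arr .A (by decide)).trans (by simpa using hA₂)
      have hB₃ : ω.arr .M = σ.arr .M := (fr₃.arr .M (by decide)).trans (by simpa using hB₂)
      have e1 : (v .t + get .A (v .i) (v .l) * get .M (v .l) (v .j) : E).eval X (ω.set .l l) =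
          ∑ k : Fin I.M.n with Fin.val k < l + 1, A i' k * B k j' := by
        have h1 := hA i' ⟨l, hl⟩
        have h2 := hB ⟨l, hl⟩ j'
        simp only [hi', hj'] at h1 h2
        rw [Fin.sum_filter_lt_succ _ hl]
        simp [hω, hi₃, hj₃, hA₃, hB₃, h1, h2, hi', hj']
      rw [ensures_assign_iff, e1]
      refine ⟨by simp [hi₃, hj₃]; omega, h.intLen_le (k := 1) ?_, by simp⟩
      rw [PowBound, mul_one]
      exact (Fin.abs_sum_filter_le (hAB i' j') _).trans hab'
    · intro ω fr₃ hω
      have hi₃ : ω.scal .i = i := (fr₃.scal .i (by decide)).trans (by simpa using hi₂)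
      have hj₃ : ω.scal .j = j := (fr₃.scal .j (by decide)).trans (by simp)
      have hN₃ : ω.arr .N = υ.arr .N := fr₃.arr .N (by decide)
      rw [ensures_store_iff, eval_var, hω]
      refine ⟨by simp [hi₃, hj₃]; omega, by simp, h.intLen_le (k := 1) ?_, ?_⟩
      · rw [PowBound, mul_one]
        exact (hABle _ _).trans hab'
      · intro s t hs
        simp only [State.put_arr, eval_var, hi₃, hj₃, Int.toNat_natCast, true_and]
        by_cases hst : (s : ℕ) = i ∧ (t : ℕ) = j
        · obtain rfl : s = i' := Fin.ext hst.1
          obtain rfl : t = j' := Fin.ext hst.2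
          rw [if_pos hst]
        · rw [if_neg hst, hN₃]
          exact hυ s t (by omega)
  · intro υ fr₂ hυ
    have hi₂ : υ.scal .i = i := (fr₂.scal .i (by decide)).trans (by simp)
    have ha₂ : υ.scal .acc = τ.scal .acc := (fr₂.scal .acc (by decide)).trans (by simp)
    have e1 : (v .acc + get .N (v .i) (v .i) : E).eval X υ =
        ∑ s : Fin I.M.n with Fin.val s < i + 1, (A * B) s s := by
      have h1 := hυ i' i' (by simp [hi'])
      simp only [hi'] at h1
      rw [Fin.sum_filter_lt_succ _ hi]
      simp [ha₂, hacc, hi₂, h1]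
    rw [ensures_assign_iff, e1]
    refine ⟨by simp [hi₂]; omega, h.intLen_le (k := 1) ?_, by simpa using hυ, by simp⟩
    rw [PowBound, mul_one]
    exact (Fin.abs_sum_filter_le (fun l => hABle l l) _).trans hab

/-- After `k` rounds `N` and `c` hold the iterate `k`, while `M` still holds the auxiliary matrix
formed from the iterate `k - 1`. For `k = n` this is the matrix `B` of `Matrix.mul_leVerrier`. -/
theorem leVerrier (h : Setting I X e) (hn : σ.scal .n = I.M.n)
    {A : Matrix (Fin I.M.n) (Fin I.M.n) ℤ} (hA : Holds (σ.arr .A) A)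
    (hD : ∀ s t, |A s t| ≤ I.commonDen) (hN : ∀ i j, σ.arr .N i j = 0) :
    leVerrier.Ensures X σ fun τ => ∃ B : Matrix (Fin I.M.n) (Fin I.M.n) ℤ,
      Holds (τ.arr .M) B ∧ A * B = -(τ.scal .c • 1) ∧ (A.det ≠ 0 → τ.scal .c ≠ 0) ∧
      |τ.scal .c| ≤ 2 ^ e ∧ ∀ s t, |B s t| ≤ 2 ^ e := by
  have hL := h.L
  have hS := h.S
  have hlt := h.lt
  have hn1 : (1 : ℤ) ≤ I.M.n := by have := I.M.init.2; omega
  have hD1 := I.one_le_commonDen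
  have hR : (1 : ℤ) ≤ 2 * (I.M.n : ℤ) ^ 2 * I.commonDen := by nlinarith
  have hmono : ∀ k ≤ I.M.n, 2 * (2 * (I.M.n : ℤ) ^ 2 * I.commonDen) ^ k ≤ 2 ^ e := by
    intro k hk
    have := pow_le_pow_right₀ hR hk
    have := h.pow_le
    omega
  have hlv := Matrix.abs_leVerrier_le hD
  have hB : ∀ k ≤ I.M.n, ∀ s t, |((Matrix.leVerrier A k).1 + (Matrix.leVerrier A k).2 • 1) s t| ≤
      2 * (2 * (I.M.n : ℤ) ^ 2 * I.commonDen) ^ k := by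
    intro k hk s t
    have h0 := (hlv k).2
    have h3 : |(Matrix.leVerrier A k).2 * (1 : Matrix (Fin I.M.n) (Fin I.M.n) ℤ) s t| ≤
        (2 * (I.M.n : ℤ) ^ 2 * I.commonDen) ^ k := by
      rw [Matrix.one_apply]
      split_ifs
      · simpa using h0
      · simpa using (abs_nonneg _).trans h0
    have := abs_add_le ((Matrix.leVerrier A k).1 s t)
      ((Matrix.leVerrier A k).2 * (1 : Matrix (Fin I.M.n) (Fin I.M.n) ℤ) s t)
    have := (hlv k).1 s t
    simp only [Matrix.add_apply, Matrix.smul_apply, smul_eq_mul]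
    linarith
  rw [ApproxProgram.leVerrier, ensures_seq_iff, ensures_assign_iff]
  refine ⟨by simp, h.intLen_le (k := 0) PowBound.one, ?_⟩
  refine ensures_loop I.M.n (fun k τ => Holds (τ.arr .N) (Matrix.leVerrier A k).1 ∧
    τ.scal .c = (Matrix.leVerrier A k).2 ∧ ∀ l, l + 1 = k → Holds (τ.arr .M)
      ((Matrix.leVerrier A l).1 + (Matrix.leVerrier A l).2 • 1))
    (by simp) (by simp [hn]) (by omega) ⟨?_, ?_, ?_⟩ ?_ ?_
  · intro s t; simpa [Matrix.leVerrier] using hN s t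
  · simp [Matrix.leVerrier]
  · intro l hl; omega
  · rintro k hk τ fr ⟨hτ, hc, -⟩
    have hn₁ : τ.scal .n = I.M.n := (fr.scal .n (by decide)).trans (by simpa using hn)
    have hA₁ : τ.arr .A = σ.arr .A := fr.arr .A (by decide)
    refine (h.addScalar (σ := τ.set .k k) (N := (Matrix.leVerrier A k).1)
      (b := (2 * (I.M.n : ℤ) ^ 2 * I.commonDen) ^ k) (by simpa using hn₁) (by simpa using hτ)
      (hlv k).1 (by simpa [hc] using (hlv k).2) (hmono k hk.le)).seq fun υ fr₂ hυ => ?_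
    have hn₂ : υ.scal .n = I.M.n := (fr₂.scal .n (by decide)).trans (by simpa using hn₁)
    have hA₂ : υ.arr .A = σ.arr .A := (fr₂.arr .A (by decide)).trans (by simpa using hA₁)
    have hk₂ : υ.scal .k = k := (fr₂.scal .k (by decide)).trans (by simp)
    simp only [State.set_scal, reduceCtorEq, if_false, hc] at hυ
    refine (h.multiply (σ := υ) hn₂ (by rw [hA₂]; exact hA) hυ hD (hB k hk.le) ?_).seq
      fun ω fr₃ hω => ?_
    -- The product of `n`, `n`, the bound for `A` and twice the bound for round `k` is precisely the
    -- bound for the next round.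
    · have := hmono (k + 1) hk
      rw [pow_succ] at this
      refine le_trans ?_ this
      have h0 : (0 : ℤ) ≤ (2 * (I.M.n : ℤ) ^ 2 * I.commonDen) ^ k := by positivity
      nlinarith [mul_nonneg h0 (by positivity : 0 ≤ (I.M.n : ℤ) ^ 2 * I.commonDen)]
    have hk₃ : ω.scal .k = k := (fr₃.scal .k (by decide)).trans hk₂
    have hM₃ : ω.arr .M = υ.arr .M := fr₃.arr .M (by decide)
    have e1 : (0 - v .acc / (v .k + 1) : E).eval X ω = (Matrix.leVerrier A (k + 1)).2 := by
      simp [hk₃, hω.2, Matrix.leVerrier]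
    rw [ensures_assign_iff, e1]
    refine ⟨by simp, h.intLen_le (k := 1) ?_, ?_, by simp, ?_⟩
    · rw [PowBound, mul_one]
      have := (hlv (k + 1)).2
      have := abs_nonneg (Matrix.leVerrier A (k + 1)).2
      have := hmono (k + 1) hk
      omega
    · exact hω.1
    · rintro l hl
      obtain rfl : l = k := by omega
      simpa [hM₃] using hυ
  · rintro τ - ⟨hτ, hc, hM⟩
    obtain ⟨l, hl⟩ : ∃ l, l + 1 = I.M.n := ⟨I.M.n - 1, by omega⟩
    refine ⟨_, hM l hl, ?_, ?_, ?_, ?_⟩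
    · rw [Matrix.mul_leVerrier A (by simpa using hl), hc, hl]
    · rw [hc]
      intro hdet
      have := Matrix.leVerrier_ne_zero A hdet
      rwa [Fintype.card_fin] at this
    · rw [hc]
      have := (hlv I.M.n).2
      have := abs_nonneg (Matrix.leVerrier A I.M.n).2
      have := hmono I.M.n le_rfl
      omega
    · intro s t
      exact (hB l (by omega) s t).trans (hmono l (by omega))

end Setting

end ApproxProgram

/-! ## Candidates for the outcomes -/

/-- This is `1` if the value `f i` has not occurred before, and `0` otherwise. -/
def firstOcc (f : ℕ → ℚ) (i : ℕ) : ℤ := if f i ∈ (Finset.range i).image f then 0 else 1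

/-- Each value contributes at its first occurrence only. The number of outcomes and the rank of an
outcome are sums of this kind, so duplicates need not be removed. -/
theorem sum_firstOcc (f : ℕ → ℚ) (p : ℚ → Prop) [DecidablePred p] (m : ℕ) :
    ∑ j ∈ Finset.range m with p (f j), firstOcc f j =
      ((((Finset.range m).image f).filter p).card : ℤ) := by
  induction m with
  | zero => simp
  | succ m ih =>
    rw [Finset.range_add_one, Finset.filter_insert, Finset.image_insert, Finset.filter_insert]
    by_cases hp : p (f m)
    · rw [if_pos hp, if_pos hp, Finset.sum_insert (by simp), ih, firstOcc]
      by_cases hm : f m ∈ (Finset.range m).image f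
      · rw [if_pos hm, Finset.insert_eq_of_mem (Finset.mem_filter.2 ⟨hm, hp⟩), zero_add]
      · rw [if_neg hm, Finset.card_insert_of_notMem (by simp_all)]
        push_cast
        ring
    · rw [if_neg hp, if_neg hp, ih]

namespace ApproxInstance

variable (I : ApproxInstance)

/-- The candidates for the outcomes: the rewards of all states, and then `0`. -/
def candidate (i : ℕ) : ℚ := if h : i < I.M.n then I.reward ⟨i, h⟩ else 0

/-- The probability that a target is hit first at `s`, scaled by `c * c`. -/
def targetWeight (c : ℤ) (B : Matrix (Fin I.M.n) (Fin I.M.n) ℤ) (s : Fin I.M.n) : ℤ :=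
  if s ∈ I.Φ.F then -(I.commonDen * c * B I.M.init s) else 0

/-- The weights of the candidates: the last one carries the probability of not hitting a target. -/
def weight (c : ℤ) (B : Matrix (Fin I.M.n) (Fin I.M.n) ℤ) (i : ℕ) : ℤ :=
  if h : i < I.M.n then I.targetWeight c B ⟨i, h⟩ else c * c - ∑ s, I.targetWeight c B s

end ApproxInstance

namespace ApproxProgram

open Loop Loop.Expr Loop.Stmt

variable {I : ApproxInstance} {X : Context} {e : ℕ} {σ : State Var Arr}

/-- The candidates and their weights are stored. -/
structure Stored (I : ApproxInstance) (f : ℕ → ℤ) (σ : State Var Arr) : Prop where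
  num : ∀ i ≤ I.M.n, σ.arr .num 0 i = (I.candidate i).num
  den : ∀ i ≤ I.M.n, σ.arr .den 0 i = (I.candidate i).den
  wt : ∀ i ≤ I.M.n, σ.arr .wt 0 i = f i

theorem Stored.congr {f : ℕ → ℤ} {τ : State Var Arr} (h : Stored I f σ)
    (h1 : τ.arr .num = σ.arr .num) (h2 : τ.arr .den = σ.arr .den) (h3 : τ.arr .wt = σ.arr .wt) :
    Stored I f τ :=
  ⟨by rw [h1]; exact h.num, by rw [h2]; exact h.den, by rw [h3]; exact h.wt⟩

namespace Setting

theorem num_small (h : Setting I X e) (i : ℕ) : PowBound e 1 (I.candidate i).num := by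
  rw [ApproxInstance.candidate]
  split_ifs
  · rw [← I.encode_rewardNum]; exact h.small _
  · exact PowBound.zero

theorem den_small (h : Setting I X e) (i : ℕ) : PowBound e 1 (I.candidate i).den := by
  rw [ApproxInstance.candidate]
  split_ifs
  · rw [← I.encode_rewardDen]; exact h.small _
  · exact PowBound.one

theorem targetWeight_small (h : Setting I X e) {c : ℤ} {B : Matrix (Fin I.M.n) (Fin I.M.n) ℤ}
    (hc : PowBound e 1 c) (hB : ∀ s t, PowBound e 1 (B s t)) (s : Fin I.M.n) :
    PowBound e 3 (I.targetWeight c B s) := by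
  have hD : PowBound e 1 I.commonDen := by
    rw [PowBound, mul_one]; exact h.commonDen_small
  rw [ApproxInstance.targetWeight]
  split_ifs
  · exact ((hD.mul hc).mul (hB _ _)).neg
  · exact PowBound.zero

theorem rest_small (h : Setting I X e) {c : ℤ} {B : Matrix (Fin I.M.n) (Fin I.M.n) ℤ}
    (hc : PowBound e 1 c) (hB : ∀ s t, PowBound e 1 (B s t)) (p : Fin I.M.n → Prop)
    [DecidablePred p] : PowBound e 5 (c * c - ∑ s with p s, I.targetWeight c B s) := by
  refine ((hc.mul hc).mono (by norm_num)).sub h.one_le (k := 4)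
    (PowBound.sum ?_ fun s _ => h.targetWeight_small hc hB s)
  refine (Finset.card_le_univ _).trans ?_
  rw [Fintype.card_fin]
  exact h.lt.le

theorem weight_small (h : Setting I X e) {c : ℤ} {B : Matrix (Fin I.M.n) (Fin I.M.n) ℤ}
    (hc : PowBound e 1 c) (hB : ∀ s t, PowBound e 1 (B s t)) (i : ℕ) :
    PowBound e 5 (I.weight c B i) := by
  rw [ApproxInstance.weight]
  split_ifs
  · exact (h.targetWeight_small hc hB _).mono (by norm_num)
  · have := h.rest_small hc hB fun s => Fin.val s < I.M.n
    rwa [Fin.sum_filter_lt_self] at this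

theorem candidates (h : Setting I X e) (hn : σ.scal .n = I.M.n) (hD : σ.scal .D = I.commonDen)
    (hinit : σ.scal .init = (I.M.init : ℕ)) {c : ℤ} (hc : σ.scal .c = c)
    {B : Matrix (Fin I.M.n) (Fin I.M.n) ℤ} (hB : Holds (σ.arr .M) B) (hcs : PowBound e 1 c)
    (hBs : ∀ s t, PowBound e 1 (B s t)) :
    candidates.Ensures X σ fun τ => Stored I (I.weight c B) τ ∧ τ.scal .W = c * c := by
  have hL := h.L
  have hS := h.S
  have hlt := h.lt
  rw [ApproxProgram.candidates, ensures_seq_iff, ensures_assign_iff]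
  refine ⟨by simp, h.intLen_le (k := 2) (by simpa [hc] using hcs.mul hcs), ?_⟩
  rw [ensures_seq_iff, ensures_assign_iff]
  refine ⟨by simp, h.intLen_le (k := 2) (by simpa [hc] using hcs.mul hcs), ?_⟩
  refine Ensures.seq (Q := fun τ =>
    (∀ s : Fin I.M.n, τ.arr .num 0 s = (I.reward s).num) ∧
    (∀ s : Fin I.M.n, τ.arr .den 0 s = (I.reward s).den) ∧
    (∀ s : Fin I.M.n, τ.arr .wt 0 s = I.targetWeight c B s) ∧
    τ.scal .rest = c * c - ∑ s, I.targetWeight c B s) ?_ ?_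
  · refine ensures_loop I.M.n (fun i τ =>
      (∀ s : Fin I.M.n, (s : ℕ) < i → τ.arr .num 0 s = (I.reward s).num) ∧
      (∀ s : Fin I.M.n, (s : ℕ) < i → τ.arr .den 0 s = (I.reward s).den) ∧
      (∀ s : Fin I.M.n, (s : ℕ) < i → τ.arr .wt 0 s = I.targetWeight c B s) ∧
      τ.scal .rest = c * c - ∑ s : Fin I.M.n with Fin.val s < i, I.targetWeight c B s)
      (by simp) (by simp [hn]) (by omega) (by simp [hc]) ?_ ?_
    · rintro i hi τ fr ⟨h1, h2, h3, h4⟩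
      set i' : Fin I.M.n := ⟨i, hi⟩ with hi'
      have hn₁ : τ.scal .n = I.M.n := (fr.scal .n (by decide)).trans (by simpa using hn)
      have hD₁ : τ.scal .D = I.commonDen := (fr.scal .D (by decide)).trans (by simpa using hD)
      have hc₁ : τ.scal .c = c := (fr.scal .c (by decide)).trans (by simpa using hc)
      have hinit₁ : τ.scal .init = (I.M.init : ℕ) :=
        (fr.scal .init (by decide)).trans (by simpa using hinit)
      have hM₁ : τ.arr .M = σ.arr .M := fr.arr .M (by decide)
      have e1 : (rewardNum (v .i)).eval X (τ.set .i i) = (I.reward i').num :=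
        eval_rewardNum h (by simp [hn₁]) (by simp [hi'])
      rw [ensures_seq_iff, ensures_store_iff, e1]
      refine ⟨by simp; omega, by simp, h.intLen_le (k := 1) ?_, ?_⟩
      · rw [← I.encode_rewardNum]; exact h.small _
      simp only [eval_ofNat, eval_var, State.set_scal, if_true, Int.toNat_natCast]
      set τ₁ := (τ.set .i i).put .num 0 i (I.reward i').num with hτ₁
      have e2 : (rewardDen (v .i)).eval X τ₁ = (I.reward i').den :=
        eval_rewardDen h (by simp [hn₁, hτ₁]) (by simp [hi', hτ₁])
      rw [ensures_seq_iff, ensures_store_iff, e2]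
      refine ⟨by simp [hτ₁]; omega, by simp, h.intLen_le (k := 1) ?_, ?_⟩
      · rw [← I.encode_rewardDen]; exact h.small _
      rw [show ((v .i : E).eval X τ₁).toNat = i by simp [hτ₁],
        show ((0 : E).eval X τ₁).toNat = 0 by simp]
      set τ₂ := τ₁.put .den 0 i (I.reward i').den with hτ₂
      have e3 : (flag (v .i)).eval X τ₂ = if i' ∈ I.Φ.F then 1 else 0 :=
        eval_flag h (by simp [hn₁, hτ₁, hτ₂]) (by simp [hi', hτ₁, hτ₂])
      have e4 : (0 - v .D * v .c * get .M (v .init) (v .i) * flag (v .i) : E).eval X τ₂ =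
          I.targetWeight c B i' := by
        have h5 := hB I.M.init i'
        simp only [hi'] at h5
        rw [eval_sub, eval_mul, e3]
        simp only [eval_ofNat, eval_mul, eval_var, eval_arr, hτ₂, hτ₁, State.put_scal, State.put_arr,
          State.set_scal, State.set_arr, hinit₁, hD₁, hc₁, hM₁, ApproxInstance.targetWeight]
        simp only [reduceCtorEq, if_false, if_true, false_and, Int.toNat_natCast, h5]
        split_ifs <;> simp [hi']
      rw [ensures_seq_iff, ensures_store_iff, e4]
      have hw := h.targetWeight_small hcs hBs i'
      have hinit_lt := I.M.init.2
      refine ⟨by simp [hτ₁, hτ₂]; omega, by simp [hτ₁, hτ₂, hinit₁]; omega, h.intLen_le hw, ?_⟩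
      rw [show ((v .i : E).eval X τ₂).toNat = i by simp [hτ₁, hτ₂],
        show ((0 : E).eval X τ₂).toNat = 0 by simp]
      set τ₃ := τ₂.put .wt 0 i (I.targetWeight c B i') with hτ₃
      have e5 : (v .rest - get .wt 0 (v .i) : E).eval X τ₃ =
          c * c - ∑ s : Fin I.M.n with Fin.val s < i + 1, I.targetWeight c B s := by
        rw [Fin.sum_filter_lt_succ _ hi]
        simp [hτ₁, hτ₂, hτ₃, State.put_arr, h4]
        ring
      rw [ensures_assign_iff, e5]
      refine ⟨by simp [hτ₁, hτ₂, hτ₃]; omega, h.intLen_le (h.rest_small hcs hBs _), ?_, ?_, ?_,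
        by simp⟩ <;> intro s hs
      all_goals
        simp only [hτ₁, hτ₂, hτ₃, State.put_arr, State.set_arr, reduceCtorEq, false_and, if_false,
          true_and]
        by_cases hsi : (s : ℕ) = i
        · obtain rfl : s = i' := Fin.ext hsi
          rw [if_pos hsi]
        · rw [if_neg hsi]
          first
          | exact h1 s (by omega)
          | exact h2 s (by omega)
          | exact h3 s (by omega)
    · rintro τ - ⟨h1, h2, h3, h4⟩
      rw [Fin.sum_filter_lt_self] at h4
      exact ⟨fun s => h1 s s.2, fun s => h2 s s.2, fun s => h3 s s.2, h4⟩
  · rintro τ fr ⟨h1, h2, h3, h4⟩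
    have hn₁ : τ.scal .n = I.M.n := (fr.scal .n (by decide)).trans (by simpa using hn)
    have hW₁ : τ.scal .W = c * c := (fr.scal .W (by decide)).trans (by simp [hc])
    have hr := h.rest_small hcs hBs fun s => Fin.val s < I.M.n
    rw [Fin.sum_filter_lt_self, ← h4] at hr
    simp only [ensures_seq_iff, ensures_store_iff, ok_arr, ok_ofNat, ok_var, eval_ofNat, eval_var,
      State.put_scal, hn₁]
    refine ⟨by simp; omega, trivial, h.intLen_le (k := 0) PowBound.zero, by simp; omega, trivial,
      h.intLen_le (k := 0) PowBound.one, by simp; omega, trivial, h.intLen_le hr, ⟨?_, ?_, ?_⟩, hW₁⟩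
    all_goals
      intro i hi
      simp only [State.put_arr, ApproxInstance.candidate, ApproxInstance.weight, reduceCtorEq,
        false_and, if_false, true_and]
      by_cases hin : i < I.M.n
      · first
        | simpa [hin, hin.ne] using h1 ⟨i, hin⟩
        | simpa [hin, hin.ne] using h2 ⟨i, hin⟩
        | simpa [hin, hin.ne] using h3 ⟨i, hin⟩
      · obtain rfl : i = I.M.n := by omega
        simp [h4]

theorem eval_diff {f : ℕ → ℤ} (hσ : Stored I f σ) {i j : E} {k l : ℕ} (hk : k ≤ I.M.n)
    (hl : l ≤ I.M.n) (hi : i.eval X σ = k) (hj : j.eval X σ = l) : (diff i j).eval X σ =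
      (I.candidate k).num * (I.candidate l).den - (I.candidate l).num * (I.candidate k).den := by
  simp [diff, hi, hj, hσ.num k hk, hσ.num l hl, hσ.den k hk, hσ.den l hl]

theorem diff_small (h : Setting I X e) (k l : ℕ) : PowBound e 3
    ((I.candidate k).num * (I.candidate l).den - (I.candidate l).num * (I.candidate k).den) :=
  ((h.num_small k).mul (h.den_small l)).sub h.one_le ((h.num_small l).mul (h.den_small k))

theorem diff_pos_iff (p q : ℚ) : 0 < p.num * q.den - q.num * p.den ↔ q < p := by
  rw [Rat.lt_iff, sub_pos]

/-- The language can only test for positivity. For an integer `x`, the number `1 - x * x` is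
positive exactly if `x = 0`. -/
theorem one_sub_diff_mul_diff_pos_iff (p q : ℚ) :
    0 < 1 - (p.num * q.den - q.num * p.den) * (p.num * q.den - q.num * p.den) ↔ q = p := by
  have h : q = p ↔ p.num * q.den - q.num * p.den = 0 := by
    rw [sub_eq_zero, Rat.eq_iff_mul_eq_mul]
    exact eq_comm
  rw [h]
  constructor
  · intro h1
    by_contra h2
    have := Int.one_le_abs h2
    nlinarith [abs_mul_abs_self (p.num * q.den - q.num * p.den)]
  · intro h1; rw [h1]; norm_num

theorem representatives (h : Setting I X e) (hn : σ.scal .n = I.M.n) {f : ℕ → ℤ}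
    (hσ : Stored I f σ) : representatives.Ensures X σ fun τ =>
      (∀ i ≤ I.M.n, τ.arr .rep 0 i = firstOcc I.candidate i) ∧
      τ.scal .len = ((Finset.range (I.M.n + 1)).image I.candidate).card := by
  have hL := h.L
  have hS := h.S
  have hlt := h.lt
  rw [ApproxProgram.representatives, ensures_seq_iff, ensures_assign_iff]
  refine ⟨by simp, h.intLen_le (k := 0) PowBound.zero, ?_⟩
  refine ensures_loop (I.M.n + 1) (fun i τ =>
    (∀ k < i, τ.arr .rep 0 k = firstOcc I.candidate k) ∧
      τ.scal .len = ((Finset.range i).image I.candidate).card) (by simp) (by simp [hn]) (by omega)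
      (by simp) ?_ (fun τ _ hτ => ⟨fun i hi => hτ.1 i (by omega), hτ.2⟩)
  rintro i hi τ fr ⟨h1, h2⟩
  have hn₁ : τ.scal .n = I.M.n := (fr.scal .n (by decide)).trans (by simpa using hn)
  have hτ : Stored I f τ :=
    hσ.congr (fr.arr .num (by decide)) (fr.arr .den (by decide)) (fr.arr .wt (by decide))
  rw [ensures_seq_iff, ensures_assign_iff]
  refine ⟨by simp, h.intLen_le (k := 0) PowBound.one, ?_⟩
  refine Ensures.seq (Q := fun υ => υ.scal .r = firstOcc I.candidate i) ?_ ?_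
  · refine ensures_loop i (fun j υ => υ.scal .r =
      if I.candidate i ∈ (Finset.range j).image I.candidate then 0 else 1) (by simp) (by simp)
      (by omega) (by simp) ?_ (fun υ _ hυ => hυ)
    intro j hj υ fr₂ hυ
    have hi₂ : υ.scal .i = i := (fr₂.scal .i (by decide)).trans (by simp)
    have hυs : Stored I f υ :=
      hτ.congr (fr₂.arr .num (by decide)) (fr₂.arr .den (by decide)) (fr₂.arr .wt (by decide))
    have e1 := eval_diff (X := X) (σ := υ.set .j j) (hυs.congr rfl rfl rfl) (i := v .i) (j := v .j)
      (k := i) (l := j) (by omega) (by omega) (by simp [hi₂]) (by simp)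
    rw [ensures_seq_iff, ensures_assign_iff, e1]
    refine ⟨by simp [diff, hi₂]; omega, h.intLen_le (h.diff_small i j), ?_⟩
    rw [ensures_ite_iff]
    simp only [eval_sub, eval_mul, eval_ofNat, eval_var, State.set_scal, if_true, Nat.cast_one,
      one_sub_diff_mul_diff_pos_iff]
    refine ⟨by simp, fun heq => ?_, fun hne => ?_⟩
    · rw [ensures_assign_iff]
      refine ⟨by simp, h.intLen_le (k := 0) PowBound.zero, ?_⟩
      rw [if_pos (Finset.mem_image.2 ⟨j, by simp, heq⟩)]
      simp
    · rw [ensures_skip_iff]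
      simp only [State.set_scal, reduceCtorEq, if_false, hυ]
      simp only [Finset.range_add_one, Finset.image_insert, Finset.mem_insert, Ne.symm hne,
        false_or]
  · intro υ fr₂ hυ
    have hi₂ : υ.scal .i = i := (fr₂.scal .i (by decide)).trans (by simp)
    have hl₂ : υ.scal .len = τ.scal .len := (fr₂.scal .len (by decide)).trans (by simp)
    have hr₂ : υ.arr .rep = τ.arr .rep := fr₂.arr .rep (by decide)
    have hf : PowBound e 0 (firstOcc I.candidate i) := by
      rw [firstOcc]
      split_ifs
      exacts [PowBound.zero, PowBound.one]
    rw [ensures_seq_iff, ensures_store_iff, eval_var, hυ]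
    refine ⟨by simp [hi₂]; omega, by simp, h.intLen_le hf, ?_⟩
    have e1 : τ.scal .len + firstOcc I.candidate i =
        ((Finset.range (i + 1)).image I.candidate).card := by
      have h3 := sum_firstOcc I.candidate (fun _ => True) i
      have h4 := sum_firstOcc I.candidate (fun _ => True) (i + 1)
      rw [Finset.filter_true, Finset.filter_true] at h3 h4
      rw [h2, ← h3, ← h4, Finset.sum_range_succ]
    rw [ensures_assign_iff]
    simp only [eval_add, eval_var, State.put_scal, hl₂, hυ, e1]
    refine ⟨by simp, h.intLen_le (k := 1) (PowBound.natCast ?_), ?_, by simp⟩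
    · refine Finset.card_image_le.trans ?_
      rw [Finset.card_range]; omega
    · intro k hk
      simp only [State.set_arr, State.put_arr, eval_ofNat, hi₂, Int.toNat_natCast, true_and, hr₂]
      by_cases hki : k = i
      · subst hki; simp
      · simpa [hki] using h1 k (by omega)

end Setting

end ApproxProgram

/-! ## The rows of the query -/

/-- A query lists numerators and denominators in lowest terms; this lemma and the next one show that
a single gcd produces both. -/
theorem Rat.num_div_intCast {w W : ℤ} (hW : 0 < W) : ((w : ℚ) / W).num = w / (Int.gcd w W : ℤ) := by
  rw [← Rat.divInt_eq_div, Rat.num_divInt, Int.sign_eq_one_of_pos hW, one_mul, Int.gcd_comm]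

theorem Rat.den_div_intCast {w W : ℤ} (hW : 0 < W) :
    (((w : ℚ) / W).den : ℤ) = W / (Int.gcd w W : ℤ) := by
  rw [← Rat.divInt_eq_div, Rat.den_divInt, if_neg hW.ne', Int.gcd_comm]
  push_cast
  rw [abs_of_pos hW]

namespace ApproxInstance

variable (I : ApproxInstance)

/-- The number of outcomes below `o`. -/
def rank (o : ℚ) : ℕ := (((Finset.range (I.M.n + 1)).image I.candidate).filter (· < o)).card

theorem rank_le (i : ℕ) (hi : i ≤ I.M.n) : I.rank (I.candidate i) ≤ I.M.n := by
  have h : ((Finset.range (I.M.n + 1)).image I.candidate).filter (· < I.candidate i) ⊂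
      (Finset.range (I.M.n + 1)).image I.candidate := by
    refine Finset.filter_ssubset.2 ⟨I.candidate i, Finset.mem_image_of_mem _ ?_, lt_irrefl _⟩
    simpa using Nat.lt_succ_of_le hi
  have h1 := Finset.card_lt_card h
  have h2 := (Finset.card_image_le (s := Finset.range (I.M.n + 1)) (f := I.candidate))
  rw [Finset.card_range] at h2
  rw [rank]
  omega

theorem rank_lt {i : ℕ} (hi : i ≤ I.M.n) {o : ℚ} (h : I.candidate i < o) :
    I.rank (I.candidate i) < I.rank o := by
  refine Finset.card_lt_card ⟨fun q hq => ?_, fun hsub => ?_⟩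
  · simp only [Finset.mem_filter] at hq ⊢
    exact ⟨hq.1, hq.2.trans h⟩
  · have h2 : I.candidate i ∈ Finset.image I.candidate (Finset.range (I.M.n + 1)) :=
      Finset.mem_image_of_mem _ (by simpa using Nat.lt_succ_of_le hi)
    have := hsub (Finset.mem_filter.2 ⟨h2, h⟩)
    simp at this

/-- Rank is strictly increasing in the value; hence rows of different outcomes never overwrite each
other. -/
theorem eq_of_rank_eq {i j : ℕ} (hi : i ≤ I.M.n) (hj : j ≤ I.M.n)
    (h : I.rank (I.candidate i) = I.rank (I.candidate j)) : I.candidate i = I.candidate j := by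
  rcases lt_trichotomy (I.candidate i) (I.candidate j) with h1 | h1 | h1
  · have := I.rank_lt hi h1; omega
  · exact h1
  · have := I.rank_lt hj h1; omega

/-- The total weight of the candidates with value `o`. -/
def totalWeight (f : ℕ → ℤ) (o : ℚ) : ℤ :=
  ∑ j ∈ Finset.range (I.M.n + 1) with I.candidate j = o, f j

end ApproxInstance

namespace ApproxProgram

open Loop Loop.Expr Loop.Stmt

variable {I : ApproxInstance} {X : Context} {e : ℕ} {σ : State Var Arr}

/-- The rows of the query that belong to the value `o` are stored. -/
def RowStored (I : ApproxInstance) (f : ℕ → ℤ) (W : ℤ) (g : ℕ → ℤ) (o : ℚ) : Prop :=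
  g (3 + 4 * I.rank o) = o.num ∧ g (4 + 4 * I.rank o) = o.den ∧
    g (5 + 4 * I.rank o) = ((I.totalWeight f o : ℚ) / W).num ∧
    g (6 + 4 * I.rank o) = ((I.totalWeight f o : ℚ) / W).den

namespace Setting

theorem rankAndWeight (h : Setting I X e) (hn : σ.scal .n = I.M.n) {f : ℕ → ℤ}
    (hσ : Stored I f σ) (hf : ∀ i, PowBound e 5 (f i))
    (hrep : ∀ i ≤ I.M.n, σ.arr .rep 0 i = firstOcc I.candidate i) {i : ℕ} (hi : i ≤ I.M.n)
    (hσi : σ.scal .i = i) : rankAndWeight.Ensures X σ fun τ =>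
      τ.scal .rank = I.rank (I.candidate i) ∧
      τ.scal .w = I.totalWeight f (I.candidate i) := by
  have hL := h.L
  have hS := h.S
  have hlt := h.lt
  rw [ApproxProgram.rankAndWeight, ensures_seq_iff, ensures_assign_iff]
  refine ⟨by simp, h.intLen_le (k := 0) PowBound.zero, ?_⟩
  rw [ensures_seq_iff, ensures_assign_iff]
  refine ⟨by simp, h.intLen_le (k := 0) PowBound.zero, ?_⟩
  refine ensures_loop (I.M.n + 1) (fun m τ =>
    τ.scal .rank = ∑ j ∈ Finset.range m with I.candidate j < I.candidate i, firstOcc I.candidate j ∧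
    τ.scal .w = ∑ j ∈ Finset.range m with I.candidate j = I.candidate i, f j) (by simp)
    (by simp [hn]) (by omega) (by simp) ?_ ?_
  · rintro j hj τ fr ⟨h1, h2⟩
    have hi₁ : τ.scal .i = i := (fr.scal .i (by decide)).trans (by simpa using hσi)
    have hτ : Stored I f τ :=
      hσ.congr (fr.arr .num (by decide)) (fr.arr .den (by decide)) (fr.arr .wt (by decide))
    have hr₁ : τ.arr .rep 0 j = firstOcc I.candidate j := by
      rw [fr.arr .rep (by decide)]
      exact hrep j (by omega)
    have e1 := eval_diff (X := X) (σ := τ.set .j j) (hτ.congr rfl rfl rfl) (i := v .i) (j := v .j)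
      (k := i) (l := j) (by omega) (by omega) (by simp [hi₁]) (by simp)
    rw [ensures_seq_iff, ensures_assign_iff, e1]
    refine ⟨by simp [diff, hi₁]; omega, h.intLen_le (h.diff_small i j), ?_⟩
    set x := (I.candidate i).num * (I.candidate j).den - (I.candidate j).num * (I.candidate i).den
      with hx
    have hxr : (∑ k ∈ Finset.range (j + 1) with I.candidate k < I.candidate i,
        firstOcc I.candidate k) = (∑ k ∈ Finset.range j with I.candidate k < I.candidate i,
        firstOcc I.candidate k) + if 0 < x then firstOcc I.candidate j else 0 := by
      simp only [hx, diff_pos_iff, Finset.sum_filter, Finset.sum_range_succ]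
    have hxw : (∑ k ∈ Finset.range (j + 1) with I.candidate k = I.candidate i, f k) =
        (∑ k ∈ Finset.range j with I.candidate k = I.candidate i, f k) +
        if 0 < 1 - x * x then f j else 0 := by
      simp only [hx, one_sub_diff_mul_diff_pos_iff, Finset.sum_filter, Finset.sum_range_succ]
    have hcard : ∀ (p : ℕ → Prop) [DecidablePred p],
        ((Finset.range (j + 1)).filter p).card ≤ e := by
      intro p _
      refine (Finset.card_filter_le _ _).trans ?_
      rw [Finset.card_range]; omega
    have hbr : PowBound e 1 (∑ k ∈ Finset.range (j + 1) with I.candidate k < I.candidate i,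
        firstOcc I.candidate k) := by
      refine PowBound.sum (k := 0) (hcard _) fun k _ => ?_
      rw [firstOcc]
      split_ifs
      exacts [PowBound.zero, PowBound.one]
    have hbw : PowBound e 6 (∑ k ∈ Finset.range (j + 1) with I.candidate k = I.candidate i, f k) :=
      PowBound.sum (k := 5) (hcard _) fun k _ => hf k
    refine Ensures.seq (Q := fun υ => υ.scal .x = x ∧ υ.scal .w = τ.scal .w ∧
      υ.scal .j = j ∧ υ.scal .rank = ∑ k ∈ Finset.range (j + 1) with
        I.candidate k < I.candidate i, firstOcc I.candidate k) ?_ ?_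
    · rw [ensures_ite_iff]
      simp only [eval_var, State.set_scal, if_true]
      refine ⟨by simp, fun hpos => ?_, fun hneg => ?_⟩
      · have e2 : (v .rank + get .rep 0 (v .j) : E).eval X ((τ.set .j j).set .x x) =
            ∑ k ∈ Finset.range (j + 1) with I.candidate k < I.candidate i,
              firstOcc I.candidate k := by
          rw [hxr, if_pos hpos]
          simp [h1, hr₁]
        rw [ensures_assign_iff, e2]
        exact ⟨by simp; omega, h.intLen_le hbr, by simp⟩
      · rw [ensures_skip_iff, hxr, if_neg hneg]
        simp [h1]
    · rintro υ fr₂ ⟨hυx, hυw, hυj, hυr⟩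
      rw [ensures_ite_iff]
      simp only [eval_var, eval_sub, eval_mul, eval_ofNat, hυx, Nat.cast_one]
      refine ⟨by simp, fun hpos => ?_, fun hneg => ?_⟩
      · have hw₂ : υ.arr .wt 0 j = f j := by
          rw [fr₂.arr .wt (by decide)]
          exact hτ.wt j (by omega)
        have e2 : (v .w + get .wt 0 (v .j) : E).eval X υ =
            ∑ k ∈ Finset.range (j + 1) with I.candidate k = I.candidate i, f k := by
          rw [hxw, if_pos hpos]
          simp [h2, hυw, hυj, hw₂]
        rw [ensures_assign_iff, e2]
        exact ⟨by simp [hυj]; omega, h.intLen_le hbw, by simpa using hυr, by simp⟩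
      · rw [ensures_skip_iff, hxw, if_neg hneg, hυw, h2, add_zero]
        exact ⟨hυr, rfl⟩
  · rintro τ - ⟨h1, h2⟩
    refine ⟨?_, h2⟩
    rw [h1, sum_firstOcc I.candidate (· < I.candidate i) (I.M.n + 1)]
    rfl

/-- Once `b < a`, a step replaces `(a, b)` by `(b, a % b)` with `2 * (a % b) ≤ a`, so the product `a
* b` is at least halved. It is at most `W * W < 2 ^ (2 * s)` after the first step, hence it is `0`
after `2 * s` more steps, and `a` is then the gcd. The first step is treated separately because `w`
is not compared with `W` beforehand. -/
theorem euclid (h : Setting I X e) {w W : ℤ} {s : ℕ} (hσw : σ.scal .w = w) (hσW : σ.scal .W = W)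
    (hσs : σ.scal .size = s) (hw : PowBound e 6 w) (hW : 0 < W) (hWb : PowBound e 6 W)
    (hs : W < 2 ^ s) (hsL : 2 * s + 1 ≤ X.L) :
    euclid.Ensures X σ fun τ => τ.scal .a = Int.gcd w W := by
  rw [ApproxProgram.euclid, ensures_seq_iff, ensures_assign_iff]
  refine ⟨by simp, by simpa [hσw] using h.intLen_le hw, ?_⟩
  rw [ensures_seq_iff, ensures_assign_iff]
  refine ⟨by simp, by simpa [hσW] using h.intLen_le hWb, ?_⟩
  refine ensures_loop (2 * s + 1) (fun k τ => Int.gcd (τ.scal .a) (τ.scal .b) = Int.gcd w W ∧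
    0 ≤ τ.scal .b ∧ (k = 0 → τ.scal .a = w ∧ τ.scal .b = W) ∧ ∀ l, l + 1 = k →
      τ.scal .b < τ.scal .a ∧ τ.scal .a ≤ W ∧ τ.scal .a * τ.scal .b * 2 ^ l ≤ W * W) (by simp)
      (by simp [hσs]) hsL ?_ ?_ ?_
  · refine ⟨by simp [hσw, hσW], by simpa [hσW] using hW.le, by simp [hσw, hσW], ?_⟩
    intro l hl; omega
  · rintro k hk τ - ⟨h1, h2, h3, h4⟩
    rw [ensures_ite_iff]
    simp only [eval_var, State.set_scal, reduceCtorEq, if_false]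
    refine ⟨by simp, fun hpos => ?_, fun hneg => ?_⟩
    · have hb : PowBound e 6 (τ.scal .b) := by
        refine hWb.of_abs_le ?_
        rw [abs_of_pos hpos, abs_of_pos hW]
        rcases Nat.eq_zero_or_eq_succ_pred k with h0 | h0
        · exact (h3 h0).2.le
        · obtain ⟨h5, h6, -⟩ := h4 _ h0.symm
          omega
      have hmod := Int.emod_nonneg (τ.scal .a) hpos.ne'
      have hmod2 := Int.emod_lt_of_pos (τ.scal .a) hpos
      have hmod3 := Int.mul_ediv_add_emod (τ.scal .a) (τ.scal .b)
      have e1 : (v .a - v .b * (v .a / v .b) : E).eval X (τ.set .j k) =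
          τ.scal .a % τ.scal .b := by
        rw [Int.emod_def]
        simp
      rw [ensures_seq_iff, ensures_assign_iff, e1]
      refine ⟨by simp, h.intLen_le (k := 6) (hb.of_abs_le ?_), ?_⟩
      · rw [abs_of_nonneg hmod, abs_of_pos hpos]; exact hmod2.le
      rw [ensures_seq_iff, ensures_assign_iff]
      refine ⟨by simp, h.intLen_le (k := 6) (by simpa using hb), ?_⟩
      rw [ensures_assign_iff]
      refine ⟨by simp, h.intLen_le (k := 6) (hb.of_abs_le ?_), ?_⟩
      · simp only [eval_var, State.set_scal, reduceCtorEq, if_false, if_true]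
        rw [abs_of_nonneg hmod, abs_of_pos hpos]; exact hmod2.le
      simp only [eval_var, State.set_scal, reduceCtorEq, if_false, if_true]
      refine ⟨?_, hmod, by simp, ?_⟩
      · rw [← h1, Int.gcd_comm (τ.scal .b), Int.gcd_emod]
      · intro l hl
        obtain rfl : l = k := by omega
        rcases Nat.eq_zero_or_eq_succ_pred l with h0 | h0
        · obtain ⟨h5, h6⟩ := h3 h0
          subst h0
          refine ⟨hmod2, h6.le, ?_⟩
          rw [pow_zero, mul_one, ← h6]
          exact mul_le_mul_of_nonneg_left hmod2.le hpos.le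
        · obtain ⟨h5, h6, h7⟩ := h4 _ h0.symm
          refine ⟨hmod2, h5.le.trans h6, ?_⟩
          refine le_trans ?_ h7
          conv_lhs => rw [h0]
          rw [pow_succ]
          have hq : 1 ≤ τ.scal .a / τ.scal .b := Int.le_ediv_of_mul_le hpos (by omega)
          have h8 : 2 * (τ.scal .a % τ.scal .b) ≤ τ.scal .a := by nlinarith
          have h9 : (0 : ℤ) ≤ τ.scal .b * 2 ^ l.pred := by positivity
          nlinarith [mul_le_mul_of_nonneg_left h8 h9]
    -- Here `b = 0` already; this cannot be the first round, in which `b = W > 0`.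
    · rw [ensures_skip_iff]
      simp only [State.set_scal, reduceCtorEq, if_false]
      have hb0 : τ.scal .b = 0 := le_antisymm (not_lt.1 hneg) h2
      have hk0 : k ≠ 0 := fun h0 => hneg (by rw [(h3 h0).2]; exact hW)
      obtain ⟨h5, h6, -⟩ := h4 (k - 1) (by omega)
      refine ⟨h1, h2, by simp, fun l _ => ⟨h5, h6, ?_⟩⟩
      rw [hb0]
      simpa using mul_self_nonneg W
  · rintro τ - ⟨h1, h2, -, h4⟩
    obtain ⟨h5, h6, h7⟩ := h4 _ rfl
    have hb0 : τ.scal .b = 0 := by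
      by_contra hne
      have h8 : 1 ≤ τ.scal .a * τ.scal .b := by
        have : 1 ≤ τ.scal .b := by omega
        nlinarith
      have h9 : W * W < 2 ^ (2 * s) := by
        rw [two_mul, pow_add]
        exact mul_lt_mul'' hs hs hW.le hW.le
      have h10 : (0 : ℤ) < 2 ^ (2 * s) := by positivity
      nlinarith
    rw [hb0] at h1 h5
    rw [← h1, Int.gcd_zero_right, Int.natCast_natAbs, abs_of_pos h5]

theorem rows (h : Setting I X e) (hn : σ.scal .n = I.M.n) {f : ℕ → ℤ}
    (hσ : Stored I f σ) (hf : ∀ i, PowBound e 5 (f i))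
    (hrep : ∀ i ≤ I.M.n, σ.arr .rep 0 i = firstOcc I.candidate i) {W : ℤ} (hσW : σ.scal .W = W)
    (hW : 0 < W) (hWb : PowBound e 2 W) : rows.Ensures X σ fun τ =>
      ∀ i ≤ I.M.n, RowStored I f W (τ.arr .query 0) (I.candidate i) := by
  have hL := h.L
  have hS := h.S
  have hlt := h.lt
  have hsize : W.toNat.size ≤ 2 * e + 1 := by
    have := hWb.size_le
    rwa [mul_comm] at this
  have hsize2 : W < 2 ^ W.toNat.size := by
    have h1 := Nat.lt_size_self W.toNat
    have h2 : W = (W.toNat : ℤ) := (Int.toNat_of_nonneg hW.le).symm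
    rw [h2]
    exact_mod_cast h1
  rw [ApproxProgram.rows, ensures_seq_iff, ensures_size_iff]
  refine ⟨by simp, ?_, ?_⟩
  · rw [eval_var, hσW]
    exact intLen_natCast_le (by omega) (by omega)
  rw [eval_var, hσW]
  refine ensures_loop (I.M.n + 1) (fun i τ =>
    ∀ k < i, RowStored I f W (τ.arr .query 0) (I.candidate k)) (by simp) (by simp [hn]) (by omega)
    (by simp) ?_ (fun τ _ hτ i hi => hτ i (by omega))
  intro i hi τ fr hτ
  have hn₁ : τ.scal .n = I.M.n := (fr.scal .n (by decide)).trans (by simpa using hn)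
  have hW₁ : τ.scal .W = W := (fr.scal .W (by decide)).trans (by simpa using hσW)
  have hs₁ : τ.scal .size = W.toNat.size := (fr.scal .size (by decide)).trans (by simp)
  have hτs : Stored I f τ :=
    hσ.congr (fr.arr .num (by decide)) (fr.arr .den (by decide)) (fr.arr .wt (by decide))
  have hr₁ : τ.arr .rep = σ.arr .rep := fr.arr .rep (by decide)
  refine (h.rankAndWeight (σ := τ.set .i i) (by simpa using hn₁) (hτs.congr rfl rfl rfl) hf
    (by simpa [hr₁] using hrep) (i := i) (by omega) (by simp)).seq ?_
  rintro υ fr₂ ⟨hrank, hw⟩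
  have hW₂ : υ.scal .W = W := (fr₂.scal .W (by decide)).trans (by simpa using hW₁)
  have hs₂ : υ.scal .size = W.toNat.size := (fr₂.scal .size (by decide)).trans (by simpa using hs₁)
  have hi₂ : υ.scal .i = i := (fr₂.scal .i (by decide)).trans (by simp)
  have hυs : Stored I f υ :=
    hτs.congr (fr₂.arr .num (by decide)) (fr₂.arr .den (by decide)) (fr₂.arr .wt (by decide))
  have hq₂ : υ.arr .query = τ.arr .query := fr₂.arr .query (by decide)
  set w := I.totalWeight f (I.candidate i) with hwdef
  have hwb : PowBound e 6 w := by
    refine PowBound.sum (k := 5) ?_ fun k _ => hf k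
    refine (Finset.card_filter_le _ _).trans ?_
    rw [Finset.card_range]; omega
  refine (h.euclid (σ := υ) hw hW₂ hs₂ hwb hW (hWb.mono (by norm_num)) hsize2 (by omega)).seq ?_
  intro ω fr₃ ha
  have hW₃ : ω.scal .W = W := (fr₃.scal .W (by decide)).trans hW₂
  have hw₃ : ω.scal .w = w := (fr₃.scal .w (by decide)).trans hw
  have hi₃ : ω.scal .i = i := (fr₃.scal .i (by decide)).trans hi₂
  have hrank₃ : ω.scal .rank = I.rank (I.candidate i) := (fr₃.scal .rank (by decide)).trans hrank
  have hωs : Stored I f ω :=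
    hυs.congr (fr₃.arr .num (by decide)) (fr₃.arr .den (by decide)) (fr₃.arr .wt (by decide))
  have hq₃ : ω.arr .query = τ.arr .query := (fr₃.arr .query (by decide)).trans hq₂
  have hrk := I.rank_le i (by omega)
  set r := I.rank (I.candidate i) with hr
  have hidx : ∀ m : ℕ, ((m : ℤ) + 4 * (r : ℤ)).toNat = m + 4 * r := by intro m; omega
  have e1 := hidx 3
  have e2 := hidx 4
  have e3 := hidx 5
  have e4 := hidx 6
  simp only [Nat.cast_ofNat] at e1 e2 e3 e4
  simp only [ensures_seq_iff, ensures_store_iff, ok_arr, ok_ofNat, ok_var, ok_add, ok_mul, ok_div,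
    eval_add, eval_mul, eval_div, eval_ofNat, eval_arr, eval_var, State.put_scal, State.put_arr,
    hrank₃, hi₃, hw₃, hW₃, ha, Nat.cast_ofNat, Nat.cast_zero, Int.toNat_zero, Int.toNat_natCast,
    e1, e2, e3, e4, reduceCtorEq, false_and, if_false, true_and,
    hωs.num i (by omega), hωs.den i (by omega)]
  rw [← Rat.num_div_intCast hW, ← Rat.den_div_intCast hW]
  refine ⟨by omega, by omega, h.intLen_le (h.num_small i), by omega, by omega,
    h.intLen_le (h.den_small i), by omega, ?_, by omega, ?_, ?_⟩
  · rw [Rat.num_div_intCast hW]; exact h.intLen_le hwb.div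
  · rw [Rat.den_div_intCast hW]; exact h.intLen_le hWb.div
  · intro k hk
    -- An earlier row of the same value has just been rewritten with the same content; one of a
    -- different value has a different rank and is untouched.
    by_cases hki : I.candidate k = I.candidate i
    · rw [hki]
      simp [RowStored, State.put_arr, ← hr, ← hwdef]
    · have hkr : I.rank (I.candidate k) ≠ r := fun h0 =>
        hki (I.eq_of_rank_eq (by omega) (by omega) h0)
      have hk' : k < i := lt_of_le_of_ne (by omega) fun h0 => hki (by rw [h0])
      obtain ⟨g1, g2, g3, g4⟩ := hτ k hk'
      refine ⟨?_, ?_, ?_, ?_⟩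
      all_goals
        simp only [State.put_arr, true_and, hq₃]
        rw [if_neg (by omega), if_neg (by omega), if_neg (by omega), if_neg (by omega)]
        assumption

end Setting

end ApproxProgram

/-! ## The query and its answer -/

namespace ApproxInstance

variable (I : ApproxInstance)

/-- The states that are no targets contribute only the candidate `0`, which is an outcome anyway. -/
theorem image_candidate : (Finset.range (I.M.n + 1)).image I.candidate = I.Φ.outcomes := by
  ext o
  simp only [Finset.mem_image, Finset.mem_range, WRObjective.outcomes, Finset.mem_insert,
    Finset.mem_univ, true_and]
  constructor
  · rintro ⟨i, hi, rfl⟩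
    rw [candidate]
    split_ifs with hin
    · rw [reward]
      split_ifs with hF
      · exact Or.inr ⟨_, rfl⟩
      · exact Or.inl rfl
    · exact Or.inl rfl
  · rintro (rfl | ⟨⟨s, hs⟩, rfl⟩)
    · exact ⟨I.M.n, by omega, by simp [candidate]⟩
    · exact ⟨s, by omega, by simp [candidate, reward, hs]⟩

theorem totalWeight_weight (c : ℤ) (B : Matrix (Fin I.M.n) (Fin I.M.n) ℤ) (o : ℚ) :
    I.totalWeight (I.weight c B) o =
      ∑ t with I.Φ.r t = o, -(I.commonDen * c * B I.M.init t.1) +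
        if o = 0 then c * c - ∑ t : {s // s ∈ I.Φ.F}, -(I.commonDen * c * B I.M.init t.1) else 0 := by
  have h1 : ∀ p : Fin I.M.n → ℤ, (∀ s, s ∉ I.Φ.F → p s = 0) →
      ∑ s, p s = ∑ t : {s // s ∈ I.Φ.F}, p t.1 := by
    intro p hp
    rw [Finset.sum_coe_sort I.Φ.F p]
    exact (Finset.sum_subset (Finset.subset_univ _) fun s _ hs => hp s hs).symm
  have h2 : ∑ s, I.targetWeight c B s =
      ∑ t : {s // s ∈ I.Φ.F}, -(I.commonDen * c * B I.M.init t.1) := by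
    rw [h1 _ fun s hs => by rw [targetWeight, if_neg hs]]
    exact Finset.sum_congr rfl fun t _ => by rw [targetWeight, if_pos t.2]
  have h3 : ∑ s, (if I.reward s = o then I.targetWeight c B s else 0) =
      ∑ t with I.Φ.r t = o, -(I.commonDen * c * B I.M.init t.1) := by
    rw [h1 _ fun s hs => by rw [targetWeight, if_neg hs, ite_self], Finset.sum_filter]
    refine Finset.sum_congr rfl fun t _ => ?_
    rw [targetWeight, if_pos t.2, reward, dif_pos t.2]
  rw [← h2, ← h3, totalWeight, Finset.sum_filter, Finset.sum_range_succ, ← Fin.sum_univ_eq_sum_range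
    (fun j => if I.candidate j = o then I.weight c B j else 0)]
  congr 1
  · refine Finset.sum_congr rfl fun s _ => ?_
    simp [candidate, weight]
  · simp [candidate, weight, eq_comm]

/-- The distribution of the value of a path, computed from the weights of the candidates. -/
theorem cast_totalWeight_div {c : ℤ} {B : Matrix (Fin I.M.n) (Fin I.M.n) ℤ} (hc : c ≠ 0)
    (hB : I.reachMatrix * B = -(c • (1 : Matrix (Fin I.M.n) (Fin I.M.n) ℤ))) (o : ℚ) :
    (((I.totalWeight (I.weight c B) o : ℚ) / (c * c : ℤ) : ℚ) : ℝ) =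
      I.M.pathMeasure.real {ρ | I.Φ.value ρ = o} := by
  have hD : I.commonDen ≠ 0 := by have := I.one_le_commonDen; omega
  have hcc : ((c * c : ℤ) : ℝ) ≠ 0 := by exact_mod_cast mul_ne_zero hc hc
  have h : ∀ t : {s // s ∈ I.Φ.F}, I.M.pathMeasure.real (I.M.firstHit I.Φ.F t.1) =
      ((-(I.commonDen * c * B I.M.init t.1) : ℤ) : ℝ) / ((c * c : ℤ) : ℝ) :=
    fun t => I.isReachMatrix.firstHit_eq hD hc hB t.2
  rw [I.M.measureReal_value_eq, totalWeight_weight]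
  simp only [h]
  rw [← Finset.sum_div, ← Finset.sum_div, Rat.cast_div, Rat.cast_intCast, Rat.cast_intCast]
  push_cast
  rw [add_div]
  congr 1
  push_cast at hcc
  split_ifs
  · rw [sub_div, div_self hcc]
  · simp

end ApproxInstance

/-! ## Digits -/

theorem RAM.digit_encodeIntBits_zero (m : ℤ) :
    0 < RAM.digit (encodeIntBits m) 0 - 1 ↔ m < 0 := by
  by_cases h : m < 0 <;> simp [RAM.digit, encodeIntBits, h]

theorem RAM.digit_cons_succ (b : Bool) (l : List Bool) (j : ℕ) :
    RAM.digit (b :: l) (j + 1) = RAM.digit l j := rfl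

/-- `Nat.bits` has no superfluous zeros, so a digit exists at position `i` exactly if the number is
at least `2 ^ i`. -/
theorem RAM.digit_bits_pos_iff (k i : ℕ) : 0 < RAM.digit k.bits i ↔ 2 ^ i ≤ k := by
  rw [← Nat.lt_size, ← Nat.size_eq_bits_len, RAM.digit]
  by_cases h : i < k.bits.length
  · rw [List.getElem?_eq_getElem h]
    cases k.bits[i] <;> simp [h]
  · rw [List.getElem?_eq_none (not_lt.1 h)]
    simpa using not_lt.1 h

theorem RAM.digit_bits_sub_one_pos_iff (k i : ℕ) : 0 < RAM.digit k.bits i - 1 ↔ k.testBit i := by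
  rw [Nat.testBit_eq_inth, List.getI_eq_getElem?_getD, RAM.digit]
  rcases k.bits[i]? with _ | _ | _ <;> simp

theorem Nat.mod_two_pow_succ_eq (k i : ℕ) :
    k % 2 ^ (i + 1) = k % 2 ^ i + if k.testBit i then 2 ^ i else 0 := by
  rw [Nat.mod_pow_succ, Nat.testBit_eq_decide_div_mod_eq]
  rcases Nat.mod_two_eq_zero_or_one (k / 2 ^ i) with h | h <;> simp [h]

/-- As `w ≥ 1`, both `b * w` and `|m| * w` exceed `|u|`, so in either difference the sign of `m`
decides. -/
theorem saturate_mul_sub_pos_iff {m u w b : ℤ} (hw : 1 ≤ w) (hu : |u| < b) (hm : b ≤ |m|) :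
    0 < (if m < 0 then -b else b) * w - u ↔ 0 < m * w - u := by
  obtain ⟨h1, h2⟩ := abs_lt.1 hu
  have hb : 0 ≤ b := by omega
  have h3 : b ≤ b * w := le_mul_of_one_le_right hb hw
  split_ifs with h
  · rw [abs_of_neg h] at hm
    have h4 : b * w ≤ -m * w := mul_le_mul_of_nonneg_right hm (by omega)
    rw [neg_mul] at h4 ⊢
    constructor <;> intro _ <;> omega
  · rw [abs_of_nonneg (not_lt.1 h)] at hm
    have h4 : b * w ≤ m * w := mul_le_mul_of_nonneg_right hm (by omega)
    constructor <;> intro _ <;> omega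

namespace ApproxProgram

open Loop Loop.Expr Loop.Stmt

variable {I : ApproxInstance} {X : Context} {e : ℕ} {σ : State Var Arr}

namespace Setting

theorem ask (h : Setting I X e) (hn : σ.scal .n = I.M.n)
    (hlen : σ.scal .len = ((Finset.range (I.M.n + 1)).image I.candidate).card) {f : ℕ → ℤ} {W : ℤ}
    (hrow : ∀ i ≤ I.M.n, RowStored I f W (σ.arr .query 0) (I.candidate i))
    (hp : ∀ o, (((I.totalWeight f o : ℚ) / W : ℚ) : ℝ) = I.M.pathMeasure.real {ρ | I.Φ.value ρ = o}) :
    ask.Ensures X σ fun τ => τ.ans =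
      X.O ((I.M.prospect I.Φ (fun o => (I.totalWeight f o : ℚ) / W) hp).encodeQuery I.ε) := by
  have hL := h.L
  have hS := h.S
  have hlt := h.lt
  have hcard := Finset.card_image_le (s := Finset.range (I.M.n + 1)) (f := I.candidate)
  rw [Finset.card_range] at hcard
  rw [I.image_candidate] at hlen hcard
  have t0 : PowBound e 1 I.ε.num := by
    have := I.encode_tail 0
    rw [show I.ε.num = _ from this.symm]; exact h.small _
  have t1 : PowBound e 1 I.ε.den := by
    have := I.encode_tail 1
    rw [show (I.ε.den : ℤ) = _ from this.symm]; exact h.small _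
  rw [ApproxProgram.ask, ensures_seq_iff, ensures_store_iff]
  refine ⟨by simp; omega, by simp, ?_, ?_⟩
  · simp only [eval_add, eval_mul, eval_ofNat, eval_var, hlen]
    exact_mod_cast intLen_natCast_le (i := 2 + 4 * I.Φ.outcomes.card) (by omega) (by omega)
  set σ₁ := σ.put .query ((0 : E).eval X σ).toNat ((0 : E).eval X σ).toNat
    ((2 + 4 * v .len : E).eval X σ) with hσ₁
  have e1 : (tail 0).eval X σ₁ = I.ε.num := eval_tail h (by simpa [hσ₁] using hn) 0
  rw [ensures_seq_iff, ensures_store_iff, e1]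
  refine ⟨by simp; omega, by simp, h.intLen_le t0, ?_⟩
  set σ₂ := σ₁.put .query ((0 : E).eval X σ₁).toNat ((1 : E).eval X σ₁).toNat I.ε.num with hσ₂
  have e2 : (tail 1).eval X σ₂ = I.ε.den := eval_tail h (by simpa [hσ₁, hσ₂] using hn) 1
  rw [ensures_seq_iff, ensures_store_iff, e2]
  refine ⟨by simp; omega, by simp, h.intLen_le t1, ?_⟩
  set σ₃ := σ₂.put .query ((0 : E).eval X σ₂).toNat ((2 : E).eval X σ₂).toNat I.ε.den with hσ₃
  have hq : ∀ j, σ₃.arr .query 0 j = if j = 2 then (I.ε.den : ℤ) else if j = 1 then I.ε.num else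
      if j = 0 then 2 + 4 * (I.Φ.outcomes.card : ℤ) else σ.arr .query 0 j := by
    intro j
    simp [hσ₃, hσ₂, hσ₁, State.put_arr, hlen]
  have hq0 : (σ₃.arr .query 0 0).toNat = 2 + 4 * I.Φ.outcomes.card := by
    rw [hq]; simp; omega
  rw [ensures_query_iff, hq0]
  -- There are at most `n + 1` outcomes, so the query and its length take at most `1 + 2 + 4 * (n +
  -- 1) = 4 * n + 7` of the `4 * n + 8` columns.
  refine ⟨by omega, ?_⟩
  change X.O _ = X.O _
  rw [State.block, hq0]
  congr 1
  refine I.M.map_range_eq_encodeQuery I.Φ _ hp I.ε _ (by rw [hq]; simp) (by rw [hq]; simp) ?_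
  rintro o ho r rfl
  rw [← I.image_candidate, Finset.mem_image] at ho
  obtain ⟨i, hi, rfl⟩ := ho
  have hrow := hrow i (by simpa [Nat.lt_succ_iff] using hi)
  rw [RowStored, ApproxInstance.rank, I.image_candidate] at hrow
  set r := (I.Φ.outcomes.filter (· < I.candidate i)).card
  simp only [hq]
  obtain ⟨g1, g2, g3, g4⟩ := hrow
  rw [show 1 + (2 + 4 * r) = 3 + 4 * r by omega, show 1 + (3 + 4 * r) = 4 + 4 * r by omega,
    show 1 + (4 + 4 * r) = 5 + 4 * r by omega, show 1 + (5 + 4 * r) = 6 + 4 * r by omega]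
  refine ⟨?_, ?_, ?_, ?_⟩
  all_goals
    rw [if_neg (by omega), if_neg (by omega), if_neg (by omega)]
    assumption

theorem decode (h : Setting I X e) (hn : σ.scal .n = I.M.n) {m : ℤ}
    (hans : σ.ans = encodeIntBits m) : decode.Ensures X σ fun τ =>
      0 < τ.scal .res ↔ 0 < m * (I.ε.num * I.v.den) - I.v.num * I.ε.den := by
  have hL := h.L
  have hS := h.S
  have hlt := h.lt
  have t0 : PowBound e 1 I.ε.num := by
    have := I.encode_tail 0
    rw [show I.ε.num = _ from this.symm]; exact h.small _
  have t1 : PowBound e 1 I.ε.den := by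
    have := I.encode_tail 1
    rw [show (I.ε.den : ℤ) = _ from this.symm]; exact h.small _
  have t2 : PowBound e 1 I.v.num := by
    have := I.encode_tail 2
    rw [show I.v.num = _ from this.symm]; exact h.small _
  have t3 : PowBound e 1 I.v.den := by
    have := I.encode_tail 3
    rw [show (I.v.den : ℤ) = _ from this.symm]; exact h.small _
  set u := I.v.num * I.ε.den with hu
  set k := m.natAbs with hk
  have hub : PowBound e 2 u := t2.mul t1
  have huub : PowBound e 4 (u * u) := hub.mul hub
  set s := (u * u).toNat.size with hs
  have hse : s ≤ 4 * e + 1 := by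
    have := huub.size_le
    rwa [mul_comm e 4] at this
  -- `|u| ≤ u * u` holds for every integer.
  have hus : |u| < 2 ^ s := by
    have h1 := Nat.lt_size_self (u * u).toNat
    have h2 : u * u < 2 ^ s := by
      rw [← Int.toNat_of_nonneg (mul_self_nonneg u)]
      exact_mod_cast h1
    rw [← abs_mul_abs_self] at h2
    rcases eq_or_ne u 0 with h3 | h3
    · rw [h3, abs_zero]; positivity
    · have := Int.one_le_abs h3
      nlinarith
  have hpow : ∀ j ≤ s, PowBound e 5 (2 ^ j) := by
    intro j hj
    rw [PowBound, abs_of_pos (by positivity)]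
    exact pow_le_pow_right₀ (by norm_num) (by have := h.one_le; omega)
  have hmodb : ∀ j ≤ s, PowBound e 5 ((k % 2 ^ j : ℕ) : ℤ) := by
    intro j hj
    refine (hpow j hj).of_abs_le ?_
    rw [Nat.abs_cast, abs_of_pos (by positivity)]
    exact_mod_cast (Nat.mod_lt k (by positivity)).le
  rw [ApproxProgram.decode, ensures_seq_iff, ensures_assign_iff]
  have e0 : (tail 2 * tail 1 : E).eval X σ = u := by
    rw [eval_mul, eval_tail h hn, eval_tail h hn]; rfl
  rw [e0]
  refine ⟨by simp, h.intLen_le hub, ?_⟩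
  rw [ensures_seq_iff, ensures_size_iff]
  have e1 : ((v .u * v .u : E).eval X (σ.set .u u)).toNat.size = s := by simp [hs]
  rw [e1]
  refine ⟨by simp, intLen_natCast_le (by omega) (by omega), ?_⟩
  rw [ensures_seq_iff, ensures_assign_iff]
  refine ⟨by simp, h.intLen_le (k := 0) PowBound.one, ?_⟩
  rw [ensures_seq_iff, ensures_assign_iff]
  refine ⟨by simp, h.intLen_le (k := 0) PowBound.zero, ?_⟩
  refine Ensures.seq (Q := fun τ => τ.scal .acc = (k % 2 ^ s : ℕ) ∧ τ.scal .p = 2 ^ s) ?_ ?_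
  · refine ensures_loop s (fun j τ => τ.scal .acc = (k % 2 ^ j : ℕ) ∧ τ.scal .p = 2 ^ j) (by simp)
      (by simp) (by omega) (by simp [Nat.mod_one]) ?_ (fun τ _ hτ => hτ)
    rintro j hj τ fr ⟨h1, h2⟩
    have ha : τ.ans = encodeIntBits m := (fr.ans (by decide)).trans (by simpa using hans)
    refine Ensures.seq (Q := fun υ => υ.scal .acc = (k % 2 ^ (j + 1) : ℕ) ∧ υ.scal .p = 2 ^ j) ?_ ?_
    · have e2 : (digit (v .i + 1) - 1 : E).eval X (τ.set .i j) = RAM.digit k.bits j - 1 := by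
        simp only [eval_sub, eval_ans, eval_add, eval_var, State.set_scal, if_true, State.set_ans, ha]
        simp only [eval_ofNat, Nat.cast_one]
        rw [show ((j : ℤ) + 1).toNat = j + 1 by omega, encodeIntBits, RAM.digit_cons_succ]
      rw [ensures_ite_iff, e2, RAM.digit_bits_sub_one_pos_iff]
      have hmod := Nat.mod_two_pow_succ_eq k j
      refine ⟨by simp, fun hbit => ?_, fun hbit => ?_⟩
      · have e3 : (v .acc + v .p : E).eval X (τ.set .i j) = (k % 2 ^ (j + 1) : ℕ) := by
          rw [hmod, if_pos hbit]
          simp [h1, h2]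
        rw [ensures_assign_iff, e3]
        exact ⟨by simp, h.intLen_le (hmodb _ hj), by simpa using h2⟩
      · rw [ensures_skip_iff, hmod, if_neg hbit]
        simpa using ⟨h1, h2⟩
    · rintro υ - ⟨h1, h2⟩
      have e3 : (v .p * 2 : E).eval X υ = 2 ^ (j + 1) := by
        rw [pow_succ]; simp [h2]
      rw [ensures_assign_iff, e3]
      exact ⟨by simp, h.intLen_le (hpow _ hj), by simpa using h1, by simp⟩
  · rintro τ fr ⟨h1, h2⟩
    have hn₁ : τ.scal .n = I.M.n := (fr.scal .n (by decide)).trans (by simpa using hn)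
    have hu₁ : τ.scal .u = u := (fr.scal .u (by decide)).trans (by simp)
    have hs₁ : τ.scal .size = s := (fr.scal .size (by decide)).trans (by simp)
    have ha₁ : τ.ans = encodeIntBits m := (fr.ans (by decide)).trans (by simpa using hans)
    -- The minimum of `|m|` and `2 ^ s`.
    set q : ℕ := if 2 ^ s ≤ k then 2 ^ s else k with hq
    have hqb : PowBound e 5 (q : ℤ) := by
      rw [hq]
      split_ifs with h3
      · exact_mod_cast hpow s le_rfl
      · have := hmodb s le_rfl
        rwa [Nat.mod_eq_of_lt (not_le.1 h3)] at this
    refine Ensures.seq (Q := fun υ => υ.scal .acc = q) ?_ ?_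
    · have e2 : (digit (v .size + 1) : E).eval X τ = RAM.digit k.bits s := by
        simp only [eval_ans, eval_add, eval_var, ha₁, hs₁]
        simp only [eval_ofNat, Nat.cast_one]
        rw [show ((s : ℤ) + 1).toNat = s + 1 by omega, encodeIntBits, RAM.digit_cons_succ]
      rw [ensures_ite_iff, e2, RAM.digit_bits_pos_iff]
      refine ⟨by simp, fun hks => ?_, fun hks => ?_⟩
      · rw [hq, if_pos hks]
        rw [ensures_assign_iff]
        refine ⟨by simp, h.intLen_le (k := 5) ?_, ?_⟩
        · simpa [h2] using hpow s le_rfl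
        · simp [h2]
      · rw [ensures_skip_iff, h1, hq, if_neg hks, Nat.mod_eq_of_lt (not_le.1 hks)]
    · intro υ fr₂ hacc
      have hn₂ : υ.scal .n = I.M.n := (fr₂.scal .n (by decide)).trans hn₁
      have hu₂ : υ.scal .u = u := (fr₂.scal .u (by decide)).trans hu₁
      have ha₂ : υ.ans = encodeIntBits m := (fr₂.ans (by decide)).trans ha₁
      set q' : ℤ := if m < 0 then -(q : ℤ) else q with hq'
      have hqb' : PowBound e 5 q' := by
        rw [hq']
        split_ifs
        exacts [hqb.neg, hqb]
      refine Ensures.seq (Q := fun ω => ω.scal .acc = q') ?_ ?_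
      · have e2 : (digit 0 - 1 : E).eval X υ = RAM.digit (encodeIntBits m) 0 - 1 := by
          simp [ha₂]
        rw [ensures_ite_iff, e2, RAM.digit_encodeIntBits_zero]
        refine ⟨by simp, fun hm => ?_, fun hm => ?_⟩
        · rw [ensures_assign_iff]
          rw [hq', if_pos hm] at hqb' ⊢
          exact ⟨by simp, h.intLen_le (k := 5) (by simpa [hacc] using hqb'), by simp [hacc]⟩
        · rw [ensures_skip_iff, hacc, hq', if_neg hm]
      · intro ω fr₃ hacc₃
        have hn₃ : ω.scal .n = I.M.n := (fr₃.scal .n (by decide)).trans hn₂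
        have hu₃ : ω.scal .u = u := (fr₃.scal .u (by decide)).trans hu₂
        have e3 : (v .acc * (tail 0 * tail 3) - v .u : E).eval X ω =
            q' * (I.ε.num * I.v.den) - u := by
          rw [eval_sub, eval_mul, eval_mul, eval_tail h hn₃, eval_tail h hn₃]
          simp [hacc₃, hu₃]
        rw [ensures_assign_iff, e3]
        refine ⟨by simp, h.intLen_le (k := 8) ?_, ?_⟩
        · exact (hqb'.mul (t0.mul t3)).sub h.one_le (k := 7) (hub.mono (by norm_num))
        · simp only [State.set_scal, if_true]
          have hw : 1 ≤ I.ε.num * I.v.den := by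
            have h3 : 0 < I.ε.num := Rat.num_pos.2 I.ε_pos
            have h4 : (0 : ℤ) < I.v.den := by exact_mod_cast I.v.pos
            exact Int.add_one_le_iff.2 (mul_pos h3 h4)
          by_cases h3 : 2 ^ s ≤ k
          · have h4 : (2 : ℤ) ^ s ≤ |m| := by
              rw [Int.abs_eq_natAbs]
              exact_mod_cast h3
            rw [hq', hq, if_pos h3]
            push_cast
            exact saturate_mul_sub_pos_iff hw hus h4
          · have h4 : q' = m := by
              rw [hq', hq, if_neg h3, hk, Int.natCast_natAbs]
              split_ifs with hm
              · rw [abs_of_neg hm, neg_neg]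
              · rw [abs_of_nonneg (not_lt.1 hm)]
            rw [h4]

end Setting

end ApproxProgram

/-! ## Correctness of the program -/

/-- With its denominators cleared, the integer condition reads `v < m * ε`; since `m * ε` is within
`ε` of the CPT-value, both requirements follow. -/
theorem ApproxInstance.correct_of_approx {C : CPTParams} {I : ApproxInstance} {m z : ℤ}
    (hm : |(m : ℝ) * (I.ε : ℝ) - cptValue C I.M I.Φ| ≤ (I.ε : ℝ))
    (hz : 0 < z ↔ 0 < m * (I.ε.num * I.v.den) - I.v.num * I.ε.den) :
    I.Correct C (decide (0 < z)) := by
  have hiff : 0 < z ↔ (I.v : ℝ) < m * (I.ε : ℝ) := by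
    rw [hz, sub_pos]
    have h1 : (0 : ℝ) < I.ε.den := by exact_mod_cast I.ε.pos
    have h2 : (0 : ℝ) < I.v.den := by exact_mod_cast I.v.pos
    rw [Rat.cast_def I.v, Rat.cast_def I.ε, mul_div_assoc', div_lt_div_iff₀ h2 h1,
      ← Int.cast_lt (R := ℝ)]
    push_cast
    rw [mul_assoc]
  obtain ⟨h1, h2⟩ := abs_le.1 hm
  refine ⟨fun h => ?_, fun h => ?_⟩
  · rw [decide_eq_true_iff, hiff]; linarith
  · rw [decide_eq_false_iff_not, hiff]; linarith

namespace ApproxProgram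

open Loop Loop.Expr Loop.Stmt

variable {I : ApproxInstance} {X : Context} {e : ℕ}

theorem Setting.program (h : Setting I X e) {C : CPTParams} (hO : IsCPTOracle C X.O) :
    program.Ensures X (Loop.State.zero Var Arr) fun τ =>
      I.Correct C (decide (0 < τ.scal .res)) := by
  have hD0 : I.commonDen ≠ 0 := by have := I.one_le_commonDen; omega
  refine h.readSizes.seq fun σ₁ f₁ ⟨n₁, init₁⟩ => ?_
  refine (h.commonDenominator n₁).seq fun σ₂ f₂ D₂ => ?_
  have n₂ := (f₂.scal .n (by decide)).trans n₁
  have init₂ := (f₂.scal .init (by decide)).trans init₁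
  refine (h.reach n₂).seq fun σ₃ f₃ live₃ => ?_
  have n₃ := (f₃.scal .n (by decide)).trans n₂
  have init₃ := (f₃.scal .init (by decide)).trans init₂
  have D₃ := (f₃.scal .D (by decide)).trans D₂
  refine (h.matrix n₃ D₃ live₃).seq fun σ₄ f₄ A₄ => ?_
  have n₄ := (f₄.scal .n (by decide)).trans n₃
  have init₄ := (f₄.scal .init (by decide)).trans init₃
  have D₄ := (f₄.scal .D (by decide)).trans D₃
  -- No earlier part of the program writes to `N`, so it still holds the initial zeros.
  have N₄ : σ₄.arr .N = fun _ _ => 0 := by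
    rw [f₄.arr .N (by decide), f₃.arr .N (by decide), f₂.arr .N (by decide),
      f₁.arr .N (by decide)]
    rfl
  refine (h.leVerrier n₄ A₄ I.abs_reachMatrix_le fun i j => by rw [N₄]).seq
    fun σ₅ f₅ ⟨B, B₅, hAB, hc, hcb, hBb⟩ => ?_
  have n₅ := (f₅.scal .n (by decide)).trans n₄
  have init₅ := (f₅.scal .init (by decide)).trans init₄
  have D₅ := (f₅.scal .D (by decide)).trans D₄
  have hc := hc (I.isReachMatrix.det_ne_zero hD0)
  generalize c₅ : σ₅.scal .c = c at hAB hc hcb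
  have hcs : PowBound e 1 c := by rwa [PowBound, mul_one]
  have hBs : ∀ s t, PowBound e 1 (B s t) := fun s t => by rw [PowBound, mul_one]; exact hBb s t
  refine (h.candidates n₅ D₅ init₅ c₅ B₅ hcs hBs).seq fun σ₆ f₆ ⟨st₆, W₆⟩ => ?_
  have n₆ := (f₆.scal .n (by decide)).trans n₅
  refine (h.representatives n₆ st₆).seq fun σ₇ f₇ ⟨rep₇, len₇⟩ => ?_
  have n₇ := (f₇.scal .n (by decide)).trans n₆
  have W₇ := (f₇.scal .W (by decide)).trans W₆
  have st₇ := st₆.congr (f₇.arr .num (by decide)) (f₇.arr .den (by decide))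
    (f₇.arr .wt (by decide))
  have hW : 0 < c * c := mul_self_pos.2 hc
  refine (h.rows n₇ st₇ (h.weight_small hcs hBs) rep₇ W₇ hW (hcs.mul hcs)).seq
    fun σ₈ f₈ row₈ => ?_
  have n₈ := (f₈.scal .n (by decide)).trans n₇
  have len₈ := (f₈.scal .len (by decide)).trans len₇
  refine (h.ask n₈ len₈ row₈ (I.cast_totalWeight_div hc hAB)).seq fun σ₉ f₉ ans₉ => ?_
  have n₉ := (f₉.scal .n (by decide)).trans n₈
  obtain ⟨m, hm, hmε⟩ := hO (I.M.prospect I.Φ _ (I.cast_totalWeight_div hc hAB)) I.ε I.ε_pos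
  rw [I.M.prospect_cpt] at hmε
  exact (h.decode n₉ (ans₉.trans hm)).mono fun τ _ hτ => I.correct_of_approx hmε hτ

theorem Setting.valid (h : Setting I X e) (he : listSize I.encode ≤ e) : X.Valid := by
  have hL := h.L
  have hS := h.S
  have hlt := h.lt
  refine ⟨by omega, by omega, fun z hz => ?_⟩
  rw [h.input_eq] at hz
  have := ApproxInstance.intLen_le_listSize hz
  omega

/-- The exponent comes from the bound for the last LeVerrier iterate. As `n` and `n * n` are at most
`l`, the common denominator is at most `2 ^ (l ^ 2)` and `2 n²` is at most `2 ^ l`; the power `n ≤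
l` and the factor `2` lead to the exponent `l ^ 3 + l ^ 2 + 1`, and one more `l` is harmless. -/
theorem exists_setting (I : ApproxInstance) (O : Oracle) (l : ℕ) (hl : listSize I.encode = l) :
    Setting I ⟨O, I.encode, 4 * I.M.n + 8, 10 * (l ^ 3 + l ^ 2 + l + 1) + 10⟩
      (l ^ 3 + l ^ 2 + l + 1) := by
  have h1 : 6 + 2 * (I.M.n * I.M.n) + 3 * I.M.n ≤ l := by
    rw [← I.length_encode, ← hl]
    exact ApproxInstance.length_le_listSize _
  have hn : (1 : ℤ) ≤ I.M.n := by have := I.M.init.2; omega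
  have hD1 := I.one_le_commonDen
  refine ⟨rfl, rfl, rfl, fun k => ?_, by omega, by omega, ?_⟩
  · have := I.natAbs_getD_lt k
    rw [hl] at this
    rw [PowBound, Int.abs_eq_natAbs]
    have h2 : 2 ^ l ≤ 2 ^ ((l ^ 3 + l ^ 2 + l + 1) * 1) :=
      Nat.pow_le_pow_right two_pos (by omega)
    exact_mod_cast this.le.trans h2
  · have hD : I.commonDen ≤ 2 ^ (l ^ 2) := by
      calc I.commonDen ≤ ∏ _k ∈ Finset.range (I.M.n * I.M.n), (2 : ℤ) ^ l := by
            refine Finset.prod_le_prod (fun k hk => ?_) fun k _ => ?_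
            · have := I.one_le_getD_den (Finset.mem_range.1 hk)
              omega
            · have h2 := I.natAbs_getD_lt (3 + 2 * k)
              rw [hl] at h2
              refine (le_abs_self _).trans ?_
              rw [Int.abs_eq_natAbs]
              exact_mod_cast h2.le
        _ = 2 ^ (l * (I.M.n * I.M.n)) := by
            rw [Finset.prod_const, Finset.card_range, ← pow_mul]
        _ ≤ 2 ^ (l ^ 2) := by
            refine pow_le_pow_right₀ (by norm_num) ?_
            rw [sq]
            exact Nat.mul_le_mul_left l (by omega)
    have hn2 : 2 * (I.M.n : ℤ) ^ 2 ≤ 2 ^ l := by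
      have h2 : 2 * I.M.n ^ 2 ≤ 2 ^ l := by
        have := (Nat.lt_two_pow_self (n := l)).le
        rw [sq]; omega
      exact_mod_cast h2
    have hR : (2 * (I.M.n : ℤ) ^ 2 * I.commonDen) ≤ 2 ^ (l + l ^ 2) := by
      rw [pow_add]
      exact mul_le_mul hn2 hD (by omega) (by positivity)
    calc 2 * (2 * (I.M.n : ℤ) ^ 2 * I.commonDen) ^ I.M.n
        ≤ 2 * (2 ^ (l + l ^ 2)) ^ I.M.n := by
          gcongr
      _ = 2 ^ ((l + l ^ 2) * I.M.n + 1) := by rw [← pow_mul, mul_comm 2, ← pow_succ]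
      _ ≤ 2 ^ (l ^ 3 + l ^ 2 + l + 1) := by
          refine pow_le_pow_right₀ (by norm_num) ?_
          have h2 : (l + l ^ 2) * I.M.n ≤ (l + l ^ 2) * l := Nat.mul_le_mul_left _ (by omega)
          have h3 : (l + l ^ 2) * l = l ^ 3 + l ^ 2 := by ring
          omega

end ApproxProgram

theorem mainTheorem5 :
    ∃ (c : RAM.Cmd) (P : Polynomial ℕ),
      ∀ (C : CPTParams) (O : Oracle), IsCPTOracle C O →
        ∀ I : ApproxInstance, ∃ b : Bool,
          RAM.ReturnsWithin O c I.encode (P.eval (listSize I.encode)) b ∧ I.Correct C b := by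
  let p : Polynomial ℕ := 10 * (.X ^ 3 + .X ^ 2 + .X + 1) + 10
  have hp : ∀ l, p.eval l = 10 * (l ^ 3 + l ^ 2 + l + 1) + 10 := fun l => by simp [p]
  obtain ⟨P, hP⟩ := Loop.Stmt.exists_polynomial_cost ApproxProgram.program p
  -- The summand `20 * p` pays for the three commands that compute `S` before the program starts.
  refine ⟨ApproxProgram.program.toCmd, P + 20 * p, fun C O hO I => ?_⟩
  have h := ApproxProgram.exists_setting I O _ rfl
  have hX := h.valid (by omega)
  obtain ⟨z, hz, hret⟩ := Loop.Stmt.returnsWithin_toCmd (x := ApproxProgram.Var.res)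
    (n := I.M.n) (Q := fun z => I.Correct C (decide (0 < z))) hX ApproxProgram.fits_program rfl
    I.encode_zero rfl (h.program hO)
  refine ⟨_, ?_, hz⟩
  convert hret using 1
  simp only [Polynomial.eval_add, Polynomial.eval_mul, ← hP, hp, Polynomial.eval_ofNat]
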